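/- Let $T=\{T(x):x\in\mathbb S^2\}$ be a (jointly measurable) real-valued, centered, isotropic Gaussian random field on the unit sphere $\mathbb S^2\subset\mathbb R^3$ with $\mathbb E[T(x)^2]=1$. Here isotropic means that its finite-dimensional distributions are invariant under $SO(3)$. Let $\{Y_{lm}: l\ge 0,\ -l\le m\le l\}$ be the spherical harmonics and $dx$ the surface measure on $\mathbb S^2$. For $q\ge1$ let $H_q$ be the $q$-th Hermite polynomial (for the weight $e^{-z^2/2}$), and put $a_{lm;q}=\int_{\mathbb S^2}H_q(T(x))\overline{Y_{lm}(x)}\,dx$ and $\widetilde C^{(q)}_l=\mathbb E|a_{lm;q}|^2$, which does not depend on $m$. Put $C_l=\widetilde C^{(1)}_l$ (the angular power spectrum of $T$), and assume $C_l>0$ for every $l\ge0$. Put $\Gamma_l=(2l+1)C_l$ and $\Gamma_*=\sum_l\Gamma_l$, and $$\mathcal G\{l_1,m_1;\dots;l_r,m_r\}=\int_{\mathbb S^2}Y_{l_1m_1}(x)\cdots Y_{l_rm_r}(x)\,dx .$$ Let $C^{c0}_{a0b0}$ be the Clebsch--Gordan coefficients of $SO(3)$ with all magnetic numbers zero. Define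 $\widehat\Gamma_{1,l}=\Gamma_l$, $\widehat\Gamma_{n+1,l}=\sum_{L,k}\widehat\Gamma_{n,L}\Gamma_k(C^{l0}_{L0k0})^2$ and, for $p\ge2$, $$\widehat\Gamma^*_{p,l;l_1}=\sum_{l_2,\dots,l_p}\Gamma_{l_2}\cdots\Gamma_{l_p}\sum_{L_1,\dots,L_{p-2}}\bigl\{C^{L_10}_{l_10l_20}C^{L_20}_{L_10l_30}\cdots C^{l0}_{L_{p-2}0l_p0}\bigr\}^2 .$$ Fix $q\ge4$. Then $\sum_L\widehat\Gamma_{q-1,L}\widehat\Gamma^*_{2,l;L}=\widehat\Gamma_{q,l}$ for every $l$. Moreover, if $$\lim_{l\to\infty}\Bigl\{\sup_\lambda\frac{\widehat\Gamma_{q-1,\lambda}\widehat\Gamma^*_{2,l;\lambda}}{\widehat\Gamma_{q,l}}+\sup_\lambda\frac{\widehat\Gamma^*_{q,l;\lambda}\Gamma_\lambda}{\widehat\Gamma_{q,l}}\Bigr\}=0,$$ then for every fixed $m\in\mathbb Z$, as $l\to\infty$ (with $l\ge|m|$), $$(\widetilde C^{(q)}_l)^{-2}\sum_{j_1,n_1}\sum_{j_2,n_2}C_{j_1}C_{j_2}\Bigl|\sum_{l_1,m_1}\cdots\sum_{l_{q-1},m_{q-1}}C_{l_1}\cdots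 C_{l_{q-1}}\,\mathcal G\{l_1,m_1;\dots;l_{q-1},m_{q-1};j_1,n_1;l,-m\}\,\mathcal G\{l_1,m_1;\dots;l_{q-1},m_{q-1};j_2,n_2;l,-m\}\Bigr|^2\longrightarrow0 ,$$ where the sums run over all pairs $(l_i,m_i)$ and $(j_i,n_i)$ with $|m_i|\le l_i$ and $|n_i|\le j_i$. Finally, the two ratios in the hypothesis are $\mathbb P\{Z_{q-1}=\lambda\mid Z_q=l\}$ and $\mathbb P\{Z_1=\lambda\mid Z_q=l\}$ respectively, for any Markov chain $\{Z_n:n\ge1\}$ on $\mathbb N$ with $\mathbb P\{Z_1=l\}=\Gamma_l/\Gamma_*$ and $\mathbb P\{Z_{n+1}=l\mid Z_n=L\}=\sum_k(\Gamma_k/\Gamma_*)(C^{l0}_{k0L0})^2$. -/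

import Mathlib

open MeasureTheory ProbabilityTheory Filter Topology

namespace HighFreq

noncomputable section

/-- The unit sphere of Euclidean three-space. -/
abbrev S2 : Type := Metric.sphere (0 : EuclideanSpace ℝ (Fin 3)) 1

/-- The Lebesgue (surface) measure `dx` on the sphere, of total mass `4π`. -/
def surf : Measure S2 := (volume : Measure (EuclideanSpace ℝ (Fin 3))).toSphere

/-! ### Spherical harmonics and generalized Gaunt integrals -/

/-- The Legendre polynomial `P_l(x) = (2^l l!)⁻¹ (d/dx)^l (x² - 1)^l`. -/
def legendreP (l : ℕ) : Polynomial ℝ :=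
  Polynomial.C ((2 ^ l * (l.factorial : ℝ))⁻¹) *
    (Polynomial.derivative^[l]) ((Polynomial.X ^ 2 - 1) ^ l)

/-- The spherical harmonic of nonnegative order `m`. In spherical coordinates one has
`x + i y = sin θ * exp (i φ)` and `z = cos θ`, so that
`(-1)^m * P_l^(m)(z) * (x + i y)^m = P_{lm}(cos θ) * exp (i m φ)`, where
`P_{lm}(t) = (-1)^m (1 - t²)^(m/2) (d/dt)^m P_l(t)`. It vanishes for `m > l`. -/
def sphHarmNonneg (l m : ℕ) (x : S2) : ℂ :=
  ((Real.sqrt ((2 * (l : ℝ) + 1) / (4 * Real.pi) *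
      (((l - m).factorial : ℝ) / ((l + m).factorial : ℝ))) *
    ((-1 : ℝ) ^ m * ((Polynomial.derivative^[m]) (legendreP l)).eval (x.1 2)) : ℝ) : ℂ) *
    (((x.1 0 : ℝ) : ℂ) + ((x.1 1 : ℝ) : ℂ) * Complex.I) ^ m

/-- The spherical harmonic `Y_{lm}`; for `m < 0` it is `(-1)^m` times the conjugate of
`Y_{l,-m}`. -/
def sphHarm (l : ℕ) (m : ℤ) (x : S2) : ℂ :=
  if 0 ≤ m then sphHarmNonneg l m.toNat x
  else (-1 : ℂ) ^ m.natAbs * (starRingEnd ℂ) (sphHarmNonneg l m.natAbs x)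

/-- The index set `{(l, m) : l ≥ 0, -l ≤ m ≤ l}` of the spherical harmonics. -/
abbrev HarmIdx : Type := (l : ℕ) × (Finset.Icc (-(l : ℤ)) (l : ℤ))

/-- A harmonic index seen as a pair `(l, m)`. -/
def HarmIdx.pair (s : HarmIdx) : ℕ × ℤ := (s.1, (s.2 : ℤ))

/-- The generalized Gaunt integral
`𝒢{l₁,m₁;...;l_r,m_r} = ∫ Y_{l₁m₁}(x) ⋯ Y_{l_r m_r}(x) dx`. -/
def gaunt (s : List (ℕ × ℤ)) : ℂ :=
  ∫ x : S2, (s.map (fun i => sphHarm i.1 i.2 x)).prod ∂surf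

/-! ### Gaussian isotropic fields and Hermite subordination -/

/-- A jointly measurable, centered, unit-variance, isotropic, real Gaussian field on the sphere.
Isotropy: the finite-dimensional distributions are invariant under every rotation `g`. -/
structure IsIsotropicGaussianField {Ω : Type*} [MeasurableSpace Ω] (P : Measure Ω)
    (T : S2 → Ω → ℝ) : Prop where
  measurable : Measurable (Function.uncurry T)
  gaussian : IsGaussianProcess T P
  centered : ∀ x, ∫ ω, T x ω ∂P = 0
  variance_one : ∀ x, ∫ ω, (T x ω) ^ 2 ∂P = 1
  isotropic : ∀ g : EuclideanSpace ℝ (Fin 3) ≃ₗᵢ[ℝ] EuclideanSpace ℝ (Fin 3),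
    LinearMap.det (g.toLinearEquiv : EuclideanSpace ℝ (Fin 3) →ₗ[ℝ] EuclideanSpace ℝ (Fin 3)) = 1 →
    ∀ (n : ℕ) (x y : Fin n → S2), (∀ i, (y i : EuclideanSpace ℝ (Fin 3)) = g (x i)) →
      IdentDistrib (fun ω i => T (y i) ω) (fun ω i => T (x i) ω) P P

/-- The random harmonic coefficient `a_{lm;q} = ∫ H_q(T(x)) conj(Y_{lm}(x)) dx`, where `H_q` is
the (probabilists') Hermite polynomial. As `H_1(z) = z`, the case `q = 1` gives the coefficients of
`T` itself. -/
def harmCoeff {Ω : Type*} (T : S2 → Ω → ℝ) (q l : ℕ) (m : ℤ) (ω : Ω) : ℂ :=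
  ∫ x : S2, ((Polynomial.aeval (T x ω) (Polynomial.hermite q) : ℝ) : ℂ) *
    (starRingEnd ℂ) (sphHarm l m x) ∂surf

/-- The angular power spectrum of `H_q(T)`, namely `E |a_{lm;q}|²`. By isotropy this does not depend
on `m ∈ {-l, ..., l}`, and it is written here with `m = 0`. The case `q = 1` is the angular power
spectrum `C_l` of `T`. -/
def powerSpec {Ω : Type*} [MeasurableSpace Ω] (P : Measure Ω) (T : S2 → Ω → ℝ) (q l : ℕ) : ℝ :=
  ∫ ω, ‖harmCoeff T q l 0 ω‖ ^ 2 ∂P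

/-- The normalized squared norm of the contraction of order `p`, for the frequency `l` and the
azimuthal number `m`: `(C̃_l^{(q)})⁻²` times
`∑_{(j,n)} C_{j_1} ⋯ C_{j_{2(q-p)}} | ∑_{(l,m)} C_{l_1} ⋯ C_{l_p}
  𝒢{l_1,m_1;...;l_p,m_p;j_1,n_1;...;j_{q-p},n_{q-p};l,-m}
  𝒢{l_1,m_1;...;l_p,m_p;j_{q-p+1},n_{q-p+1};...;j_{2(q-p)},n_{2(q-p)};l,-m} |²`. -/
def contraction {Ω : Type*} [MeasurableSpace Ω] (P : Measure Ω) (T : S2 → Ω → ℝ)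
    (q p : ℕ) (m : ℤ) (l : ℕ) : ℝ :=
  ((powerSpec P T q l) ^ 2)⁻¹ *
    ∑' t : (Fin (q - p) → HarmIdx) × (Fin (q - p) → HarmIdx),
      ((∏ i, powerSpec P T 1 (t.1 i).1) * (∏ i, powerSpec P T 1 (t.2 i).1)) *
        ‖∑' r : Fin p → HarmIdx,
          ((∏ i, powerSpec P T 1 (r i).1 : ℝ) : ℂ) *
            gaunt (List.ofFn (fun i => (r i).pair) ++ List.ofFn (fun i => (t.1 i).pair)
              ++ [(l, -m)]) *
            gaunt (List.ofFn (fun i => (r i).pair) ++ List.ofFn (fun i => (t.2 i).pair)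
              ++ [(l, -m)])‖ ^ 2

/-! ### Clebsch-Gordan convolutions -/

/-- The Clebsch-Gordan coefficient `C_{a0b0}^{c0}` of `SO(3)`: zero unless `a, b, c` satisfy the
triangle conditions and `a + b + c` is even, and otherwise
`(-1)^((a+b-c)/2) √(2c+1) [(a+b+c)/2]! / ([(a+b-c)/2]! [(a-b+c)/2]! [(-a+b+c)/2]!)
  * {(a+b-c)! (a-b+c)! (-a+b+c)! / (a+b+c+1)!}^{1/2}`. -/
def cg0 (a b c : ℕ) : ℝ :=
  if c ≤ a + b ∧ b ≤ a + c ∧ a ≤ b + c ∧ Even (a + b + c) then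
    (-1 : ℝ) ^ ((a + b - c) / 2) * Real.sqrt (2 * (c : ℝ) + 1) *
        (((a + b + c) / 2).factorial : ℝ) /
      ((((a + b - c) / 2).factorial : ℝ) * (((a + c - b) / 2).factorial : ℝ) *
        (((b + c - a) / 2).factorial : ℝ)) *
      Real.sqrt ((((a + b - c).factorial : ℝ) * ((a + c - b).factorial : ℝ) *
        ((b + c - a).factorial : ℝ)) / ((a + b + c + 1).factorial : ℝ))
  else 0

/-- `Γ_l = (2l+1) C_l`, with `C_l` the angular power spectrum of `T`. -/
def gam {Ω : Type*} [MeasurableSpace Ω] (P : Measure Ω) (T : S2 → Ω → ℝ) (l : ℕ) : ℝ :=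
  (2 * (l : ℝ) + 1) * powerSpec P T 1 l

/-- The convolutions `Γ̂_{1,l} = Γ_l` and
`Γ̂_{q+1,l} = ∑_L ∑_k Γ̂_{q,L} Γ_k (C_{L0k0}^{l0})²` (the order `0` is a placeholder). -/
def gamHat (Γ : ℕ → ℝ) : ℕ → ℕ → ℝ
  | 0 => fun _ => 0
  | 1 => Γ
  | (n + 2) => fun l => ∑' L : ℕ, ∑' k : ℕ, gamHat Γ (n + 1) L * Γ k * (cg0 L k l) ^ 2

/-- The `*`-convolution of order `p ≥ 2`,
`Γ̂*_{p,l;a} = ∑_{l_2,...,l_p} Γ_{l_2} ⋯ Γ_{l_p} ∑_{L_1,...,L_{p-2}}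
  {C_{a0l_20}^{L_10} C_{L_10l_30}^{L_20} ⋯ C_{L_{p-2}0l_p0}^{l0}}²`.
Here `Fin (p - 2 + 1)` indexes `l_2, ..., l_p`, the lower-left indices are
`a, L_1, ..., L_{p-2}` and the upper ones are `L_1, ..., L_{p-2}, l`. -/
def gamStar (Γ : ℕ → ℝ) (p l a : ℕ) : ℝ :=
  ∑' k : Fin (p - 2 + 1) → ℕ, (∏ i, Γ (k i)) *
    ∑' L : Fin (p - 2) → ℕ,
      (∏ i : Fin (p - 2 + 1),
        cg0 ((Fin.cons a L : Fin (p - 2 + 1) → ℕ) i) (k i)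
          ((Fin.snoc L l : Fin (p - 2 + 1) → ℕ) i)) ^ 2

/-- `Z_1, Z_2, ...` is a Markov chain with initial law `P{Z_1 = l} = Γ_l / Γ_*` and one-step
transition probabilities
`P{Z_{n+1} = l | Z_n = L} = ∑_k (Γ_k / Γ_*) (C_{k0L0}^{l0})²`, where `Γ_* = ∑_l Γ_l`. -/
structure IsCGWalk {Ω' : Type*} [MeasurableSpace Ω'] (Q : Measure Ω') (Γ : ℕ → ℝ)
    (Z : ℕ → Ω' → ℕ) : Prop where
  measurable : ∀ n, Measurable (Z n)
  init : ∀ l, Q.real {ω | Z 1 ω = l} = Γ l / ∑' k, Γ k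
  markov : ∀ n, 1 ≤ n → ∀ i : ℕ → ℕ,
    Q.real {ω | ∀ k ∈ Finset.Icc 1 (n + 1), Z k ω = i k} =
      Q.real {ω | ∀ k ∈ Finset.Icc 1 n, Z k ω = i k} *
        ∑' k, Γ k / (∑' k', Γ k') * (cg0 k (i n) (i (n + 1))) ^ 2

end

end HighFreq

/-!
The proof turns every quantity into a statement about zonal kernels on the sphere.

*Spectra.* By the addition theorem (`sum_harm_mul_conj`) a kernel `∑_l c_l ∑_m Y_{lm}(x) conj Y_{lm}(y)`
is a Legendre series in `⟨x, y⟩`, and by the linearization `P_a P_b = ∑_c (C_{a0b0}^{c0})² P_c`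
(`legendreP_mul_eq_sum`) products of Legendre series correspond to Clebsch-Gordan convolutions of their
coefficients (`legSeries_cgConv`). In particular the convolution is commutative and associative, which
gives the decompositions of `Γ̂_q` over its last but one and over its first degree
(`hasSum_gamHat_mul_gamStar_two`, `hasSum_gamStar_mul`). Isotropy makes the covariance of `T` a function
of `⟨x, y⟩`, which equals the Legendre series of `Γ_l / (4π)` almost everywhere, the summability of
`Γ` being Bessel's inequality. Since `E H_q(X) H_q(Y) = q! ρ^q` for standard normal variables with
correlation `ρ`, the spectrum of `H_q(T)` is `q! (4π)^{1-q} Γ̂_{q,l} / (2l + 1)`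
(`powerSpec_eq_gamHat`).

*Contractions.* The sum over the `q - 1` contracted pairs collapses to a sum over one pair `t`, of degree
`L`, with weight proportional to `Γ̂_{q-1,L} / (2L + 1)` (`tsum_prodG_mul_prodG`), so the contraction is a
quadratic form in integrals of three harmonics,
`∑_{s,s'} v_s v_{s'} |∑_t u_t 𝒢{t, s, e} conj 𝒢{t, s', e}|²` with `e = (l, -m)`. The form is symmetric
in the weights `u` and `v` (`gauntForm_comm`). Replacing the second `e` by a sum over all orders of degree
`l` only adds nonnegative terms, and unitarity of the three-fold integrals then evaluates everything
(`gauntForm_le`). In the notation of the Markov chain `Z` the bound, relative to the squared spectrum, is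
of the form `∑_L (2l + 1) / (2L + 1) P(Z_{q-1} = L | Z_q = l)²`, which is at most twice the maximal
conditional probability if only degrees `L ≥ l / 2` occur. The remaining part of `u` lives on
`L < l / 2`; there the triangle inequality forces the degree of `s` to be at least `l / 2`, and after
exchanging the weights the same estimate holds with `P(Z_1 = · | Z_q = l)`. Together
(`contraction_le`) the contraction is at most four times the sum of the two suprema.

*Markov chain.* The one-step Markov property, applied to events determined by `Z_1` and `Z_n`, shows that
the law of `Z_n` and its restriction to `Z_1 = a` are iterated Clebsch-Gordan convolutions
(`measureReal_succ`), whose quotients are the two conditional probabilities (`cond_last`,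
`cond_first`).
-/


namespace HighFreq

open Polynomial ComplexConjugate

/-! ### Legendre polynomials -/

/-- Leibniz rule for the product with `X`. -/
lemma iterate_derivative_X_mul_succ (f : ℝ[X]) (n : ℕ) :
    derivative^[n + 1] (X * f) = X * derivative^[n + 1] f + ((n : ℝ[X]) + 1) * derivative^[n] f := by
  induction n with
  | zero => simp [derivative_mul]; ring
  | succ n ih =>
    rw [Function.iterate_succ_apply', ih]
    simp only [derivative_add, derivative_mul, derivative_X, ← Function.iterate_succ_apply' (⇑derivative),
      Nat.cast_add, Nat.cast_one, derivative_natCast, derivative_one]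
    ring

/-- Leibniz rule for the product with `X² - 1`. -/
lemma iterate_derivative_X_sq_sub_one_mul (f : ℝ[X]) (n : ℕ) :
    derivative^[n + 2] ((X ^ 2 - 1) * f) = (X ^ 2 - 1) * derivative^[n + 2] f
      + 2 * ((n : ℝ[X]) + 2) * X * derivative^[n + 1] f
      + ((n : ℝ[X]) + 2) * ((n : ℝ[X]) + 1) * derivative^[n] f := by
  induction n with
  | zero =>
    simp [derivative_mul, map_ofNat, one_add_one_eq_two]
    ring
  | succ n ih =>
    rw [Function.iterate_succ_apply', ih]
    simp only [derivative_add, derivative_mul, derivative_X, ← Function.iterate_succ_apply' (⇑derivative),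
      Nat.cast_add, Nat.cast_one, derivative_sub, derivative_X_pow, derivative_natCast,
      derivative_one, derivative_ofNat, map_natCast, Nat.succ_eq_add_one]
    push_cast
    ring

lemma legendreP_zero : legendreP 0 = 1 := by simp [legendreP]

lemma legendreP_one : legendreP 1 = X := by
  simp only [legendreP, Function.iterate_one, pow_one]
  have h : derivative (X ^ 2 - 1 : ℝ[X]) = C 2 * X := by
    simp [one_add_one_eq_two, ← map_ofNat C]
  rw [h, ← mul_assoc, ← C_mul]
  simp

/-- The raw Rodrigues step: one of the `l + 1` derivatives is absorbed into `(X² - 1)^(l+1)`. -/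
lemma legendreP_succ_eq (l : ℕ) :
    legendreP (l + 1) =
      C ((2 ^ l * (l.factorial : ℝ))⁻¹) * derivative^[l] (X * (X ^ 2 - 1) ^ l) := by
  have h1 : derivative ((X ^ 2 - 1 : ℝ[X]) ^ (l + 1))
      = C (2 * ((l : ℝ) + 1)) * (X * (X ^ 2 - 1) ^ l) := by
    rw [derivative_pow]
    simp [map_ofNat]
    ring
  rw [legendreP, Function.iterate_succ_apply, h1, iterate_derivative_C_mul, ← mul_assoc, ← C_mul]
  congr 2
  have : (l.factorial : ℝ) ≠ 0 := by positivity
  rw [Nat.factorial_succ]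
  push_cast
  field_simp
  ring

lemma derivative_legendreP_succ (l : ℕ) :
    derivative (legendreP (l + 1)) = X * derivative (legendreP l) + ((l : ℝ[X]) + 1) * legendreP l := by
  rw [legendreP_succ_eq, derivative_C_mul, ← Function.iterate_succ_apply' (⇑derivative),
    iterate_derivative_X_mul_succ, legendreP, derivative_C_mul,
    ← Function.iterate_succ_apply' (⇑derivative)]
  ring

lemma legendreP_succ_mul (l : ℕ) :
    ((l : ℝ[X]) + 1) * legendreP (l + 1) =
      ((l : ℝ[X]) + 1) * X * legendreP l + (X ^ 2 - 1) * derivative (legendreP l) := by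
  rcases l with _ | k
  · simp [legendreP_zero, legendreP_one]
  · have h1 := legendreP_succ_eq (k + 1)
    rw [iterate_derivative_X_mul_succ] at h1
    have h2 : 2 * ((k : ℝ[X]) + 2) * legendreP (k + 1 + 1) = C ((2 ^ (k + 1) * ((k + 1).factorial : ℝ))⁻¹) *
        derivative^[k + 2] ((X ^ 2 - 1) * (X ^ 2 - 1) ^ (k + 1)) := by
      rw [legendreP, ← pow_succ', ← mul_assoc]
      congr 1
      have e : (2 * ((k : ℝ[X]) + 2) : ℝ[X]) = C (2 * ((k : ℝ) + 2)) := by simp [map_ofNat]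
      rw [e, ← C_mul]
      congr 1
      have : ((k+1).factorial : ℝ) ≠ 0 := by positivity
      rw [Nat.factorial_succ (k + 1)]
      push_cast
      field_simp
      ring
    rw [iterate_derivative_X_sq_sub_one_mul] at h2
    have h3 : legendreP (k + 1) = C ((2 ^ (k + 1) * ((k + 1).factorial : ℝ))⁻¹) *
      derivative^[k + 1] ((X ^ 2 - 1) ^ (k + 1)) := rfl
    have h4 : derivative (legendreP (k + 1)) = C ((2 ^ (k + 1) * ((k + 1).factorial : ℝ))⁻¹) *
      derivative^[k + 2] ((X ^ 2 - 1) ^ (k + 1)) := by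
      rw [h3, derivative_C_mul, ← Function.iterate_succ_apply' (⇑derivative)]
    rw [h4]
    push_cast at h1 h2 ⊢
    linear_combination h2 - (k + 2) * h1 - 2 * (k + 2) * X * h3 + (k+2) * X * h3

/-- Bonnet's three-term recurrence. -/
lemma legendreP_recurrence (l : ℕ) :
    ((l : ℝ[X]) + 2) * legendreP (l + 2) =
      (2 * (l : ℝ[X]) + 3) * X * legendreP (l + 1) - ((l : ℝ[X]) + 1) * legendreP l := by
  have hB0 := legendreP_succ_mul l
  have hB1 := legendreP_succ_mul (l + 1)
  have hA := derivative_legendreP_succ l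
  push_cast at hB0 hB1 ⊢
  linear_combination hB1 + (X ^ 2 - 1) * hA - X * hB0

/-- The Legendre differential equation. -/
lemma legendreP_ode (l : ℕ) :
    (X ^ 2 - 1) * derivative (derivative (legendreP l)) + 2 * X * derivative (legendreP l)
      = (l : ℝ[X]) * ((l : ℝ[X]) + 1) * legendreP l := by
  have hA := derivative_legendreP_succ l
  have hB := congrArg derivative (legendreP_succ_mul l)
  simp only [derivative_add, derivative_mul, derivative_X, derivative_sub, derivative_X_pow,
    derivative_natCast, derivative_one, map_natCast] at hB
  push_cast at hB
  linear_combination -hB + (l + 1) * hA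

/-- The differential equation of the derivatives `P_l^{(m)}`. -/
lemma legendreP_ode_iterate (l m : ℕ) :
    (X ^ 2 - 1) * derivative^[m + 2] (legendreP l)
      + 2 * ((m : ℝ[X]) + 1) * X * derivative^[m + 1] (legendreP l)
      = ((l : ℝ[X]) * ((l : ℝ[X]) + 1) - (m : ℝ[X]) * ((m : ℝ[X]) + 1)) * derivative^[m] (legendreP l) := by
  induction m with
  | zero => simpa using legendreP_ode l
  | succ m ih =>
    have h := congrArg derivative ih
    simp only [derivative_add, derivative_mul, derivative_X, derivative_sub, derivative_X_pow,
      derivative_natCast, derivative_one, derivative_ofNat, map_natCast,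
      ← Function.iterate_succ_apply' (⇑derivative), Nat.succ_eq_add_one] at h
    push_cast at h ⊢
    linear_combination h

lemma eval_one_legendreP (l : ℕ) : (legendreP l).eval 1 = 1 := by
  have h0 : ∀ l : ℕ, (legendreP (l + 1)).eval 1 = (legendreP l).eval 1 := by
    intro l
    have := congrArg (eval 1) (legendreP_succ_mul l)
    simp only [eval_mul, eval_add, eval_sub, eval_pow, eval_X, eval_one, eval_natCast, one_pow,
      sub_self, zero_mul, add_zero, mul_one] at this
    have hl : (l : ℝ) + 1 ≠ 0 := by positivity
    exact mul_left_cancel₀ hl this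
  induction l with
  | zero => simp [legendreP_zero]
  | succ l ih => rw [h0, ih]

lemma natDegree_legendreP_le (l : ℕ) : (legendreP l).natDegree ≤ l := by
  refine (natDegree_C_mul_le _ _).trans ((natDegree_iterate_derivative _ _).trans ?_)
  have : ((X ^ 2 - 1 : ℝ[X]) ^ l).natDegree ≤ l * 2 := by
    refine natDegree_pow_le_of_le l ?_
    compute_degree
  omega

lemma coeff_legendreP_self_pos (l : ℕ) : 0 < (legendreP l).coeff l := by
  have hm : (X ^ 2 - 1 : ℝ[X]).Monic := by
    have := monic_X_pow_sub_C (1 : ℝ) (n := 2) (by norm_num)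
    simpa using this
  have hd : (X ^ 2 - 1 : ℝ[X]).natDegree = 2 := by
    have := natDegree_X_pow_sub_C (n := 2) (r := (1 : ℝ))
    simpa using this
  have h1 : ((X ^ 2 - 1 : ℝ[X]) ^ l).coeff (l + l) = 1 := by
    have := (hm.pow l).coeff_natDegree
    rwa [natDegree_pow, hd, mul_two] at this
  rw [legendreP, coeff_C_mul, coeff_iterate_derivative, h1]
  have : 0 < (l + l).descFactorial l := Nat.descFactorial_pos.2 (by omega)
  simp only [nsmul_eq_mul, mul_one]
  positivity

lemma coeff_iterate_derivative_legendreP_ne_zero (l m : ℕ) :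
    (derivative^[m] (legendreP (l + m))).coeff l ≠ 0 := by
  rw [coeff_iterate_derivative, nsmul_eq_mul]
  have := coeff_legendreP_self_pos (l + m)
  have h2 : 0 < (l + m).descFactorial m := Nat.descFactorial_pos.2 (by omega)
  positivity

lemma natDegree_iterate_derivative_legendreP_le (l m : ℕ) :
    (derivative^[m] (legendreP l)).natDegree ≤ l - m :=
  (natDegree_iterate_derivative _ _).trans (Nat.sub_le_sub_right (natDegree_legendreP_le l) m)

/-- The `m`-th derivatives of `P_m, …, P_{m+N}` span the polynomials of degree at most `N`,
because their degrees are `0, …, N`. -/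
lemma mem_span_iterate_derivative_legendreP (m N : ℕ) (p : ℝ[X]) (hp : p.natDegree ≤ N) :
    p ∈ Submodule.span ℝ
      ((fun l => derivative^[m] (legendreP (l + m))) '' {l | l ≤ N}) := by
  induction N using Nat.strong_induction_on generalizing p with
  | _ N ih =>
    set u := derivative^[m] (legendreP (N + m)) with hu
    have hc := coeff_iterate_derivative_legendreP_ne_zero N m
    have hud : u.natDegree ≤ N := by
      simpa using natDegree_iterate_derivative_legendreP_le (N + m) m
    have humem : u ∈ Submodule.span ℝ
      ((fun l => derivative^[m] (legendreP (l + m))) '' {l | l ≤ N}) :=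
      Submodule.subset_span ⟨N, le_refl N, rfl⟩
    set r := p - (p.coeff N / u.coeff N) • u with hr
    have hrN : r.coeff N = 0 := by
      simp only [hr, coeff_sub, coeff_smul, smul_eq_mul]
      rw [div_mul_cancel₀ _ hc, sub_self]
    have hrd : r.natDegree ≤ N :=
      (natDegree_sub_le _ _).trans (max_le hp ((natDegree_smul_le _ _).trans hud))
    have hpr : p = r + (p.coeff N / u.coeff N) • u := by simp [hr]
    rw [hpr]
    refine Submodule.add_mem _ ?_ (Submodule.smul_mem _ _ humem)
    rcases Nat.eq_zero_or_pos N with h0 | hpos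
    · have : r = 0 := by
        rw [h0] at hrN hrd
        rw [eq_C_of_natDegree_le_zero hrd, hrN, C_0]
      rw [this]; exact Submodule.zero_mem _
    · have hlt : r.natDegree ≤ N - 1 := by
        by_contra hcon
        have hEq : r.natDegree = N := by omega
        have : r.leadingCoeff = 0 := by rw [leadingCoeff, hEq, hrN]
        rw [leadingCoeff_eq_zero] at this
        rw [this] at hEq
        simp at hEq
        omega
      exact Submodule.span_mono (Set.image_mono fun l hl => by
        simp only [Set.mem_ofPred_eq] at hl ⊢; omega) (ih (N - 1) (by omega) r hlt)

/-! ### The integral of a polynomial over `[-1, 1]` -/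

/-- The linear functional `p ↦ ∫_{-1}^1 p(t) dt` on real polynomials. -/
noncomputable def polyInt : ℝ[X] →ₗ[ℝ] ℝ where
  toFun p := ∫ t in (-1 : ℝ)..1, p.eval t
  map_add' p q := by
    simp only [eval_add]
    exact intervalIntegral.integral_add (p.continuous.intervalIntegrable _ _)
      (q.continuous.intervalIntegrable _ _)
  map_smul' c p := by simp [eval_smul]

lemma polyInt_apply (p : ℝ[X]) : polyInt p = ∫ t in (-1 : ℝ)..1, p.eval t := rfl

lemma polyInt_derivative (p : ℝ[X]) : polyInt (derivative p) = p.eval 1 - p.eval (-1) := by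
  rw [polyInt_apply]
  exact intervalIntegral.integral_eq_sub_of_hasDerivAt (fun x _ => p.hasDerivAt x)
    ((derivative p).continuous.intervalIntegrable _ _)

lemma polyInt_one : polyInt 1 = 2 := by
  simp [polyInt_apply]; norm_num

/-- Integration by parts against the weight `(1 - t²)^{m+1}`. -/
lemma polyInt_weight_succ (l l' m : ℕ) :
    polyInt ((1 - X ^ 2) ^ (m + 1) * (derivative^[m + 1] (legendreP l) *
        derivative^[m + 1] (legendreP l'))) =
      (l' * (l' + 1) - m * (m + 1)) * polyInt ((1 - X ^ 2) ^ m * (derivative^[m] (legendreP l) *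
        derivative^[m] (legendreP l'))) := by
  have hd : derivative ((1 - X ^ 2) ^ (m + 1) * (derivative^[m] (legendreP l) *
        derivative^[m + 1] (legendreP l'))) =
      (1 - X ^ 2) ^ (m + 1) * (derivative^[m + 1] (legendreP l) *
        derivative^[m + 1] (legendreP l')) -
      ((l' * (l' + 1) - m * (m + 1) : ℝ)) • ((1 - X ^ 2) ^ m * (derivative^[m] (legendreP l) *
        derivative^[m] (legendreP l'))) := by
    have ho := legendreP_ode_iterate l' m
    rw [derivative_mul, derivative_mul, derivative_pow_succ, ← Function.iterate_succ_apply' (⇑derivative),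
      ← Function.iterate_succ_apply' (⇑derivative), smul_eq_C_mul]
    simp [-Function.iterate_succ]
    linear_combination -(1 - X ^ 2) ^ m * derivative^[m] (legendreP l) * ho
  have h := polyInt_derivative ((1 - X ^ 2) ^ (m + 1) * (derivative^[m] (legendreP l) *
        derivative^[m + 1] (legendreP l')))
  rw [hd, map_sub, map_smul, smul_eq_mul] at h
  simp only [eval_mul, eval_pow, eval_sub, eval_one, eval_X] at h
  norm_num [-Function.iterate_succ] at h
  linarith

lemma polyInt_legendreP_mul_of_ne {l l' : ℕ} (h : l ≠ l') :
    polyInt (legendreP l * legendreP l') = 0 := by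
  have h1 := polyInt_weight_succ l l' 0
  have h2 := polyInt_weight_succ l' l 0
  simp only [Function.iterate_zero, id, Nat.cast_zero, zero_add, pow_zero, one_mul, zero_mul,
    sub_zero, mul_comm (legendreP l') (legendreP l),
    mul_comm (derivative^[1] (legendreP l')) (derivative^[1] (legendreP l))] at h1 h2
  have h3 : ((l : ℝ) * (l + 1) - l' * (l' + 1)) * polyInt (legendreP l * legendreP l') = 0 := by
    linarith
  rcases mul_eq_zero.1 h3 with h4 | h4
  · exfalso
    have h5 : ((l : ℝ) - l') * (l + l' + 1) = 0 := by linarith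
    rcases mul_eq_zero.1 h5 with h6 | h6
    · exact h (by exact_mod_cast sub_eq_zero.1 h6)
    · have : (0 : ℝ) < l + l' + 1 := by positivity
      linarith
  · exact h4

lemma polyInt_legendreP_sq (l : ℕ) :
    polyInt (legendreP l * legendreP l) = 2 / (2 * l + 1) := by
  have nat_mul : ∀ (c : ℝ) (p : ℝ[X]), polyInt (C c * p) = c * polyInt p := fun c p => by
    rw [← smul_eq_C_mul, map_smul, smul_eq_mul]
  have one : polyInt (legendreP 1 * legendreP 1) = 2 / 3 := by
    have h : legendreP 1 * legendreP 1 = derivative (C (1/3 : ℝ) * X ^ 3) := by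
      rw [legendreP_one, derivative_C_mul_X_pow]
      norm_num
      ring
    rw [h, polyInt_derivative]
    norm_num
  -- both sides of the step are multiples of `∫ t P_{l+1}(t) P_{l+2}(t) dt`
  have step : ∀ l : ℕ, (2 * (l : ℝ) + 5) * polyInt (legendreP (l + 2) * legendreP (l + 2)) =
      (2 * l + 3) * polyInt (legendreP (l + 1) * legendreP (l + 1)) := by
    intro l
    have r1 := congrArg (fun p => polyInt (p * legendreP (l + 2))) (legendreP_recurrence l)
    have r2 := congrArg (fun p => polyInt (p * legendreP (l + 1))) (legendreP_recurrence (l + 1))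
    have e1 : ((l : ℝ[X]) + 2) * legendreP (l + 2) * legendreP (l + 2) =
      C ((l : ℝ) + 2) * (legendreP (l + 2) * legendreP (l + 2)) := by simp [map_ofNat]; ring
    have e2 : ((2 * (l : ℝ[X]) + 3) * X * legendreP (l + 1) - ((l : ℝ[X]) + 1) * legendreP l)
        * legendreP (l + 2) = C (2 * (l : ℝ) + 3) * (X * legendreP (l + 1) * legendreP (l + 2))
        - C ((l : ℝ) + 1) * (legendreP l * legendreP (l + 2)) := by simp [map_ofNat]; ring
    have e3 : (((l + 1 : ℕ) : ℝ[X]) + 2) * legendreP (l + 1 + 2) * legendreP (l + 1) =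
      C ((l : ℝ) + 3) * (legendreP (l + 3) * legendreP (l + 1)) := by
        simp [map_ofNat, show l + 1 + 2 = l + 3 from rfl]; ring
    have e4 : ((2 * ((l + 1 : ℕ) : ℝ[X]) + 3) * X * legendreP (l + 1 + 1)
          - (((l + 1 : ℕ) : ℝ[X]) + 1) * legendreP (l + 1)) * legendreP (l + 1) =
        C (2 * (l : ℝ) + 5) * (X * legendreP (l + 1) * legendreP (l + 2))
        - C ((l : ℝ) + 2) * (legendreP (l + 1) * legendreP (l + 1)) := by
        simp [map_ofNat]; ring
    simp only [e1, e2] at r1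
    simp only [e3, e4] at r2
    rw [map_sub, nat_mul, nat_mul, nat_mul,
      polyInt_legendreP_mul_of_ne (show l ≠ l + 2 by omega)] at r1
    rw [map_sub, nat_mul, nat_mul, nat_mul,
      polyInt_legendreP_mul_of_ne (show l + 3 ≠ l + 1 by omega)] at r2
    have hl : (l : ℝ) + 2 ≠ 0 := by positivity
    apply mul_left_cancel₀ hl
    linear_combination (2 * (l : ℝ) + 5) * r1 - (2 * l + 3) * r2
  have key : ∀ l : ℕ, polyInt (legendreP (l + 1) * legendreP (l + 1)) = 2 / (2 * (l : ℝ) + 3) := by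
    intro l
    induction l with
    | zero => simpa using one
    | succ l ih =>
      have h := step l
      rw [ih] at h
      rw [eq_div_iff (by positivity)]
      push_cast
      have h3 : (2 * (l : ℝ) + 3) * (2 / (2 * l + 3)) = 2 := by field_simp
      linarith
  rcases l with _ | l
  · simp [legendreP_zero, polyInt_one]
  · rw [key l]; push_cast; ring_nf

lemma polyInt_legendreP_mul (l l' : ℕ) :
    polyInt (legendreP l * legendreP l') = if l = l' then 2 / (2 * (l : ℝ) + 1) else 0 := by
  split_ifs with h
  · rw [← h, polyInt_legendreP_sq]
  · exact polyInt_legendreP_mul_of_ne h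

/-- Orthogonality of the associated Legendre functions of equal order. -/
lemma polyInt_weight (l l' m : ℕ) (hm : m ≤ l) :
    polyInt ((1 - X ^ 2) ^ m * (derivative^[m] (legendreP l) *
        derivative^[m] (legendreP l'))) =
      if l = l' then 2 / (2 * (l : ℝ) + 1) * ((l + m).factorial / (l - m).factorial) else 0 := by
  induction m with
  | zero =>
    have : ((l.factorial : ℝ)) ≠ 0 := by positivity
    simp [polyInt_legendreP_mul, this]
  | succ m ih =>
    rw [polyInt_weight_succ, ih (by omega)]
    split_ifs with h
    · subst h
      obtain ⟨k, rfl⟩ := Nat.exists_eq_add_of_le hm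
      have e1 : m + 1 + k - m = k + 1 := by omega
      have e2 : m + 1 + k - (m + 1) = k := by omega
      have e3 : m + 1 + k + (m + 1) = (m + 1 + k + m) + 1 := by omega
      rw [e1, e2, e3, Nat.factorial_succ, Nat.factorial_succ (m + 1 + k + m)]
      have : (k.factorial : ℝ) ≠ 0 := by positivity
      push_cast
      field_simp
      ring
    · simp

/-- The Legendre expansion of a polynomial. -/
lemma eq_sum_legendreP (p : ℝ[X]) (N : ℕ) (hp : p.natDegree ≤ N) :
    p = ∑ l ∈ Finset.range (N + 1), ((2 * (l : ℝ) + 1) / 2 * polyInt (p * legendreP l)) •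
      legendreP l := by
  have h := mem_span_iterate_derivative_legendreP 0 N p hp
  simp only [Function.iterate_zero, id, add_zero] at h
  clear hp
  induction h using Submodule.span_induction with
  | mem x hx =>
    obtain ⟨l, hl, rfl⟩ := hx
    simp only [Set.mem_ofPred_eq] at hl
    rw [Finset.sum_eq_single l]
    · rw [polyInt_legendreP_sq]
      have : (2 * (l : ℝ) + 1) / 2 * (2 / (2 * l + 1)) = 1 := by field_simp
      rw [this, one_smul]
    · intro b _ hb
      rw [polyInt_legendreP_mul_of_ne hb.symm]; simp
    · intro hl'; simp at hl'; omega
  | zero => simp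
  | add x y _ _ hx hy =>
    conv_lhs => rw [hx, hy]
    rw [← Finset.sum_add_distrib]
    refine Finset.sum_congr rfl fun l _ => ?_
    rw [← add_smul, add_mul x y, map_add]; ring_nf
  | smul a x _ hx =>
    conv_lhs => rw [hx]
    rw [Finset.smul_sum]
    refine Finset.sum_congr rfl fun l _ => ?_
    rw [smul_smul, smul_mul_assoc, map_smul, smul_eq_mul]; ring_nf

/-! ### Linearization of products of Legendre polynomials -/

/-- The central binomial coefficients, extended by zero to the negative integers. With this
convention the two-term recurrence below holds on all of `ℤ`. -/
noncomputable def centralBinomInt (n : ℤ) : ℝ := if 0 ≤ n then (n.toNat.centralBinom : ℝ) else 0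

lemma centralBinomInt_natCast (n : ℕ) : centralBinomInt n = n.centralBinom := by
  simp [centralBinomInt]

lemma centralBinomInt_of_neg {n : ℤ} (h : n < 0) : centralBinomInt n = 0 := by
  simp [centralBinomInt, h]

lemma centralBinomInt_pos {n : ℤ} (h : 0 ≤ n) : 0 < centralBinomInt n := by
  lift n to ℕ using h
  rw [centralBinomInt_natCast]
  exact_mod_cast n.centralBinom_pos

lemma centralBinomInt_succ (n : ℤ) :
    ((n : ℝ) + 1) * centralBinomInt (n + 1) = 2 * (2 * n + 1) * centralBinomInt n := by
  rcases lt_trichotomy n (-1) with h | h | h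
  · rw [centralBinomInt_of_neg (by omega), centralBinomInt_of_neg (by omega)]; ring
  · subst h; rw [centralBinomInt_of_neg (n := -1) (by omega)]; simp
  · lift n to ℕ using by omega
    have := Nat.succ_mul_centralBinom_succ n
    rw [centralBinomInt_natCast, ← Nat.cast_succ, centralBinomInt_natCast]
    push_cast
    exact_mod_cast this

/-- The square of a Clebsch-Gordan coefficient with zero magnetic numbers, in the coordinates
`a = y + z`, `b = x + z`, `c = x + y`. The triangle conditions are `0 ≤ x, y, z`. -/
lemma cg0_sq_eq (x y z : ℤ) (a b c : ℕ) (ha : (a : ℤ) = y + z) (hb : (b : ℤ) = x + z)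
    (hc : (c : ℤ) = x + y) :
    cg0 a b c ^ 2 = (2 * (c : ℝ) + 1) *
      (centralBinomInt x * centralBinomInt y * centralBinomInt z /
        ((2 * ((x + y + z : ℤ) : ℝ) + 1) * centralBinomInt (x + y + z))) := by
  by_cases h : 0 ≤ x ∧ 0 ≤ y ∧ 0 ≤ z
  · obtain ⟨hx, hy, hz⟩ := h
    lift x to ℕ using hx
    lift y to ℕ using hy
    lift z to ℕ using hz
    obtain rfl : a = y + z := by omega
    obtain rfl : b = x + z := by omega
    obtain rfl : c = x + y := by omega
    have e1 : y + z + (x + z) - (x + y) = 2 * z := by omega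
    have e2 : y + z + (x + y) - (x + z) = 2 * y := by omega
    have e3 : x + z + (x + y) - (y + z) = 2 * x := by omega
    have e4 : y + z + (x + z) + (x + y) = 2 * (x + y + z) := by omega
    have hcond : x + y ≤ y + z + (x + z) ∧ x + z ≤ y + z + (x + y) ∧ y + z ≤ x + z + (x + y) ∧
      Even (y + z + (x + z) + (x + y)) :=
      ⟨by omega, by omega, by omega, by rw [e4]; exact even_two_mul _⟩
    have cB : ∀ n : ℕ, (n.centralBinom : ℝ) = (2 * n).factorial / (n.factorial : ℝ) ^ 2 := by
      intro n
      have h := Nat.choose_mul_factorial_mul_factorial (show n ≤ 2 * n by omega)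
      rw [show 2 * n - n = n by omega] at h
      have : (n.factorial : ℝ) ≠ 0 := by positivity
      rw [Nat.centralBinom, eq_div_iff (by positivity)]
      exact_mod_cast (by rw [pow_two, ← mul_assoc]; exact h)
    rw [cg0, if_pos hcond, e1, e2, e3, e4]
    simp only [Nat.mul_div_cancel_left _ (show 0 < 2 by norm_num)]
    have e5 : (x : ℤ) + y + z = ((x + y + z : ℕ) : ℤ) := by push_cast; ring
    rw [e5, centralBinomInt_natCast, centralBinomInt_natCast, centralBinomInt_natCast,
      centralBinomInt_natCast, cB, cB, cB, cB, Nat.factorial_succ]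
    rw [mul_pow, div_pow, mul_pow, mul_pow, Real.sq_sqrt (by positivity), Real.sq_sqrt
      (by positivity), ← pow_mul, mul_comm z 2, pow_mul]
    have f1 : (x.factorial : ℝ) ≠ 0 := by positivity
    have f2 : (y.factorial : ℝ) ≠ 0 := by positivity
    have f3 : (z.factorial : ℝ) ≠ 0 := by positivity
    have f4 : ((x+y+z).factorial : ℝ) ≠ 0 := by positivity
    have f5 : ((2*(x+y+z)).factorial : ℝ) ≠ 0 := by positivity
    push_cast
    field_simp
    norm_num
  · have h1 : cg0 a b c = 0 := by
      rw [cg0, if_neg]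
      rintro ⟨h1, h2, h3, -⟩
      exact h ⟨by omega, by omega, by omega⟩
    have h2 : centralBinomInt x * centralBinomInt y * centralBinomInt z = 0 := by
      by_cases hx : x < 0
      · simp [centralBinomInt_of_neg hx]
      by_cases hy : y < 0
      · simp [centralBinomInt_of_neg hy]
      have hz : z < 0 := by
        by_contra hz; exact h ⟨by omega, by omega, by omega⟩
      simp [centralBinomInt_of_neg hz]
    rw [h1, h2]; simp

lemma cg0_of_odd {a b c : ℕ} (h : ¬ Even (a + b + c)) : cg0 a b c = 0 := by
  rw [cg0, if_neg]
  exact fun h' => h h'.2.2.2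

lemma cg0_eq_zero_of_not_triangle {a b c : ℕ} (h : ¬ (c ≤ a + b ∧ b ≤ a + c ∧ a ≤ b + c)) :
    cg0 a b c = 0 := by
  rw [cg0, if_neg]
  exact fun h' => h ⟨h'.1, h'.2.1, h'.2.2.1⟩

/-- The squared `3j`-symbol with zero magnetic numbers, `(C_{a0b0}^{c0})² / (2c + 1)`, which is
symmetric in its three arguments. -/
noncomputable def threeJSq (a b c : ℕ) : ℝ := cg0 a b c ^ 2 / (2 * (c : ℝ) + 1)

lemma cg0_sq (a b c : ℕ) : cg0 a b c ^ 2 = (2 * (c : ℝ) + 1) * threeJSq a b c := by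
  rw [threeJSq]; field_simp

lemma threeJSq_nonneg (a b c : ℕ) : 0 ≤ threeJSq a b c := by
  rw [threeJSq]; positivity

lemma threeJSq_eq (x y z : ℤ) (a b c : ℕ) (ha : (a : ℤ) = y + z) (hb : (b : ℤ) = x + z)
    (hc : (c : ℤ) = x + y) :
    threeJSq a b c = centralBinomInt x * centralBinomInt y * centralBinomInt z /
        ((2 * ((x + y + z : ℤ) : ℝ) + 1) * centralBinomInt (x + y + z)) := by
  rw [threeJSq, cg0_sq_eq x y z a b c ha hb hc]
  field_simp

/-- The recurrence satisfied by the squared `3j`-symbols, which mirrors that of the integrals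
`∫ P_a P_b P_c`. -/
lemma threeJSq_recurrence (a b c : ℕ) :
    (2 * (c : ℝ) + 1) * (((a : ℝ) + 1) * threeJSq (a + 1) b c + a * threeJSq (a - 1) b c) =
      (2 * (a : ℝ) + 1) * (((c : ℝ) + 1) * threeJSq a b (c + 1) + c * threeJSq a b (c - 1)) := by
  by_cases hpar : Even (a + b + c)
  · have h1 : ¬ Even (a + 1 + b + c) := by grind
    have h2 : ¬ Even (a + b + (c + 1)) := by grind
    have h3 : (a : ℝ) * threeJSq (a - 1) b c = 0 := by
      rcases a with _ | a
      · simp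
      · rw [threeJSq, cg0_of_odd (by rw [Nat.add_sub_cancel]; grind)]; simp
    have h4 : (c : ℝ) * threeJSq a b (c - 1) = 0 := by
      rcases c with _ | c
      · simp
      · rw [threeJSq, cg0_of_odd (by rw [Nat.add_sub_cancel]; grind)]; simp
    rw [h3, h4, threeJSq, threeJSq, cg0_of_odd h1, cg0_of_odd h2]; simp
  · obtain ⟨k, hk⟩ := Nat.not_even_iff_odd.1 hpar
    -- `x`, `Y + 1`, `Z + 1` are the coordinates of `(a + 1, b, c)`
    obtain ⟨x, Y, Z, ha, hb, hc⟩ : ∃ x Y Z : ℤ, (a : ℤ) = Y + Z + 1 ∧ (b : ℤ) = x + Z + 1 ∧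
        (c : ℤ) = x + Y + 1 := ⟨k - a, k - b, k - c, by omega, by omega, by omega⟩
    have h1 := threeJSq_eq x (Y + 1) (Z + 1) (a + 1) b c (by push_cast; omega) (by omega) (by omega)
    have h3 := threeJSq_eq (x + 1) (Y + 1) Z a b (c + 1) (by omega) (by omega)
      (by push_cast; omega)
    have h2 : (a : ℝ) * threeJSq (a - 1) b c = a * (centralBinomInt (x + 1) * centralBinomInt Y *
        centralBinomInt Z / ((2 * ((x + Y + Z + 1 : ℤ) : ℝ) + 1) *
          centralBinomInt (x + Y + Z + 1))) := by
      rcases Nat.eq_zero_or_pos a with h0 | h0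
      · simp [h0]
      · rw [threeJSq_eq (x + 1) Y Z (a - 1) b c (by push_cast [h0]; omega) (by omega) (by omega),
          show x + 1 + Y + Z = x + Y + Z + 1 by ring]
    have h4 : (c : ℝ) * threeJSq a b (c - 1) = c * (centralBinomInt x * centralBinomInt Y *
        centralBinomInt (Z + 1) / ((2 * ((x + Y + Z + 1 : ℤ) : ℝ) + 1) *
          centralBinomInt (x + Y + Z + 1))) := by
      rcases Nat.eq_zero_or_pos c with h0 | h0
      · simp [h0]
      · rw [threeJSq_eq x Y (Z + 1) a b (c - 1) (by omega) (by omega) (by push_cast [h0]; omega),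
          show x + Y + (Z + 1) = x + Y + Z + 1 by ring]
    rw [show x + (Y + 1) + (Z + 1) = x + Y + Z + 1 + 1 by ring] at h1
    rw [show x + 1 + (Y + 1) + Z = x + Y + Z + 1 + 1 by ring] at h3
    rw [h1, h2, h3, h4]
    have ha' : (a : ℝ) = Y + Z + 1 := by exact_mod_cast ha
    have hc' : (c : ℝ) = x + Y + 1 := by exact_mod_cast hc
    obtain ⟨h, hh⟩ : ∃ h : ℤ, h = x + Y + Z + 1 := ⟨_, rfl⟩
    have hh0 : 0 ≤ h := by omega
    have hhR : (h : ℝ) = x + Y + Z + 1 := by exact_mod_cast hh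
    rw [← hh]
    have gh := centralBinomInt_pos hh0
    have ghs := centralBinomInt_pos (show 0 ≤ h + 1 by omega)
    have hR : (0 : ℝ) ≤ h := by exact_mod_cast hh0
    have eh : centralBinomInt (h + 1) = 2 * (2 * h + 1) * centralBinomInt h / (h + 1) := by
      rw [eq_div_iff (by positivity), ← centralBinomInt_succ]; ring
    have sx := centralBinomInt_succ x
    have sY := centralBinomInt_succ Y
    have sZ := centralBinomInt_succ Z
    rw [eh]
    push_cast
    have key : (2 * (c : ℝ) + 1) * (((a : ℝ) + 1) * (h + 1) *
          (centralBinomInt x * centralBinomInt (Y + 1) * centralBinomInt (Z + 1))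
        + 2 * (2 * h + 3) * a * (centralBinomInt (x + 1) * centralBinomInt Y * centralBinomInt Z)) =
      (2 * (a : ℝ) + 1) * (((c : ℝ) + 1) * (h + 1) *
          (centralBinomInt (x + 1) * centralBinomInt (Y + 1) * centralBinomInt Z)
        + 2 * (2 * h + 3) * c *
          (centralBinomInt x * centralBinomInt Y * centralBinomInt (Z + 1))) := by
      rw [ha', hc', hhR]
      by_cases hx : x < 0
      · rw [centralBinomInt_of_neg hx] at sx ⊢
        by_cases hx1 : x = -1
        · subst hx1
          rw [neg_add_cancel]
          push_cast
          linear_combination (-(2 * (Y : ℝ) + 2 * Z + 3) * (Y + Z + 1) *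
            centralBinomInt 0 * centralBinomInt Z) * sY
        · rw [centralBinomInt_of_neg (show x + 1 < 0 by omega)]; ring
      by_cases hY : Y < 0
      · rw [centralBinomInt_of_neg hY] at sY ⊢
        by_cases hY1 : Y = -1
        · subst hY1
          rw [neg_add_cancel]
          push_cast
          linear_combination ((2 * (x : ℝ) + 1) * (x + Z + 1) * centralBinomInt x *
            centralBinomInt 0) * sZ - ((2 * (Z : ℝ) + 1) * (x + Z + 1) *
            centralBinomInt Z * centralBinomInt 0) * sx
        · rw [centralBinomInt_of_neg (show Y + 1 < 0 by omega)]; ring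
      by_cases hZ : Z < 0
      · rw [centralBinomInt_of_neg hZ] at sZ ⊢
        by_cases hZ1 : Z = -1
        · subst hZ1
          rw [neg_add_cancel]
          push_cast
          linear_combination ((2 * (x : ℝ) + 2 * Y + 3) * (x + Y + 1) * centralBinomInt x *
            centralBinomInt 0) * sY
        · rw [centralBinomInt_of_neg (show Z + 1 < 0 by omega)]; ring
      have hx' : (0 : ℝ) ≤ x := by exact_mod_cast not_lt.1 hx
      have hY' : (0 : ℝ) ≤ Y := by exact_mod_cast not_lt.1 hY
      have hZ' : (0 : ℝ) ≤ Z := by exact_mod_cast not_lt.1 hZ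
      have ex : centralBinomInt (x + 1) = 2 * (2 * x + 1) * centralBinomInt x / (x + 1) := by
        rw [eq_div_iff (by positivity), ← sx]; ring
      have eY : centralBinomInt (Y + 1) = 2 * (2 * Y + 1) * centralBinomInt Y / (Y + 1) := by
        rw [eq_div_iff (by positivity), ← sY]; ring
      have eZ : centralBinomInt (Z + 1) = 2 * (2 * Z + 1) * centralBinomInt Z / (Z + 1) := by
        rw [eq_div_iff (by positivity), ← sZ]; ring
      rw [ex, eY, eZ]
      field_simp
      ring
    have h2h : (2 * (h : ℝ) + 1) ≠ 0 := by positivity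
    have h2h3 : (2 * ((h : ℝ) + 1) + 1) ≠ 0 := by positivity
    field_simp
    linear_combination key

lemma threeJSq_zero (b c : ℕ) : threeJSq 0 b c = if b = c then 1 / (2 * (b : ℝ) + 1) else 0 := by
  split_ifs with h
  · subst h
    rw [threeJSq_eq b 0 0 0 b b (by simp) (by simp) (by simp)]
    have := centralBinomInt_pos (show 0 ≤ (b : ℤ) by omega)
    have h0 : centralBinomInt 0 = 1 := by simp [centralBinomInt]
    simp only [add_zero, h0, mul_one]
    push_cast
    field_simp
  · rw [threeJSq, cg0_eq_zero_of_not_triangle (by omega)]; simp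

/-- The integral of a product of three Legendre polynomials. -/
lemma polyInt_legendreP_mul_mul (a b c : ℕ) :
    polyInt (legendreP a * legendreP b * legendreP c) = 2 * threeJSq a b c := by
  have nat_mul : ∀ (c : ℝ) (p : ℝ[X]), polyInt (C c * p) = c * polyInt p := fun c p => by
    rw [← smul_eq_C_mul, map_smul, smul_eq_mul]
  have X_mul : ∀ c : ℕ, C (2 * (c : ℝ) + 1) * (X * legendreP c) =
      C ((c : ℝ) + 1) * legendreP (c + 1) + C (c : ℝ) * legendreP (c - 1) := by
    intro c
    rcases c with _ | c
    · simp [legendreP_zero, legendreP_one]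
    · have := legendreP_recurrence c
      simp [map_ofNat]
      linear_combination -this
  -- multiplication by `X` can be moved from the first factor to the third
  have exch : ∀ a b c : ℕ, (2 * (c : ℝ) + 1) * (((a : ℝ) + 1) *
        polyInt (legendreP (a + 1) * legendreP b * legendreP c) +
        a * polyInt (legendreP (a - 1) * legendreP b * legendreP c)) =
      (2 * (a : ℝ) + 1) * (((c : ℝ) + 1) * polyInt (legendreP a * legendreP b * legendreP (c + 1))
        + c * polyInt (legendreP a * legendreP b * legendreP (c - 1))) := by
    intro a b c
    have h1 := X_mul a
    have h2 := X_mul c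
    simp only [← nat_mul, ← map_add]
    refine congrArg polyInt ?_
    generalize legendreP a = pa at *
    generalize legendreP b = pb at *
    generalize legendreP c = pc at *
    generalize legendreP (a + 1) = pa1 at *
    generalize legendreP (a - 1) = pa2 at *
    generalize legendreP (c + 1) = pc1 at *
    generalize legendreP (c - 1) = pc2 at *
    linear_combination -C (2 * (c : ℝ) + 1) * pb * pc * h1
      + C (2 * (a : ℝ) + 1) * pa * pb * h2
  induction a using Nat.strong_induction_on generalizing c with
  | _ a ih =>
    rcases a with _ | a
    · rw [legendreP_zero, one_mul, polyInt_legendreP_mul, threeJSq_zero]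
      split_ifs <;> ring
    · have h1 := exch a b c
      have h2 := threeJSq_recurrence a b c
      rw [ih a (by omega), ih a (by omega)] at h1
      have h3 : (a : ℝ) * polyInt (legendreP (a - 1) * legendreP b * legendreP c) =
          a * (2 * threeJSq (a - 1) b c) := by
        rcases a with _ | a
        · simp
        · rw [ih _ (by omega)]
      rw [h3] at h1
      have h4 : (2 * (c : ℝ) + 1) * ((a : ℝ) + 1) ≠ 0 := by positivity
      apply mul_left_cancel₀ h4
      linear_combination h1 - 2 * h2

lemma threeJSq_swap (a b c : ℕ) : threeJSq a b c = threeJSq b a c := by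
  have h1 := polyInt_legendreP_mul_mul a b c
  rw [mul_comm (legendreP a), polyInt_legendreP_mul_mul] at h1
  linarith

lemma threeJSq_swap_right (a b c : ℕ) : threeJSq a b c = threeJSq a c b := by
  have h1 := polyInt_legendreP_mul_mul a b c
  rw [mul_right_comm (legendreP a), polyInt_legendreP_mul_mul] at h1
  linarith

lemma cg0_sq_comm (a b c : ℕ) : cg0 a b c ^ 2 = cg0 b a c ^ 2 := by
  rw [cg0_sq, cg0_sq, threeJSq_swap]

lemma threeJSq_eq_zero {a b c : ℕ} (h : ¬ (c ≤ a + b ∧ b ≤ a + c ∧ a ≤ b + c)) :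
    threeJSq a b c = 0 := by
  rw [threeJSq, cg0_eq_zero_of_not_triangle h]; simp

/-- The linearization formula `P_a P_b = ∑_c (C_{a0b0}^{c0})² P_c`. -/
lemma legendreP_mul_eq_sum (a b : ℕ) :
    legendreP a * legendreP b =
      ∑ c ∈ Finset.range (a + b + 1), cg0 a b c ^ 2 • legendreP c := by
  have h := eq_sum_legendreP (legendreP a * legendreP b) (a + b)
    (natDegree_mul_le.trans (add_le_add (natDegree_legendreP_le a) (natDegree_legendreP_le b)))
  rw [h]
  refine Finset.sum_congr rfl fun c _ => ?_
  rw [polyInt_legendreP_mul_mul, cg0_sq]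
  congr 1
  ring

/-! ### The surface measure of the sphere -/

instance : IsFiniteMeasure surf := by unfold surf; infer_instance

/-- The action of a linear isometry on the sphere. -/
noncomputable def sphMap (g : EuclideanSpace ℝ (Fin 3) ≃ₗᵢ[ℝ] EuclideanSpace ℝ (Fin 3)) (x : S2) :
    S2 := ⟨g x.1, by simp⟩

lemma coe_sphMap (g : EuclideanSpace ℝ (Fin 3) ≃ₗᵢ[ℝ] EuclideanSpace ℝ (Fin 3)) (x : S2) :
    (sphMap g x : EuclideanSpace ℝ (Fin 3)) = g x := rfl

lemma continuous_sphMap (g : EuclideanSpace ℝ (Fin 3) ≃ₗᵢ[ℝ] EuclideanSpace ℝ (Fin 3)) :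
    Continuous (sphMap g) :=
  (g.continuous.comp continuous_subtype_val).subtype_mk _

lemma sphMap_symm_sphMap (g : EuclideanSpace ℝ (Fin 3) ≃ₗᵢ[ℝ] EuclideanSpace ℝ (Fin 3)) (x : S2) :
    sphMap g.symm (sphMap g x) = x := Subtype.ext (by simp [coe_sphMap])

lemma sphMap_sphMap_symm (g : EuclideanSpace ℝ (Fin 3) ≃ₗᵢ[ℝ] EuclideanSpace ℝ (Fin 3)) (x : S2) :
    sphMap g (sphMap g.symm x) = x := Subtype.ext (by simp [coe_sphMap])

lemma inner_sphMap (g : EuclideanSpace ℝ (Fin 3) ≃ₗᵢ[ℝ] EuclideanSpace ℝ (Fin 3)) (x y : S2) :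
    inner ℝ (sphMap g x).1 (sphMap g y).1 = inner ℝ x.1 y.1 := by
  simp [coe_sphMap]

open Pointwise in
/-- The surface measure is invariant under linear isometries. -/
lemma measurePreserving_sphMap
    (g : EuclideanSpace ℝ (Fin 3) ≃ₗᵢ[ℝ] EuclideanSpace ℝ (Fin 3)) :
    MeasurePreserving (sphMap g) surf surf := by
  refine ⟨(continuous_sphMap g).measurable, ?_⟩
  ext s hs
  rw [Measure.map_apply (continuous_sphMap g).measurable hs, surf,
    Measure.toSphere_apply' _ ((continuous_sphMap g).measurable hs), Measure.toSphere_apply' _ hs]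
  congr 1
  rw [← (g.measurePreserving).measure_preimage_emb g.toHomeomorph.measurableEmbedding
    (Set.Ioo (0 : ℝ) 1 • (Subtype.val '' s))]
  congr 1
  ext v
  simp only [Set.mem_smul, Set.mem_image, Set.mem_preimage]
  constructor
  · rintro ⟨r, hr, _, ⟨x, hx, rfl⟩, rfl⟩
    exact ⟨r, hr, _, ⟨sphMap g x, hx, rfl⟩, by simp [coe_sphMap]⟩
  · rintro ⟨r, hr, _, ⟨x, hx, rfl⟩, h⟩
    refine ⟨r, hr, _, ⟨sphMap g.symm x, by rwa [sphMap_sphMap_symm], rfl⟩, ?_⟩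
    have h' : r • (x : EuclideanSpace ℝ (Fin 3)) = g v := h
    rw [coe_sphMap, ← map_smul, h', LinearIsometryEquiv.symm_apply_apply]

lemma integral_sphMap {E : Type*} [NormedAddCommGroup E] [NormedSpace ℝ E]
    (g : EuclideanSpace ℝ (Fin 3) ≃ₗᵢ[ℝ] EuclideanSpace ℝ (Fin 3)) (f : S2 → E) :
    ∫ x, f (sphMap g x) ∂surf = ∫ x, f x ∂surf := by
  refine (measurePreserving_sphMap g).integral_comp ?_ f
  refine Continuous.measurableEmbedding (continuous_sphMap g) ?_
  intro x y h
  rw [← sphMap_symm_sphMap g x, h, sphMap_symm_sphMap]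

/-- Rotation by the angle with cosine `c` and sine `s` about the third axis. -/
noncomputable def rotZ (c s : ℝ) (h : c ^ 2 + s ^ 2 = 1) :
    EuclideanSpace ℝ (Fin 3) ≃ₗᵢ[ℝ] EuclideanSpace ℝ (Fin 3) :=
  LinearIsometry.toLinearIsometryEquiv
    { toFun := fun x => !₂[c * x 0 - s * x 1, s * x 0 + c * x 1, x 2]
      map_add' := fun x y => by
        ext i; fin_cases i <;> simp <;> ring
      map_smul' := fun a x => by
        ext i; fin_cases i <;> simp <;> ring
      norm_map' := fun x => by
        simp only [LinearMap.coe_mk, AddHom.coe_mk, EuclideanSpace.norm_eq, Fin.sum_univ_three,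
          Real.norm_eq_abs, sq_abs]
        congr 1
        simp
        linear_combination (x 0 ^ 2 + x 1 ^ 2) * h } rfl

lemma rotZ_apply (c s : ℝ) (h : c ^ 2 + s ^ 2 = 1) (x : EuclideanSpace ℝ (Fin 3)) :
    rotZ c s h x = !₂[c * x 0 - s * x 1, s * x 0 + c * x 1, x 2] := rfl

/-- The reflection that changes the sign of the second coordinate. -/
noncomputable def reflY : EuclideanSpace ℝ (Fin 3) ≃ₗᵢ[ℝ] EuclideanSpace ℝ (Fin 3) :=
  LinearIsometry.toLinearIsometryEquiv
    { toFun := fun x => !₂[x 0, - x 1, x 2]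
      map_add' := fun x y => by
        ext i; fin_cases i <;> simp <;> ring
      map_smul' := fun a x => by
        ext i; fin_cases i <;> simp
      norm_map' := fun x => by
        simp only [LinearMap.coe_mk, AddHom.coe_mk, EuclideanSpace.norm_eq, Fin.sum_univ_three,
          Real.norm_eq_abs, sq_abs]
        congr 1
        simp } rfl

lemma reflY_apply (x : EuclideanSpace ℝ (Fin 3)) : reflY x = !₂[x 0, - x 1, x 2] := rfl

/-- Isometries act transitively on the sphere. -/
lemma exists_sphMap_eq (x y : S2) :
    ∃ g : EuclideanSpace ℝ (Fin 3) ≃ₗᵢ[ℝ] EuclideanSpace ℝ (Fin 3), sphMap g x = y := by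
  refine ⟨Submodule.reflection (ℝ ∙ (x.1 - y.1))ᗮ, Subtype.ext ?_⟩
  rw [coe_sphMap]
  exact Submodule.reflection_sub (by simp)

/-- The north pole. -/
noncomputable def northPole : S2 := ⟨EuclideanSpace.single 2 1, by simp⟩

lemma inner_northPole (x : S2) : inner ℝ x.1 northPole.1 = x.1 2 := by
  simp [northPole, EuclideanSpace.inner_single_right]

lemma sq_add_sq_add_sq (x : S2) : x.1 0 ^ 2 + x.1 1 ^ 2 + x.1 2 ^ 2 = 1 := by
  have h : ‖(x : EuclideanSpace ℝ (Fin 3))‖ = 1 := by simp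
  rw [EuclideanSpace.norm_eq, Fin.sum_univ_three, Real.sqrt_eq_one] at h
  simpa using h

lemma inner_mem_Icc (x y : S2) : inner ℝ x.1 y.1 ∈ Set.Icc (-1 : ℝ) 1 := by
  have h := abs_real_inner_le_norm x.1 y.1
  simp only [norm_eq_of_mem_sphere, mul_one] at h
  exact abs_le.1 h

lemma continuous_integrable {E : Type*} [NormedAddCommGroup E] {f : S2 → E} (hf : Continuous f)
    [SecondCountableTopology E] :
    Integrable f surf := by
  have : IsCompact (Set.univ : Set S2) := isCompact_univ
  exact integrableOn_univ.1 (hf.continuousOn.integrableOn_compact this)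

lemma surf_real_univ : surf.real Set.univ = 4 * Real.pi := by
  rw [surf, Measure.toSphere_real_apply_univ, measureReal_def, EuclideanSpace.volume_ball_fin_three]
  have : 0 ≤ Real.pi * 4 / 3 := by positivity
  simp only [ENNReal.ofReal_one, one_pow, ENNReal.toReal_mul, ENNReal.toReal_ofReal this,
    finrank_euclideanSpace, Fintype.card_fin, ENNReal.toReal_one]
  push_cast
  ring

/-- The even moments of a coordinate. Rotations give `∫ (z + t y)^{2j} = (1 + t²)^j ∫ z^{2j}` for
all `t`, and the coefficients of `t²` relate the moments of orders `2j` and `2j - 2`. -/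
lemma integral_coord_pow_even (j : ℕ) :
    ∫ x : S2, x.1 2 ^ (2 * j) ∂surf = 4 * Real.pi / (2 * j + 1) := by
  induction j with
  | zero => simp [surf_real_univ]
  | succ j ih =>
    set n := 2 * (j + 1) with hn
    set M := ∫ x : S2, x.1 2 ^ n ∂surf with hM
    have cont : ∀ i, Continuous fun x : S2 => x.1 i := fun i => by fun_prop
    set A : ℕ → ℝ := fun i => ∫ x : S2, x.1 1 ^ i * x.1 2 ^ (n - i) ∂surf with hA
    have rot : ∀ t : ℝ, ∫ x : S2, (t * x.1 1 + x.1 2) ^ n ∂surf = M * (1 + t ^ 2) ^ (j + 1) := by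
      intro t
      have hs : 0 < Real.sqrt (1 + t ^ 2) := Real.sqrt_pos.2 (by positivity)
      have hs2 : Real.sqrt (1 + t ^ 2) ^ 2 = 1 + t ^ 2 := Real.sq_sqrt (by positivity)
      let u : S2 := ⟨!₂[0, t / Real.sqrt (1 + t ^ 2), 1 / Real.sqrt (1 + t ^ 2)], by
        rw [mem_sphere_zero_iff_norm, EuclideanSpace.norm_eq, Fin.sum_univ_three, Real.sqrt_eq_one]
        simp only [Real.norm_eq_abs, sq_abs]
        simp
        rw [div_pow, hs2]
        field_simp
        ring⟩
      obtain ⟨g, hg⟩ := exists_sphMap_eq u northPole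
      have h1 : ∀ x : S2, t * x.1 1 + x.1 2 = Real.sqrt (1 + t ^ 2) * (sphMap g x).1 2 := by
        intro x
        have hu := inner_sphMap g x u
        rw [hg, inner_northPole] at hu
        rw [hu]
        simp only [u, PiLp.inner_apply, Fin.sum_univ_three]
        simp
        field_simp
      simp_rw [h1, mul_pow]
      rw [integral_const_mul, integral_sphMap g (fun x => x.1 2 ^ n), hn, pow_mul, hs2, ← hn]
      ring
    have hexp : ∀ t : ℝ, ∫ x : S2, (t * x.1 1 + x.1 2) ^ n ∂surf =
        ∑ i ∈ Finset.range (n + 1), t ^ i * (A i * n.choose i) := by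
      intro t
      simp_rw [add_pow]
      rw [integral_finsetSum _ fun i _ => continuous_integrable (by fun_prop)]
      refine Finset.sum_congr rfl fun i _ => ?_
      rw [hA, ← integral_mul_const, ← integral_const_mul]
      congr 1
      ext x
      ring
    have hpoly : ∑ i ∈ Finset.range (n + 1), C (A i * n.choose i) * X ^ i =
        C M * (1 + X ^ 2) ^ (j + 1) := by
      refine Polynomial.funext fun t => ?_
      have h := (hexp t).symm.trans (rot t)
      simp only [eval_finsetSum, eval_mul, eval_C, eval_pow, eval_X, eval_add, eval_one]
      rw [← h]
      exact Finset.sum_congr rfl fun i _ => mul_comm _ _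
    have hcoef := congrArg (fun p => coeff p 2) hpoly
    simp only [finsetSum_coeff, coeff_C_mul, coeff_X_pow] at hcoef
    have h2 : ((1 + X ^ 2 : ℝ[X]) ^ (j + 1)).coeff 2 = j + 1 := by
      have : (1 + X ^ 2 : ℝ[X]) ^ (j + 1) = expand ℝ 2 ((1 + X) ^ (j + 1)) := by simp
      rw [this, show (2 : ℕ) = 1 * 2 by norm_num, coeff_expand_mul (by norm_num),
        coeff_one_add_X_pow]
      simp
    rw [h2, Finset.sum_eq_single 2 (fun i _ hi => by simp [hi.symm])
      (fun h => by simp at h; omega)] at hcoef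
    -- the `x²`- and the `y²`-moments agree by a quarter turn
    have hA2 : A 2 = ∫ x : S2, x.1 0 ^ 2 * x.1 2 ^ (n - 2) ∂surf := by
      rw [hA, ← integral_sphMap (rotZ 0 1 (by norm_num))]
      simp [coe_sphMap, rotZ_apply]
    have hsum : A 2 + A 2 = (∫ x : S2, x.1 2 ^ (2 * j) ∂surf) - M := by
      nth_rewrite 2 [hA2]
      rw [hA, ← integral_add (continuous_integrable (by fun_prop))
        (continuous_integrable (by fun_prop)), hM,
        ← integral_sub (continuous_integrable (by fun_prop)) (continuous_integrable (by fun_prop))]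
      congr 1
      ext x
      have h := sq_add_sq_add_sq x
      rw [show n - 2 = 2 * j by omega, show n = 2 * j + 2 by omega, pow_add]
      linear_combination x.1 2 ^ (2 * j) * h
    have hch : (n.choose 2 : ℝ) = (j + 1) * (2 * j + 1) := by
      rw [Nat.cast_choose_two, hn]; push_cast; ring
    rw [ih] at hsum
    rw [hch] at hcoef
    simp only [if_true, mul_one] at hcoef
    have hj : (j : ℝ) + 1 ≠ 0 := by positivity
    have h3 : A 2 * (2 * j + 1) = M := by
      apply mul_right_cancel₀ hj
      linear_combination hcoef
    have h4 : (2 * (j : ℝ) + 1) * (4 * Real.pi / (2 * j + 1)) = 4 * Real.pi := by field_simp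
    rw [eq_div_iff (by positivity)]
    push_cast
    linear_combination (-2 : ℝ) * h3 + (2 * (j : ℝ) + 1) * hsum + h4

/-- Archimedes' theorem for polynomials. -/
lemma integral_eval_coord (p : ℝ[X]) :
    ∫ x : S2, p.eval (x.1 2) ∂surf = 2 * Real.pi * polyInt p := by
  induction p using Polynomial.induction_on' with
  | add p q hp hq =>
    simp only [eval_add, map_add, mul_add]
    rw [integral_add (continuous_integrable (by fun_prop)) (continuous_integrable (by fun_prop)),
      hp, hq]
  | monomial n a =>
    simp only [eval_monomial, polyInt_apply]
    rw [integral_const_mul, intervalIntegral.integral_const_mul, integral_pow]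
    rcases Nat.even_or_odd' n with ⟨j, rfl | rfl⟩
    · rw [integral_coord_pow_even]
      rw [Odd.neg_one_pow (by simp)]
      push_cast
      ring
    · have h0 : ∫ x : S2, x.1 2 ^ (2 * j + 1) ∂surf = 0 := by
        obtain ⟨g, hg⟩ := exists_sphMap_eq (-northPole) northPole
        have h1 : ∀ x : S2, (sphMap g x).1 2 = - x.1 2 := by
          intro x
          have hu := inner_sphMap g x (-northPole)
          rw [hg, inner_northPole] at hu
          rw [hu]
          simp [inner_neg_right, inner_northPole]
        have h2 := integral_sphMap g (fun x => x.1 2 ^ (2 * j + 1))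
        simp only [h1, Odd.neg_pow (show Odd (2 * j + 1) by simp), integral_neg] at h2
        linarith
      rw [h0, Even.neg_one_pow (by simp [Nat.even_add_one])]
      simp

lemma measure_surf_map (y : S2) :
    surf.map (fun x : S2 => inner ℝ x.1 y.1) = surf.map (fun x : S2 => x.1 2) := by
  obtain ⟨g, hg⟩ := exists_sphMap_eq y northPole
  have h : (fun x : S2 => inner ℝ x.1 y.1) = (fun x : S2 => x.1 2) ∘ sphMap g := by
    ext x
    rw [Function.comp_apply, ← inner_northPole, ← hg, inner_sphMap]
  rw [h, ← Measure.map_map (by fun_prop) (continuous_sphMap g).measurable,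
    (measurePreserving_sphMap g).map_eq]

/-- Archimedes' theorem: a coordinate is uniformly distributed over `[-1, 1]`. -/
lemma surf_map_inner (y : S2) :
    surf.map (fun x : S2 => inner ℝ x.1 y.1) =
      ENNReal.ofReal (2 * Real.pi) • volume.restrict (Set.Icc (-1 : ℝ) 1) := by
  rw [measure_surf_map]
  have hfin : IsFiniteMeasure (ENNReal.ofReal (2 * Real.pi) •
    volume.restrict (Set.Icc (-1 : ℝ) 1)) := ⟨by simp [ENNReal.mul_lt_top_iff]⟩
  have hpi : (0 : ℝ) ≤ 2 * Real.pi := by positivity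
  refine ext_of_forall_integral_eq_of_IsFiniteMeasure fun f => ?_
  rw [integral_map (by fun_prop) (by fun_prop), integral_smul_measure,
    ENNReal.toReal_ofReal hpi, integral_Icc_eq_integral_Ioc,
    ← intervalIntegral.integral_of_le (by norm_num), smul_eq_mul]
  have hmem : ∀ x : S2, x.1 2 ∈ Set.Icc (-1 : ℝ) 1 := fun x => by
    rw [← inner_northPole]; exact inner_mem_Icc _ _
  refine eq_of_forall_dist_le fun ε hε => ?_
  obtain ⟨p, hp⟩ := exists_polynomial_near_of_continuousOn (-1) 1 f f.continuous.continuousOn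
    (ε / (8 * Real.pi)) (by positivity)
  have h1 : |∫ x : S2, f (x.1 2) ∂surf - ∫ x : S2, p.eval (x.1 2) ∂surf| ≤ ε / 2 := by
    rw [← integral_sub (continuous_integrable (by fun_prop)) (continuous_integrable (by fun_prop))]
    have := norm_integral_le_of_norm_le_const (μ := surf)
      (f := fun x : S2 => f (x.1 2) - p.eval (x.1 2)) (C := ε / (8 * Real.pi))
      (Eventually.of_forall fun x => by
        rw [Real.norm_eq_abs, abs_sub_comm]; exact (hp _ (hmem x)).le)
    rw [surf_real_univ, Real.norm_eq_abs] at this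
    refine this.trans (le_of_eq ?_)
    field_simp
    norm_num
  have h2 : |(∫ t in (-1 : ℝ)..1, f t) - polyInt p| ≤ ε / (8 * Real.pi) * 2 := by
    rw [polyInt_apply, ← intervalIntegral.integral_sub (f.continuous.intervalIntegrable _ _)
      (p.continuous.intervalIntegrable _ _)]
    have := intervalIntegral.norm_integral_le_of_norm_le_const (a := -1) (b := 1)
      (f := fun t => f t - p.eval t) (C := ε / (8 * Real.pi)) (fun t ht => by
        rw [Set.uIoc_of_le (by norm_num)] at ht
        rw [Real.norm_eq_abs, abs_sub_comm]
        exact (hp _ (Set.Ioc_subset_Icc_self ht)).le)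
    rw [Real.norm_eq_abs] at this
    refine this.trans (le_of_eq ?_)
    norm_num
  rw [integral_eval_coord] at h1
  have h3 : |2 * Real.pi * polyInt p - 2 * Real.pi * ∫ t in (-1 : ℝ)..1, f t| ≤ ε / 2 := by
    rw [← mul_sub, abs_mul, abs_of_nonneg hpi, abs_sub_comm]
    refine (mul_le_mul_of_nonneg_left h2 hpi).trans (le_of_eq ?_)
    field_simp
    norm_num
  rw [Real.dist_eq]
  calc _ ≤ _ := abs_sub_le _ (2 * Real.pi * polyInt p) _
    _ ≤ ε / 2 + ε / 2 := add_le_add h1 h3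
    _ = ε := by ring

/-- Archimedes' theorem for functions of one coordinate. -/
lemma integral_comp_inner (y : S2) (f : ℝ → ℝ) (hf : Measurable f) :
    ∫ x : S2, f (inner ℝ x.1 y.1) ∂surf = 2 * Real.pi * ∫ t in (-1 : ℝ)..1, f t := by
  rw [← integral_map (φ := fun x : S2 => inner ℝ x.1 y.1) (by fun_prop)
    hf.aestronglyMeasurable, surf_map_inner,
    integral_smul_measure, ENNReal.toReal_ofReal (by positivity), integral_Icc_eq_integral_Ioc,
    ← intervalIntegral.integral_of_le (by norm_num), smul_eq_mul]

/-! ### Orthonormality of the spherical harmonics -/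

/-- The coordinate `x + i y` in the plane orthogonal to the third axis. -/
noncomputable def planar (x : S2) : ℂ := ((x.1 0 : ℝ) : ℂ) + ((x.1 1 : ℝ) : ℂ) * Complex.I

/-- The factor `(sin θ)^{|m|} e^{imφ}`, that is, `(x + i y)^m` for `m ≥ 0` and `(x - i y)^{-m}` for
`m < 0`. -/
noncomputable def planarPow (m : ℤ) (x : S2) : ℂ :=
  if 0 ≤ m then planar x ^ m.natAbs else conj (planar x) ^ m.natAbs

/-- The constant in front of `P_l^{(|m|)}(z)` in the spherical harmonic. -/
noncomputable def harmConst (l : ℕ) (m : ℤ) : ℝ :=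
  Real.sqrt ((2 * (l : ℝ) + 1) / (4 * Real.pi) *
      (((l - m.natAbs).factorial : ℝ) / ((l + m.natAbs).factorial : ℝ))) *
    if 0 ≤ m then (-1) ^ m.natAbs else 1

lemma sphHarm_eq (l : ℕ) (m : ℤ) (x : S2) :
    sphHarm l m x = ((harmConst l m * (derivative^[m.natAbs] (legendreP l)).eval (x.1 2) : ℝ) : ℂ)
      * planarPow m x := by
  rw [sphHarm, planarPow, harmConst]
  split_ifs with h
  · have h1 : m.toNat = m.natAbs := by omega
    rw [sphHarmNonneg, h1, planar]
    push_cast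
    ring
  · rw [sphHarmNonneg, map_mul, Complex.conj_ofReal, map_pow, ← planar]
    push_cast
    have h1 : (-1 : ℂ) ^ m.natAbs * (-1) ^ m.natAbs = 1 := by
      rw [← mul_pow]; norm_num
    linear_combination ((√((2 * (l : ℝ) + 1) / (4 * Real.pi) *
      (((l - m.natAbs).factorial : ℝ) / ((l + m.natAbs).factorial : ℝ))) : ℝ) : ℂ) *
      ((eval (x.1 2) (derivative^[m.natAbs] (legendreP l)) : ℝ) : ℂ) * conj (planar x) ^ m.natAbs * h1

lemma continuous_planar : Continuous planar := by unfold planar; fun_prop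

lemma continuous_planarPow (m : ℤ) : Continuous (planarPow m) := by
  unfold planarPow
  split_ifs
  · exact continuous_planar.pow _
  · exact (Complex.continuous_conj.comp continuous_planar).pow _

lemma continuous_sphHarm (l : ℕ) (m : ℤ) : Continuous (sphHarm l m) := by
  rw [funext (sphHarm_eq l m)]
  have := continuous_planarPow m
  fun_prop

lemma planar_mul_conj (x : S2) : planar x * conj (planar x) = 1 - ((x.1 2 : ℝ) : ℂ) ^ 2 := by
  have h := sq_add_sq_add_sq x
  have h' : ((x.1 0 : ℝ) : ℂ) ^ 2 + ((x.1 1 : ℝ) : ℂ) ^ 2 + ((x.1 2 : ℝ) : ℂ) ^ 2 = 1 := by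
    have h1 := congrArg (fun r : ℝ => (r : ℂ)) h
    push_cast at h1
    exact h1
  simp only [planar, map_add, map_mul, Complex.conj_ofReal, Complex.conj_I]
  linear_combination h' - ((x.1 1 : ℝ) : ℂ) ^ 2 * Complex.I_sq

lemma planarPow_mul_conj (m : ℤ) (x : S2) :
    planarPow m x * conj (planarPow m x) = (1 - ((x.1 2 : ℝ) : ℂ) ^ 2) ^ m.natAbs := by
  rw [← planar_mul_conj, planarPow]
  split_ifs
  · rw [map_pow, ← mul_pow]
  · rw [map_pow, Complex.conj_conj, ← mul_pow, mul_comm]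

lemma planarPow_rotZ (c s : ℝ) (h : c ^ 2 + s ^ 2 = 1) (m : ℤ) (x : S2) :
    planarPow m (sphMap (rotZ c s h) x) = ((c : ℂ) + s * Complex.I) ^ m * planarPow m x := by
  have h1 : planar (sphMap (rotZ c s h) x) = ((c : ℂ) + s * Complex.I) * planar x := by
    simp only [planar, coe_sphMap, rotZ_apply]
    simp
    linear_combination -((s : ℂ) * ((x.1 1 : ℝ) : ℂ)) * Complex.I_sq
  have h2 : ((c : ℂ) + s * Complex.I) * conj ((c : ℂ) + s * Complex.I) = 1 := by
    have h' : (c : ℂ) ^ 2 + (s : ℂ) ^ 2 = 1 := by exact_mod_cast h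
    simp only [map_add, map_mul, Complex.conj_ofReal, Complex.conj_I]
    linear_combination h' - (s : ℂ) ^ 2 * Complex.I_sq
  have h3 : conj ((c : ℂ) + s * Complex.I) = ((c : ℂ) + s * Complex.I)⁻¹ :=
    eq_inv_of_mul_eq_one_right h2
  rw [planarPow, planarPow, h1]
  split_ifs with hm
  · rw [mul_pow]
    congr 1
    rw [← zpow_natCast, Int.natAbs_of_nonneg hm]
  · rw [map_mul, mul_pow, h3]
    congr 1
    rw [← zpow_natCast, inv_zpow', Int.ofNat_natAbs_of_nonpos (by omega), neg_neg]

lemma harmConst_sq (l : ℕ) (m : ℤ) : harmConst l m ^ 2 = (2 * (l : ℝ) + 1) / (4 * Real.pi) *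
    (((l - m.natAbs).factorial : ℝ) / ((l + m.natAbs).factorial : ℝ)) := by
  rw [harmConst, mul_pow, Real.sq_sqrt (by positivity)]
  split_ifs
  · rw [← pow_mul, Even.neg_one_pow (by simp), mul_one]
  · simp

lemma harmConst_ne_zero (l : ℕ) (m : ℤ) : harmConst l m ≠ 0 := by
  intro h
  have h1 := harmConst_sq l m
  rw [h] at h1
  have : 0 < (2 * (l : ℝ) + 1) / (4 * Real.pi) *
    (((l - m.natAbs).factorial : ℝ) / ((l + m.natAbs).factorial : ℝ)) := by positivity
  rw [← h1] at this
  norm_num at this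

/-- Different orders: rotate about the third axis by the angle `π / (m - m')`. -/
lemma integral_sphHarm_mul_conj_of_ne (l l' : ℕ) {m m' : ℤ} (h : m ≠ m') :
    ∫ x, sphHarm l m x * conj (sphHarm l' m' x) ∂surf = 0 := by
  set θ : ℝ := Real.pi / ((m - m' : ℤ) : ℝ) with hθ
  have hk : ((m - m' : ℤ) : ℝ) ≠ 0 := by exact_mod_cast sub_ne_zero.2 h
  have hcs : Real.cos θ ^ 2 + Real.sin θ ^ 2 = 1 := Real.cos_sq_add_sin_sq θ
  have hζ : ((Real.cos θ : ℂ) + Real.sin θ * Complex.I) = Complex.exp (θ * Complex.I) := by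
    rw [Complex.exp_mul_I, Complex.ofReal_cos, Complex.ofReal_sin]
  have hexp : ∀ k : ℤ, Complex.exp (θ * Complex.I) ^ k = Complex.exp (k * (θ * Complex.I)) :=
    fun k => (Complex.exp_int_mul _ _).symm
  have hconj : conj (Complex.exp (θ * Complex.I)) = (Complex.exp (θ * Complex.I))⁻¹ := by
    rw [← Complex.exp_conj, ← Complex.exp_neg]
    simp
  have hz : ∀ x, (sphMap (rotZ (Real.cos θ) (Real.sin θ) hcs) x).1 2 = x.1 2 := fun x => by
    simp [coe_sphMap, rotZ_apply]
  have hpow : Complex.exp (θ * Complex.I) ^ m * conj (Complex.exp (θ * Complex.I) ^ m') = -1 := by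
    rw [map_zpow₀, hconj, inv_zpow, ← zpow_neg, ← zpow_add₀ (Complex.exp_ne_zero _), hexp,
      ← Complex.exp_pi_mul_I]
    congr 1
    have : ((m - m' : ℤ) : ℂ) * (θ : ℂ) = Real.pi := by
      rw [hθ]
      have hk' : ((m - m' : ℤ) : ℂ) ≠ 0 := by exact_mod_cast sub_ne_zero.2 h
      push_cast at hk' ⊢
      field_simp
    push_cast at this ⊢
    linear_combination Complex.I * this
  have h1 := integral_sphMap (rotZ (Real.cos θ) (Real.sin θ) hcs)
    (fun x => sphHarm l m x * conj (sphHarm l' m' x))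
  have h2 : ∀ x, sphHarm l m (sphMap (rotZ (Real.cos θ) (Real.sin θ) hcs) x) *
      conj (sphHarm l' m' (sphMap (rotZ (Real.cos θ) (Real.sin θ) hcs) x)) =
      -(sphHarm l m x * conj (sphHarm l' m' x)) := by
    intro x
    rw [sphHarm_eq, sphHarm_eq, sphHarm_eq, sphHarm_eq, planarPow_rotZ, planarPow_rotZ, hz, hζ]
    simp only [map_mul]
    linear_combination
      ((harmConst l m * eval (x.1 2) (derivative^[m.natAbs] (legendreP l)) : ℝ) *
        planarPow m x * (conj ((harmConst l' m' *
          eval (x.1 2) (derivative^[m'.natAbs] (legendreP l')) : ℝ) : ℂ) *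
            conj (planarPow m' x))) * hpow
  simp only [h2, integral_neg] at h1
  exact self_eq_neg.1 h1.symm

/-- Orthonormality of the spherical harmonics. -/
lemma integral_sphHarm_mul_conj (l l' : ℕ) (m m' : ℤ) (hm : m.natAbs ≤ l) :
    ∫ x, sphHarm l m x * conj (sphHarm l' m' x) ∂surf = if l = l' ∧ m = m' then 1 else 0 := by
  by_cases hmm : m = m'
  · subst hmm
    have h1 : ∀ x, sphHarm l m x * conj (sphHarm l' m x) =
        ((harmConst l m * harmConst l' m * eval (x.1 2) ((1 - X ^ 2) ^ m.natAbs *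
          (derivative^[m.natAbs] (legendreP l) * derivative^[m.natAbs] (legendreP l'))) : ℝ) : ℂ) := by
      intro x
      have h := planarPow_mul_conj m x
      rw [sphHarm_eq, sphHarm_eq]
      simp only [map_mul, Complex.conj_ofReal, eval_mul, eval_pow, eval_sub, eval_one, eval_X]
      push_cast
      rw [← h]
      ring
    simp_rw [h1]
    rw [integral_complex_ofReal, integral_const_mul, integral_eval_coord, polyInt_weight _ _ _ hm]
    simp only [and_true]
    split_ifs with hl
    · subst hl
      rw [← pow_two, harmConst_sq]
      have h1 : ((l - m.natAbs).factorial : ℝ) ≠ 0 := by positivity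
      have h2 : ((l + m.natAbs).factorial : ℝ) ≠ 0 := by positivity
      have h3 : (2 * (l : ℝ) + 1) ≠ 0 := by positivity
      have : (2 * (l : ℝ) + 1) / (4 * Real.pi) *
          (((l - m.natAbs).factorial : ℝ) / ((l + m.natAbs).factorial : ℝ)) * (2 * Real.pi *
          (2 / (2 * l + 1) * ((l + m.natAbs).factorial / (l - m.natAbs).factorial))) = 1 := by
        field_simp
        norm_num
      rw [this]
      simp
    · simp
  · rw [integral_sphHarm_mul_conj_of_ne l l' hmm, if_neg (fun h => hmm h.2)]

/-- The spherical harmonic with a given index. -/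
noncomputable def harm (t : HarmIdx) (x : S2) : ℂ := sphHarm t.1 t.2 x

lemma continuous_harm (t : HarmIdx) : Continuous (harm t) := continuous_sphHarm _ _

lemma natAbs_le_of_harmIdx (t : HarmIdx) : ((t.2 : ℤ)).natAbs ≤ t.1 := by
  have := Finset.mem_Icc.1 t.2.2
  omega

lemma integral_harm_mul_conj (t t' : HarmIdx) :
    ∫ x, harm t x * conj (harm t' x) ∂surf = if t = t' then 1 else 0 := by
  unfold harm
  rw [integral_sphHarm_mul_conj _ _ _ _ (natAbs_le_of_harmIdx t)]
  congr 1
  rcases t with ⟨l, m, hm⟩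
  rcases t' with ⟨l', m', hm'⟩
  simp only [eq_iff_iff, Sigma.mk.injEq]
  constructor
  · rintro ⟨rfl, rfl⟩; simp
  · rintro ⟨rfl, h⟩; simpa using h

/-! ### The addition theorem -/

/-- The restrictions to the sphere of the complex polynomials of degree at most `N`, described as
sums of products of `N` affine forms. In this form the invariance under linear isometries is
clear. -/
noncomputable def spherePoly : ℕ → Submodule ℂ (S2 → ℂ)
  | 0 => Submodule.span ℂ {fun _ => 1}
  | N + 1 => Submodule.span ℂ {h | ∃ f ∈ spherePoly N, ∃ (a : ℝ) (v : EuclideanSpace ℝ (Fin 3)),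
      h = fun x => f x * ((a + inner ℝ v x.1 : ℝ) : ℂ)}

lemma mul_affine_mem_spherePoly {N : ℕ} {f : S2 → ℂ} (hf : f ∈ spherePoly N) (a : ℝ)
    (v : EuclideanSpace ℝ (Fin 3)) :
    (fun x : S2 => f x * ((a + inner ℝ v x.1 : ℝ) : ℂ)) ∈ spherePoly (N + 1) :=
  Submodule.subset_span ⟨f, hf, a, v, rfl⟩

lemma spherePoly_mono : Monotone spherePoly := by
  refine monotone_nat_of_le_succ fun N f hf => ?_
  simpa using mul_affine_mem_spherePoly hf 1 0

lemma comp_sphMap_mem_spherePoly {N : ℕ} {f : S2 → ℂ} (hf : f ∈ spherePoly N)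
    (g : EuclideanSpace ℝ (Fin 3) ≃ₗᵢ[ℝ] EuclideanSpace ℝ (Fin 3)) :
    (fun x => f (sphMap g x)) ∈ spherePoly N := by
  induction N generalizing f with
  | zero =>
    obtain ⟨c, rfl⟩ := Submodule.mem_span_singleton.1 hf
    exact Submodule.mem_span_singleton.2 ⟨c, rfl⟩
  | succ N ih =>
    induction hf using Submodule.span_induction with
    | mem h hh =>
      obtain ⟨f, hf, a, v, rfl⟩ := hh
      have h1 := mul_affine_mem_spherePoly (ih hf) a (g.symm v)
      convert h1 using 5 with x
      rw [coe_sphMap, ← LinearIsometryEquiv.inner_map_map g (g.symm v),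
        LinearIsometryEquiv.apply_symm_apply]
    | zero => exact Submodule.zero_mem _
    | add f f' _ _ h h' => exact Submodule.add_mem _ h h'
    | smul c f _ h => exact Submodule.smul_mem _ c h

lemma mul_coord_mem_spherePoly {N : ℕ} {f : S2 → ℂ} (hf : f ∈ spherePoly N) (i : Fin 3) :
    (fun x : S2 => f x * ((x.1 i : ℝ) : ℂ)) ∈ spherePoly (N + 1) := by
  simpa [EuclideanSpace.inner_single_left] using
    mul_affine_mem_spherePoly hf 0 (EuclideanSpace.single i 1)

lemma mul_planar_mem_spherePoly {N : ℕ} {f : S2 → ℂ} (hf : f ∈ spherePoly N) :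
    (fun x : S2 => f x * planar x) ∈ spherePoly (N + 1) := by
  have h := Submodule.add_mem _ (mul_coord_mem_spherePoly hf 0)
    (Submodule.smul_mem _ Complex.I (mul_coord_mem_spherePoly hf 1))
  convert h using 1
  ext x
  simp [planar]
  ring

lemma mul_conj_planar_mem_spherePoly {N : ℕ} {f : S2 → ℂ} (hf : f ∈ spherePoly N) :
    (fun x : S2 => f x * conj (planar x)) ∈ spherePoly (N + 1) := by
  have h := Submodule.sub_mem _ (mul_coord_mem_spherePoly hf 0)
    (Submodule.smul_mem _ Complex.I (mul_coord_mem_spherePoly hf 1))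
  convert h using 1
  ext x
  simp [planar]
  ring

lemma planarPow_mem_spherePoly (m : ℤ) : planarPow m ∈ spherePoly m.natAbs := by
  have h1 : ∀ n : ℕ, (fun x => planar x ^ n) ∈ spherePoly n := by
    intro n
    induction n with
    | zero => simp only [pow_zero]; exact Submodule.subset_span rfl
    | succ n ih => simp only [pow_succ]; exact mul_planar_mem_spherePoly ih
  have h2 : ∀ n : ℕ, (fun x => conj (planar x) ^ n) ∈ spherePoly n := by
    intro n
    induction n with
    | zero => simp only [pow_zero]; exact Submodule.subset_span rfl
    | succ n ih => simp only [pow_succ]; exact mul_conj_planar_mem_spherePoly ih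
  by_cases hm : 0 ≤ m
  · have : planarPow m = fun x => planar x ^ m.natAbs := by ext x; rw [planarPow, if_pos hm]
    rw [this]; exact h1 _
  · have : planarPow m = fun x => conj (planar x) ^ m.natAbs := by
      ext x; rw [planarPow, if_neg hm]
    rw [this]; exact h2 _

lemma planarPow_mul_eval_mem_spherePoly (m : ℤ) (p : ℝ[X]) {N : ℕ}
    (h : p.natDegree + m.natAbs ≤ N) :
    (fun x : S2 => planarPow m x * ((p.eval (x.1 2) : ℝ) : ℂ)) ∈ spherePoly N := by
  have hpow : ∀ k : ℕ, (fun x : S2 => planarPow m x * ((x.1 2 : ℝ) : ℂ) ^ k) ∈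
      spherePoly (m.natAbs + k) := by
    intro k
    induction k with
    | zero => simpa using planarPow_mem_spherePoly m
    | succ k ih =>
      simp only [pow_succ, ← mul_assoc]
      exact mul_coord_mem_spherePoly ih 2
  have hsum : (fun x : S2 => planarPow m x * ((p.eval (x.1 2) : ℝ) : ℂ)) =
      ∑ k ∈ Finset.range (p.natDegree + 1), ((p.coeff k : ℝ) : ℂ) •
        (fun x : S2 => planarPow m x * ((x.1 2 : ℝ) : ℂ) ^ k) := by
    ext x
    rw [eval_eq_sum_range, Finset.sum_apply, Complex.ofReal_sum, Finset.mul_sum]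
    refine Finset.sum_congr rfl fun k _ => ?_
    simp
    ring
  rw [hsum]
  refine Submodule.sum_mem _ fun k hk => Submodule.smul_mem _ _ (spherePoly_mono ?_ (hpow k))
  have := Finset.mem_range.1 hk
  omega

lemma harm_mem_spherePoly (t : HarmIdx) : harm t ∈ spherePoly t.1 := by
  have h := Submodule.smul_mem _ ((harmConst t.1 t.2 : ℝ) : ℂ)
    (planarPow_mul_eval_mem_spherePoly t.2 (derivative^[(t.2 : ℤ).natAbs] (legendreP t.1))
      (N := t.1) (by
        have h1 := natDegree_iterate_derivative_legendreP_le t.1 (t.2 : ℤ).natAbs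
        have h2 := natAbs_le_of_harmIdx t
        omega))
  convert h using 1
  ext x
  rw [harm, sphHarm_eq]
  simp
  ring

/-- The indices of the spherical harmonics of degree at most `N`. -/
noncomputable def idxLe (N : ℕ) : Finset HarmIdx := (Finset.range (N + 1)).sigma fun _ => Finset.univ

lemma mem_idxLe {N : ℕ} {t : HarmIdx} : t ∈ idxLe N ↔ t.1 ≤ N := by
  simp [idxLe]

lemma sum_idxLe {E : Type*} [AddCommMonoid E] (N : ℕ) (f : HarmIdx → E) :
    ∑ t ∈ idxLe N, f t = ∑ l ∈ Finset.range (N + 1), ∑ m, f ⟨l, m⟩ := by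
  rw [idxLe, Finset.sum_sigma]

/-- The span of the spherical harmonics of degree at most `N`. -/
noncomputable def harmSpan (N : ℕ) : Submodule ℂ (S2 → ℂ) :=
  Submodule.span ℂ (harm '' {t | t.1 ≤ N})

lemma harm_mem_harmSpan {N : ℕ} {t : HarmIdx} (h : t.1 ≤ N) : harm t ∈ harmSpan N :=
  Submodule.subset_span ⟨t, h, rfl⟩

lemma harmSpan_le_spherePoly (N : ℕ) : harmSpan N ≤ spherePoly N := by
  refine Submodule.span_le.2 ?_
  rintro _ ⟨t, ht, rfl⟩
  exact spherePoly_mono ht (harm_mem_spherePoly t)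

lemma planarPow_mul_eval_mem_harmSpan (m : ℤ) (p : ℝ[X]) {N : ℕ}
    (h : p.natDegree + m.natAbs ≤ N) :
    (fun x : S2 => planarPow m x * ((p.eval (x.1 2) : ℝ) : ℂ)) ∈ harmSpan N := by
  have hp := mem_span_iterate_derivative_legendreP m.natAbs (N - m.natAbs) p (by omega)
  have hmN : m.natAbs ≤ N := by omega
  clear h
  induction hp using Submodule.span_induction with
  | mem q hq =>
    obtain ⟨l, hl, rfl⟩ := hq
    simp only [Set.mem_ofPred_eq] at hl
    have hmem : m ∈ Finset.Icc (-((l + m.natAbs : ℕ) : ℤ)) ((l + m.natAbs : ℕ) : ℤ) :=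
      Finset.mem_Icc.2 ⟨by omega, by omega⟩
    have h1 := Submodule.smul_mem _ ((harmConst (l + m.natAbs) m : ℝ) : ℂ)⁻¹
      (harm_mem_harmSpan (N := N) (t := ⟨l + m.natAbs, m, hmem⟩) (show l + m.natAbs ≤ N by omega))
    convert h1 using 1
    ext x
    have hc : ((harmConst (l + m.natAbs) m : ℝ) : ℂ) ≠ 0 := by
      exact_mod_cast harmConst_ne_zero _ _
    rw [Pi.smul_apply, harm, sphHarm_eq, smul_eq_mul]
    push_cast
    field_simp
  | zero => simp only [eval_zero, Complex.ofReal_zero, mul_zero]; exact Submodule.zero_mem _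
  | add p q _ _ hp hq =>
    convert Submodule.add_mem _ hp hq using 1
    ext x
    simp [mul_add]
  | smul a p _ hp =>
    convert Submodule.smul_mem _ (a : ℂ) hp using 1
    ext x
    simp
    ring

lemma planarPow_mul_planar (m : ℤ) (x : S2) : planarPow m x * planar x =
    planarPow (m + 1) x * if 0 ≤ m then 1 else (1 - ((x.1 2 : ℝ) : ℂ) ^ 2) := by
  rw [planarPow, planarPow]
  split_ifs with h1 h2 h2
  · rw [show (m + 1).natAbs = m.natAbs + 1 by omega]; ring
  · omega
  · rw [show (m + 1).natAbs = 0 by omega, show m.natAbs = 1 by omega, ← planar_mul_conj]; ring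
  · rw [show m.natAbs = (m + 1).natAbs + 1 by omega, ← planar_mul_conj]; ring

lemma conj_planarPow (m : ℤ) (x : S2) : conj (planarPow m x) = planarPow (-m) x := by
  rw [planarPow, planarPow]
  split_ifs with h1 h2 h2
  · rw [show m.natAbs = 0 by omega, show (-m).natAbs = 0 by omega]; simp
  · rw [map_pow, Int.natAbs_neg]
  · rw [map_pow, Complex.conj_conj, Int.natAbs_neg]
  · omega

lemma planarPow_mul_conj_planar (m : ℤ) (x : S2) : planarPow m x * conj (planar x) =
    planarPow (m - 1) x * if m ≤ 0 then 1 else (1 - ((x.1 2 : ℝ) : ℂ) ^ 2) := by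
  have h := congrArg conj (planarPow_mul_planar (-m) x)
  rw [map_mul, conj_planarPow, neg_neg, map_mul, conj_planarPow,
    show -(-m + 1) = m - 1 by ring] at h
  rw [h]
  congr 1
  by_cases hm : m ≤ 0
  · simp [hm]
  · simp [hm]

lemma spherePoly_le_harmSpan (N : ℕ) : spherePoly N ≤ harmSpan N := by
  -- the intermediate space is spanned by the functions `planarPow m * p(z)`
  set B : ℕ → Submodule ℂ (S2 → ℂ) := fun N => Submodule.span ℂ
    {h | ∃ (m : ℤ) (p : ℝ[X]), p.natDegree + m.natAbs ≤ N ∧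
      h = fun x : S2 => planarPow m x * ((p.eval (x.1 2) : ℝ) : ℂ)} with hB
  have gen : ∀ {N : ℕ} (m : ℤ) (p : ℝ[X]), p.natDegree + m.natAbs ≤ N →
      (fun x : S2 => planarPow m x * ((p.eval (x.1 2) : ℝ) : ℂ)) ∈ B N :=
    fun m p h => Submodule.subset_span ⟨m, p, h, rfl⟩
  have hdX : ∀ p : ℝ[X], (p * X).natDegree ≤ p.natDegree + 1 := fun p =>
    natDegree_mul_le.trans (by simp)
  have hd1 : ∀ p : ℝ[X], (p * (1 - X ^ 2)).natDegree ≤ p.natDegree + 2 := fun p =>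
    natDegree_mul_le.trans (add_le_add le_rfl (by compute_degree))
  have hw : ∀ {N : ℕ} (m : ℤ) (p : ℝ[X]), p.natDegree + m.natAbs ≤ N →
      (fun x : S2 => planarPow m x * ((p.eval (x.1 2) : ℝ) : ℂ) * planar x) ∈ B (N + 1) := by
    intro N m p h
    by_cases hm : 0 ≤ m
    · convert gen (N := N + 1) (m + 1) p (by omega) using 1
      ext x
      have := planarPow_mul_planar m x
      rw [if_pos hm] at this
      linear_combination ((p.eval (x.1 2) : ℝ) : ℂ) * this
    · convert gen (N := N + 1) (m + 1) (p * (1 - X ^ 2)) (by have := hd1 p; omega) using 1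
      ext x
      have := planarPow_mul_planar m x
      rw [if_neg hm] at this
      simp only [eval_mul, eval_sub, eval_one, eval_pow, eval_X]
      push_cast
      linear_combination ((p.eval (x.1 2) : ℝ) : ℂ) * this
  have hwc : ∀ {N : ℕ} (m : ℤ) (p : ℝ[X]), p.natDegree + m.natAbs ≤ N →
      (fun x : S2 => planarPow m x * ((p.eval (x.1 2) : ℝ) : ℂ) * conj (planar x)) ∈
        B (N + 1) := by
    intro N m p h
    by_cases hm : m ≤ 0
    · convert gen (N := N + 1) (m - 1) p (by omega) using 1
      ext x
      have := planarPow_mul_conj_planar m x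
      rw [if_pos hm] at this
      linear_combination ((p.eval (x.1 2) : ℝ) : ℂ) * this
    · convert gen (N := N + 1) (m - 1) (p * (1 - X ^ 2)) (by have := hd1 p; omega) using 1
      ext x
      have := planarPow_mul_conj_planar m x
      rw [if_neg hm] at this
      simp only [eval_mul, eval_sub, eval_one, eval_pow, eval_X]
      push_cast
      linear_combination ((p.eval (x.1 2) : ℝ) : ℂ) * this
  have hAff : ∀ {N : ℕ} {f : S2 → ℂ}, f ∈ B N → ∀ (a : ℝ) (v : EuclideanSpace ℝ (Fin 3)),
      (fun x : S2 => f x * ((a + inner ℝ v x.1 : ℝ) : ℂ)) ∈ B (N + 1) := by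
    intro N f hf a v
    induction hf using Submodule.span_induction with
    | mem h hh =>
      obtain ⟨m, p, hmp, rfl⟩ := hh
      have h1 := gen (N := N + 1) m p (by omega)
      have h2 := gen (N := N + 1) m (p * X) (by have := hdX p; omega)
      have h3 := hw m p hmp
      have h4 := hwc m p hmp
      convert Submodule.add_mem _ (Submodule.add_mem _ (Submodule.smul_mem _ (a : ℂ) h1)
        (Submodule.smul_mem _ ((v 2 : ℝ) : ℂ) h2))
        (Submodule.add_mem _
          (Submodule.smul_mem _ (((v 0 : ℝ) : ℂ) / 2 - Complex.I * ((v 1 : ℝ) : ℂ) / 2) h3)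
          (Submodule.smul_mem _ (((v 0 : ℝ) : ℂ) / 2 + Complex.I * ((v 1 : ℝ) : ℂ) / 2) h4)) using 1
      ext x
      simp [PiLp.inner_apply, Fin.sum_univ_three, planar]
      linear_combination (planarPow m x * ((p.eval (x.1 2) : ℝ) : ℂ) * ((v 1 : ℝ) : ℂ) *
        ((x.1 1 : ℝ) : ℂ)) * Complex.I_sq
    | zero => simp only [Pi.zero_apply, zero_mul]; exact Submodule.zero_mem _
    | add f f' _ _ h h' =>
      convert Submodule.add_mem _ h h' using 1
      ext x; simp [add_mul]
    | smul c f _ h =>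
      convert Submodule.smul_mem _ c h using 1
      ext x; simp [mul_assoc]
  have h1 : ∀ N, spherePoly N ≤ B N := by
    intro N
    induction N with
    | zero =>
      refine Submodule.span_le.2 ?_
      rintro _ rfl
      simpa [planarPow] using gen (N := 0) 0 1 (by simp)
    | succ N ih =>
      refine Submodule.span_le.2 ?_
      rintro _ ⟨f, hf, a, v, rfl⟩
      exact hAff (ih hf) a v
  refine (h1 N).trans (Submodule.span_le.2 ?_)
  rintro _ ⟨m, p, hmp, rfl⟩
  exact planarPow_mul_eval_mem_harmSpan m p hmp

lemma comp_sphMap_mem_harmSpan {N : ℕ} {f : S2 → ℂ} (hf : f ∈ harmSpan N)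
    (g : EuclideanSpace ℝ (Fin 3) ≃ₗᵢ[ℝ] EuclideanSpace ℝ (Fin 3)) :
    (fun x => f (sphMap g x)) ∈ harmSpan N :=
  spherePoly_le_harmSpan N (comp_sphMap_mem_spherePoly (harmSpan_le_spherePoly N hf) g)

/-- The reproducing kernel of the polynomials of degree at most `N`. -/
noncomputable def reprKernel (N : ℕ) (x y : S2) : ℂ := ∑ t ∈ idxLe N, harm t x * conj (harm t y)

lemma conj_reprKernel (N : ℕ) (x y : S2) : conj (reprKernel N x y) = reprKernel N y x := by
  simp [reprKernel, map_sum, mul_comm]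

lemma reprKernel_mem_harmSpan (N : ℕ) (y : S2) : (fun x => reprKernel N x y) ∈ harmSpan N := by
  have : (fun x => reprKernel N x y) = ∑ t ∈ idxLe N, conj (harm t y) • harm t := by
    ext x; simp [reprKernel, mul_comm]
  rw [this]
  exact Submodule.sum_mem _ fun t ht =>
    Submodule.smul_mem _ _ (harm_mem_harmSpan (mem_idxLe.1 ht))

lemma continuous_reprKernel_right (N : ℕ) (x : S2) : Continuous fun y => reprKernel N x y := by
  unfold reprKernel
  exact continuous_finsetSum _ fun t _ =>
    continuous_const.mul (Complex.continuous_conj.comp (continuous_harm t))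

lemma continuous_of_mem_harmSpan {N : ℕ} {f : S2 → ℂ} (hf : f ∈ harmSpan N) : Continuous f := by
  induction hf using Submodule.span_induction with
  | mem f hf => obtain ⟨t, -, rfl⟩ := hf; exact continuous_harm t
  | zero => exact continuous_zero
  | add f f' _ _ h h' => exact h.add h'
  | smul c f _ h => exact h.const_smul c

lemma integral_reprKernel_mul {N : ℕ} {f : S2 → ℂ} (hf : f ∈ harmSpan N) (x : S2) :
    ∫ y, reprKernel N x y * f y ∂surf = f x := by
  induction hf using Submodule.span_induction with
  | mem f hf =>
    obtain ⟨t, ht, rfl⟩ := hf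
    simp only [reprKernel, Finset.sum_mul]
    rw [integral_finsetSum]
    · have : ∀ s ∈ idxLe N, ∫ y, harm s x * conj (harm s y) * harm t y ∂surf =
          if s = t then harm s x else 0 := by
        intro s _
        have h1 : ∀ y, harm s x * conj (harm s y) * harm t y =
          harm s x * (harm t y * conj (harm s y)) := fun y => by ring
        simp_rw [h1]
        rw [integral_const_mul, integral_harm_mul_conj]
        by_cases h : t = s
        · simp [h]
        · simp [h, Ne.symm h]
      rw [Finset.sum_congr rfl this, Finset.sum_ite_eq', if_pos (mem_idxLe.2 ht)]
    · intro s _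
      exact continuous_integrable ((continuous_const.mul
        (Complex.continuous_conj.comp (continuous_harm s))).mul (continuous_harm t))
  | zero => simp
  | add f f' hf hf' h h' =>
    simp only [Pi.add_apply, mul_add]
    rw [integral_add, h, h']
    · exact continuous_integrable
        ((continuous_reprKernel_right N x).mul (continuous_of_mem_harmSpan hf))
    · exact continuous_integrable
        ((continuous_reprKernel_right N x).mul (continuous_of_mem_harmSpan hf'))
  | smul c f _ h =>
    have : ∀ y, reprKernel N x y * (c • f) y = c * (reprKernel N x y * f y) := fun y => by
      simp; ring
    simp_rw [this]
    rw [integral_const_mul, h]; simp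

/-- The reproducing kernel of an isometry-invariant space is isometry-invariant. -/
lemma reprKernel_sphMap (N : ℕ)
    (g : EuclideanSpace ℝ (Fin 3) ≃ₗᵢ[ℝ] EuclideanSpace ℝ (Fin 3)) (x y : S2) :
    reprKernel N (sphMap g x) (sphMap g y) = reprKernel N x y := by
  have h1 := integral_reprKernel_mul
    (comp_sphMap_mem_harmSpan (reprKernel_mem_harmSpan N (sphMap g y)) g) x
  have h2 := integral_reprKernel_mul
    (comp_sphMap_mem_harmSpan (reprKernel_mem_harmSpan N x) g.symm) (sphMap g y)
  simp only [sphMap_symm_sphMap] at h2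
  rw [← h1, ← conj_reprKernel, ← h2, ← integral_conj,
    ← integral_sphMap g (fun z => conj (reprKernel N (sphMap g y) z *
      reprKernel N (sphMap g.symm z) x))]
  refine integral_congr_ae (Eventually.of_forall fun z => ?_)
  simp only [map_mul, conj_reprKernel, sphMap_symm_sphMap]
  ring

/-- The zonal kernel `Z_l(x, y) = (2l + 1) / (4π) P_l(⟨x, y⟩)`. -/
noncomputable def zonal (l : ℕ) (x y : S2) : ℝ :=
  (2 * (l : ℝ) + 1) / (4 * Real.pi) * (legendreP l).eval (inner ℝ x.1 y.1)

lemma planarPow_northPole (m : ℤ) : planarPow m northPole = if m = 0 then 1 else 0 := by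
  have h : planar northPole = 0 := by simp [planar, northPole]
  rw [planarPow, h]
  by_cases hm : m = 0
  · simp [hm]
  · simp [hm]

/-- The addition theorem for spherical harmonics. -/
theorem sum_harm_mul_conj (l : ℕ) (x y : S2) :
    ∑ m, harm ⟨l, m⟩ x * conj (harm ⟨l, m⟩ y) = (zonal l x y : ℂ) := by
  have hinv : ∀ (g : EuclideanSpace ℝ (Fin 3) ≃ₗᵢ[ℝ] EuclideanSpace ℝ (Fin 3)) (x y : S2),
      ∑ m, harm ⟨l, m⟩ (sphMap g x) * conj (harm ⟨l, m⟩ (sphMap g y)) =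
        ∑ m, harm ⟨l, m⟩ x * conj (harm ⟨l, m⟩ y) := by
    intro g x y
    have h := reprKernel_sphMap l g x y
    simp only [reprKernel, sum_idxLe, Finset.sum_range_succ] at h
    rcases l with _ | l
    · simpa using h
    · have h' := reprKernel_sphMap l g x y
      simp only [reprKernel, sum_idxLe] at h'
      rw [h'] at h
      exact add_left_cancel h
  obtain ⟨g, hg⟩ := exists_sphMap_eq y northPole
  rw [← hinv g, hg]
  have h0 : (0 : ℤ) ∈ Finset.Icc (-(l : ℤ)) l := by simp
  have hn : northPole.1 2 = 1 := by simp [northPole]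
  rw [Finset.sum_eq_single ⟨0, h0⟩]
  · simp only [harm, sphHarm_eq, planarPow_northPole, hn]
    have hz := inner_sphMap g x y
    rw [hg, inner_northPole] at hz
    rw [zonal, ← hz]
    have hc := harmConst_sq l 0
    have hl : (l.factorial : ℝ) ≠ 0 := by positivity
    simp only [Int.natAbs_zero, tsub_zero, add_zero, div_self hl, mul_one] at hc
    rw [← hc]
    simp [planarPow, eval_one_legendreP]
    ring
  · intro m _ hm
    have hm' : (m : ℤ) ≠ 0 := fun h => hm (Subtype.ext h)
    simp [harm, sphHarm_eq, planarPow_northPole, hm']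
  · simp

/-! ### Bounds for zonal kernels -/

lemma zonal_self (l : ℕ) (x : S2) : zonal l x x = (2 * (l : ℝ) + 1) / (4 * Real.pi) := by
  rw [zonal, real_inner_self_eq_norm_sq]
  simp [eval_one_legendreP]

lemma sum_norm_harm_sq (l : ℕ) (x : S2) :
    ∑ m, ‖harm ⟨l, m⟩ x‖ ^ 2 = (2 * (l : ℝ) + 1) / (4 * Real.pi) := by
  rw [← zonal_self l x]
  have h := sum_harm_mul_conj l x x
  have h1 : ∀ m, harm ⟨l, m⟩ x * conj (harm ⟨l, m⟩ x) = ((‖harm ⟨l, m⟩ x‖ ^ 2 : ℝ) : ℂ) :=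
    fun m => by rw [Complex.mul_conj']; norm_cast
  simp_rw [h1] at h
  exact_mod_cast h

lemma sum_norm_harm_mul_norm_harm_le (l : ℕ) (x y : S2) :
    ∑ m, ‖harm ⟨l, m⟩ x‖ * ‖harm ⟨l, m⟩ y‖ ≤ (2 * (l : ℝ) + 1) / (4 * Real.pi) := by
  have h : ∀ m, ‖harm ⟨l, m⟩ x‖ * ‖harm ⟨l, m⟩ y‖ ≤
      (‖harm ⟨l, m⟩ x‖ ^ 2 + ‖harm ⟨l, m⟩ y‖ ^ 2) / 2 := fun m => by
    nlinarith [sq_nonneg (‖harm ⟨l, m⟩ x‖ - ‖harm ⟨l, m⟩ y‖)]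
  refine (Finset.sum_le_sum fun m _ => h m).trans (le_of_eq ?_)
  rw [← Finset.sum_div, Finset.sum_add_distrib, sum_norm_harm_sq, sum_norm_harm_sq]
  ring

/-- The point of the sphere in the half-plane `y = 0`, `x ≥ 0` at height `t`. -/
noncomputable def meridian (t : ℝ) (ht : t ∈ Set.Icc (-1 : ℝ) 1) : S2 :=
  ⟨!₂[Real.sqrt (1 - t ^ 2), 0, t], by
    have : 0 ≤ 1 - t ^ 2 := by nlinarith [ht.1, ht.2]
    rw [mem_sphere_zero_iff_norm, EuclideanSpace.norm_eq, Fin.sum_univ_three, Real.sqrt_eq_one]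
    simp [Real.sq_sqrt this]⟩

lemma inner_meridian (t : ℝ) (ht : t ∈ Set.Icc (-1 : ℝ) 1) :
    inner ℝ (meridian t ht).1 northPole.1 = t := by
  rw [inner_northPole]; simp [meridian]

/-- By the addition theorem `(2l + 1) / (4π) P_l(⟨x, y⟩)` is a Gram matrix with constant diagonal. -/
lemma abs_eval_legendreP_le_one (l : ℕ) {t : ℝ} (ht : t ∈ Set.Icc (-1 : ℝ) 1) :
    |(legendreP l).eval t| ≤ 1 := by
  have h := congrArg norm (sum_harm_mul_conj l (meridian t ht) northPole)
  have h1 : ‖∑ m, harm ⟨l, m⟩ (meridian t ht) * conj (harm ⟨l, m⟩ northPole)‖ ≤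
      (2 * (l : ℝ) + 1) / (4 * Real.pi) := by
    refine (norm_sum_le _ _).trans ?_
    simpa using sum_norm_harm_mul_norm_harm_le l (meridian t ht) northPole
  rw [h, Complex.norm_real, Real.norm_eq_abs, zonal, inner_meridian, abs_mul] at h1
  have h2 : 0 < (2 * (l : ℝ) + 1) / (4 * Real.pi) := by positivity
  rw [abs_of_pos h2] at h1
  exact le_of_mul_le_mul_left (by simpa using h1) h2

/-! ### Legendre series with summable nonnegative coefficients -/

/-- The sum of the Legendre series with coefficients `u`. -/
noncomputable def legSeries (u : ℕ → ℝ) (t : ℝ) : ℝ := ∑' l, u l * (legendreP l).eval t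

/-- The Clebsch-Gordan convolution of two sequences. -/
noncomputable def cgConv (u v : ℕ → ℝ) (l : ℕ) : ℝ := ∑' L : ℕ, ∑' k : ℕ, u L * v k * cg0 L k l ^ 2

lemma summable_mul_legendreP {u : ℕ → ℝ} (hs : Summable u) (h0 : ∀ l, 0 ≤ u l) {t : ℝ}
    (ht : t ∈ Set.Icc (-1 : ℝ) 1) : Summable fun l => u l * (legendreP l).eval t := by
  refine Summable.of_norm_bounded hs fun l => ?_
  rw [norm_mul, Real.norm_of_nonneg (h0 l)]
  exact mul_le_of_le_one_right (h0 l) (abs_eval_legendreP_le_one l ht)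

lemma abs_legSeries_le {u : ℕ → ℝ} (hs : Summable u) (h0 : ∀ l, 0 ≤ u l) {t : ℝ}
    (ht : t ∈ Set.Icc (-1 : ℝ) 1) : |legSeries u t| ≤ ∑' l, u l := by
  rw [legSeries, ← Real.norm_eq_abs]
  refine tsum_of_norm_bounded hs.hasSum fun l => ?_
  rw [norm_mul, Real.norm_of_nonneg (h0 l)]
  exact mul_le_of_le_one_right (h0 l) (abs_eval_legendreP_le_one l ht)

lemma hasSum_cg0_sq_mul_legendreP (a b : ℕ) (t : ℝ) :
    HasSum (fun c => cg0 a b c ^ 2 * (legendreP c).eval t)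
      ((legendreP a).eval t * (legendreP b).eval t) := by
  rw [← eval_mul, legendreP_mul_eq_sum]
  simp only [eval_finsetSum, eval_smul, smul_eq_mul]
  refine hasSum_sum_of_ne_finset_zero fun c hc => ?_
  rw [cg0_eq_zero_of_not_triangle (by simp at hc; omega)]
  simp

lemma hasSum_cg0_sq (a b : ℕ) : HasSum (fun c => cg0 a b c ^ 2) 1 := by
  simpa [eval_one_legendreP] using hasSum_cg0_sq_mul_legendreP a b 1

lemma cg0_sq_le_one (a b c : ℕ) : cg0 a b c ^ 2 ≤ 1 :=
  le_hasSum (hasSum_cg0_sq a b) c fun _ _ => sq_nonneg _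

section conv

variable {u v : ℕ → ℝ}

lemma cgConv_nonneg (hu0 : ∀ l, 0 ≤ u l) (hv0 : ∀ l, 0 ≤ v l) (l : ℕ) : 0 ≤ cgConv u v l :=
  tsum_nonneg fun L => tsum_nonneg fun k => mul_nonneg (mul_nonneg (hu0 L) (hv0 k)) (sq_nonneg _)

lemma summable_cgConv_triple (hu : Summable u) (hu0 : ∀ l, 0 ≤ u l) (hv : Summable v)
    (hv0 : ∀ l, 0 ≤ v l) :
    Summable fun p : (ℕ × ℕ) × ℕ => u p.1.1 * v p.1.2 * cg0 p.1.1 p.1.2 p.2 ^ 2 := by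
  have hn : 0 ≤ fun p : (ℕ × ℕ) × ℕ => u p.1.1 * v p.1.2 * cg0 p.1.1 p.1.2 p.2 ^ 2 := fun p =>
    mul_nonneg (mul_nonneg (hu0 p.1.1) (hv0 p.1.2)) (sq_nonneg _)
  have h1 : ∀ p : ℕ × ℕ, HasSum (fun l => u p.1 * v p.2 * cg0 p.1 p.2 l ^ 2) (u p.1 * v p.2) :=
    fun p => by simpa using (hasSum_cg0_sq p.1 p.2).mul_left (u p.1 * v p.2)
  refine (summable_prod_of_nonneg hn).2 ⟨fun p => (h1 p).summable, ?_⟩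
  exact (hu.mul_of_nonneg hv hu0 hv0).congr fun p => (h1 p).tsum_eq.symm

lemma summable_cgConv_pair (hu : Summable u) (hu0 : ∀ l, 0 ≤ u l) (hv : Summable v)
    (hv0 : ∀ l, 0 ≤ v l) (l : ℕ) :
    Summable fun p : ℕ × ℕ => u p.1 * v p.2 * cg0 p.1 p.2 l ^ 2 :=
  ((summable_cgConv_triple hu hu0 hv hv0).prod_symm).prod_factor l

lemma cgConv_eq_tsum_prod (hu : Summable u) (hu0 : ∀ l, 0 ≤ u l) (hv : Summable v)
    (hv0 : ∀ l, 0 ≤ v l) (l : ℕ) :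
    cgConv u v l = ∑' p : ℕ × ℕ, u p.1 * v p.2 * cg0 p.1 p.2 l ^ 2 :=
  ((summable_cgConv_pair hu hu0 hv hv0 l).tsum_prod).symm

lemma summable_cgConv (hu : Summable u) (hu0 : ∀ l, 0 ≤ u l) (hv : Summable v)
    (hv0 : ∀ l, 0 ≤ v l) : Summable (cgConv u v) := by
  have h := ((summable_cgConv_triple hu hu0 hv hv0).prod_symm).prod
  exact h.congr fun l => (cgConv_eq_tsum_prod hu hu0 hv hv0 l).symm

/-- The Clebsch-Gordan convolution corresponds to the product of Legendre series. -/
lemma legSeries_cgConv (hu : Summable u) (hu0 : ∀ l, 0 ≤ u l) (hv : Summable v)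
    (hv0 : ∀ l, 0 ≤ v l) {t : ℝ} (ht : t ∈ Set.Icc (-1 : ℝ) 1) :
    legSeries (cgConv u v) t = legSeries u t * legSeries v t := by
  have hS : Summable fun p : (ℕ × ℕ) × ℕ =>
      u p.1.1 * v p.1.2 * cg0 p.1.1 p.1.2 p.2 ^ 2 * (legendreP p.2).eval t := by
    refine Summable.of_norm_bounded (summable_cgConv_triple hu hu0 hv hv0) fun p => ?_
    have h0 := mul_nonneg (mul_nonneg (hu0 p.1.1) (hv0 p.1.2)) (sq_nonneg (cg0 p.1.1 p.1.2 p.2))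
    rw [norm_mul, Real.norm_of_nonneg h0]
    exact mul_le_of_le_one_right h0 (abs_eval_legendreP_le_one _ ht)
  have h1 : legSeries u t * legSeries v t = ∑' p : (ℕ × ℕ) × ℕ,
      u p.1.1 * v p.1.2 * cg0 p.1.1 p.1.2 p.2 ^ 2 * (legendreP p.2).eval t := by
    rw [legSeries, legSeries, (summable_mul_legendreP hu hu0 ht).tsum_mul_tsum
      (summable_mul_legendreP hv hv0 ht), hS.tsum_prod]
    · refine tsum_congr fun p => ?_
      simp_rw [mul_assoc (u p.1 * v p.2)]
      rw [tsum_mul_left, (hasSum_cg0_sq_mul_legendreP p.1 p.2 t).tsum_eq]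
      ring
    · exact summable_mul_of_summable_norm (summable_mul_legendreP hu hu0 ht).norm
        (summable_mul_legendreP hv hv0 ht).norm
  have h2 : ∑' p : (ℕ × ℕ) × ℕ,
      u p.1.1 * v p.1.2 * cg0 p.1.1 p.1.2 p.2 ^ 2 * (legendreP p.2).eval t =
      ∑' l, ∑' p : ℕ × ℕ, u p.1 * v p.2 * cg0 p.1 p.2 l ^ 2 * (legendreP l).eval t := by
    rw [← (Equiv.prodComm ℕ (ℕ × ℕ)).tsum_eq]
    exact hS.prod_symm.tsum_prod
  rw [h1, h2, legSeries]
  refine tsum_congr fun l => ?_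
  rw [tsum_mul_right, cgConv_eq_tsum_prod hu hu0 hv hv0]

lemma cgConv_comm (hu : Summable u) (hu0 : ∀ l, 0 ≤ u l) (hv : Summable v)
    (hv0 : ∀ l, 0 ≤ v l) : cgConv u v = cgConv v u := by
  ext l
  rw [cgConv_eq_tsum_prod hu hu0 hv hv0, cgConv_eq_tsum_prod hv hv0 hu hu0,
    ← (Equiv.prodComm ℕ ℕ).tsum_eq]
  refine tsum_congr fun p => ?_
  rw [Equiv.prodComm_apply, Prod.fst_swap, Prod.snd_swap, cg0_sq_comm]
  ring

end conv

lemma continuousOn_legSeries {u : ℕ → ℝ} (hs : Summable u) (h0 : ∀ l, 0 ≤ u l) :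
    ContinuousOn (legSeries u) (Set.Icc (-1) 1) := by
  refine continuousOn_tsum (fun l => by fun_prop) hs fun l t ht => ?_
  rw [norm_mul, Real.norm_of_nonneg (h0 l)]
  exact mul_le_of_le_one_right (h0 l) (abs_eval_legendreP_le_one l ht)

/-- The Legendre coefficients of a Legendre series. -/
lemma integral_legSeries_mul_legendreP {u : ℕ → ℝ} (hs : Summable u) (h0 : ∀ l, 0 ≤ u l) (l : ℕ) :
    ∫ t in (-1 : ℝ)..1, legSeries u t * (legendreP l).eval t = 2 / (2 * (l : ℝ) + 1) * u l := by
  have hb : ∀ k, ∀ t ∈ Set.Icc (-1 : ℝ) 1,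
      ‖u k * (legendreP k).eval t * (legendreP l).eval t‖ ≤ u k := by
    intro k t ht
    rw [norm_mul, norm_mul, Real.norm_of_nonneg (h0 k), mul_assoc]
    exact mul_le_of_le_one_right (h0 k) (mul_le_one₀ (abs_eval_legendreP_le_one k ht)
      (norm_nonneg _) (abs_eval_legendreP_le_one l ht))
  have h := intervalIntegral.hasSum_integral_of_dominated_convergence (a := -1) (b := 1)
    (μ := volume) (F := fun k t => u k * (legendreP k).eval t * (legendreP l).eval t)
    (f := fun t => legSeries u t * (legendreP l).eval t) (fun k _ => u k)
    (fun k => by fun_prop)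
    (fun k => Eventually.of_forall fun t ht => hb k t (by
      rw [Set.uIoc_of_le (by norm_num)] at ht; exact Set.Ioc_subset_Icc_self ht))
    (Eventually.of_forall fun t _ => hs) (by simp)
    (Eventually.of_forall fun t ht => by
      rw [Set.uIoc_of_le (by norm_num)] at ht
      exact ((summable_mul_legendreP hs h0 (Set.Ioc_subset_Icc_self ht)).hasSum).mul_right _)
  rw [← h.tsum_eq, tsum_eq_single l]
  · simp_rw [mul_assoc]
    rw [intervalIntegral.integral_const_mul]
    have := polyInt_legendreP_sq l
    rw [polyInt_apply] at this
    simp only [eval_mul] at this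
    rw [this]; ring
  · intro k hk
    simp_rw [mul_assoc]
    rw [intervalIntegral.integral_const_mul]
    have := polyInt_legendreP_mul_of_ne hk
    rw [polyInt_apply] at this
    simp only [eval_mul] at this
    rw [this]; ring

/-- A summable nonnegative sequence is determined by its Legendre series. -/
lemma legSeries_injective {u v : ℕ → ℝ} (hu : Summable u) (hu0 : ∀ l, 0 ≤ u l) (hv : Summable v)
    (hv0 : ∀ l, 0 ≤ v l) (h : ∀ t ∈ Set.Icc (-1 : ℝ) 1, legSeries u t = legSeries v t) :
    u = v := by
  ext l
  have h1 := integral_legSeries_mul_legendreP hu hu0 l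
  have h2 := integral_legSeries_mul_legendreP hv hv0 l
  rw [intervalIntegral.integral_congr (g := fun t => legSeries v t * (legendreP l).eval t)
    (fun t ht => by
      rw [Set.uIcc_of_le (by norm_num)] at ht
      simp only [h t ht]), h2] at h1
  exact (mul_left_cancel₀ (by positivity) h1).symm

/-! ### The convolutions `gamHat` and `gamStar` -/

section gam

variable {Γ : ℕ → ℝ}

lemma gamHat_add_two (Γ : ℕ → ℝ) (n : ℕ) : gamHat Γ (n + 2) = cgConv (gamHat Γ (n + 1)) Γ := by
  ext l; simp only [gamHat, cgConv]

lemma gamHat_nonneg (h0 : ∀ l, 0 ≤ Γ l) (n l : ℕ) : 0 ≤ gamHat Γ (n + 1) l := by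
  induction n generalizing l with
  | zero => simpa [gamHat] using h0 l
  | succ n ih => rw [gamHat_add_two]; exact cgConv_nonneg ih h0 l

lemma summable_gamHat (hs : Summable Γ) (h0 : ∀ l, 0 ≤ Γ l) (n : ℕ) :
    Summable (gamHat Γ (n + 1)) := by
  induction n with
  | zero => simpa [gamHat] using hs
  | succ n ih => rw [gamHat_add_two]; exact summable_cgConv ih (gamHat_nonneg h0 n) hs h0

lemma legSeries_gamHat (hs : Summable Γ) (h0 : ∀ l, 0 ≤ Γ l) (n : ℕ) {t : ℝ}
    (ht : t ∈ Set.Icc (-1 : ℝ) 1) :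
    legSeries (gamHat Γ (n + 1)) t = legSeries Γ t ^ (n + 1) := by
  induction n with
  | zero => simp [gamHat]
  | succ n ih =>
    rw [gamHat_add_two, legSeries_cgConv (summable_gamHat hs h0 n) (gamHat_nonneg h0 n) hs h0 ht,
      ih, pow_succ _ (n + 1)]

/-- The `n`-fold right convolution by `Γ` of the unit mass at `a`. -/
noncomputable def cgIter (Γ : ℕ → ℝ) (a : ℕ) : ℕ → ℕ → ℝ
  | 0 => Pi.single a 1
  | n + 1 => cgConv (cgIter Γ a n) Γ

lemma cgIter_nonneg (h0 : ∀ l, 0 ≤ Γ l) (a n l : ℕ) : 0 ≤ cgIter Γ a n l := by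
  induction n generalizing l with
  | zero => by_cases h : l = a <;> simp [cgIter, h]
  | succ n ih => exact cgConv_nonneg ih h0 l

lemma summable_cgIter (hs : Summable Γ) (h0 : ∀ l, 0 ≤ Γ l) (a n : ℕ) :
    Summable (cgIter Γ a n) := by
  induction n with
  | zero => exact (hasSum_pi_single a 1).summable
  | succ n ih => exact summable_cgConv ih (cgIter_nonneg h0 a n) hs h0

lemma legSeries_single (a : ℕ) (t : ℝ) : legSeries (Pi.single a 1) t = (legendreP a).eval t := by
  rw [legSeries, tsum_eq_single a (fun l hl => by simp [hl])]
  simp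

/-- Associativity of the convolution, through the product of the Legendre series. -/
lemma cgIter_succ_eq (hs : Summable Γ) (h0 : ∀ l, 0 ≤ Γ l) (a n l : ℕ) :
    cgIter Γ a (n + 1) l = ∑' L, gamHat Γ (n + 1) L * cg0 a L l ^ 2 := by
  have hδs : Summable (Pi.single a 1 : ℕ → ℝ) := (hasSum_pi_single a 1).summable
  have hδ0 : ∀ l, 0 ≤ (Pi.single a 1 : ℕ → ℝ) l := cgIter_nonneg h0 a 0
  have hser : ∀ n, ∀ t ∈ Set.Icc (-1 : ℝ) 1,
      legSeries (cgIter Γ a n) t = (legendreP a).eval t * legSeries Γ t ^ n := by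
    intro n t ht
    induction n with
    | zero => simp [cgIter, legSeries_single]
    | succ n ih =>
      rw [cgIter, legSeries_cgConv (summable_cgIter hs h0 a n) (cgIter_nonneg h0 a n) hs h0 ht, ih]
      ring
  have h := legSeries_injective (summable_cgIter hs h0 a (n + 1)) (cgIter_nonneg h0 a (n + 1))
    (summable_cgConv hδs hδ0 (summable_gamHat hs h0 n) (gamHat_nonneg h0 n))
    (cgConv_nonneg hδ0 (gamHat_nonneg h0 n)) (fun t ht => by
      rw [hser _ t ht, legSeries_cgConv hδs hδ0 (summable_gamHat hs h0 n) (gamHat_nonneg h0 n) ht,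
        legSeries_single, legSeries_gamHat hs h0 n ht])
  rw [h, cgConv, tsum_eq_single a (fun L hL => by simp [hL])]
  simp

/-- The summand of `gamStar` over all paths `l_2, …` and `L_1, …`. -/
noncomputable def pathTerm (Γ : ℕ → ℝ) (n a l : ℕ) (k : Fin (n + 1) → ℕ) (L : Fin n → ℕ) : ℝ :=
  (∏ i, Γ (k i)) * (∏ i : Fin (n + 1), cg0 ((Fin.cons a L : Fin (n + 1) → ℕ) i) (k i)
          ((Fin.snoc L l : Fin (n + 1) → ℕ) i)) ^ 2

lemma pathTerm_nonneg (h0 : ∀ l, 0 ≤ Γ l) (n a l : ℕ) (k : Fin (n + 1) → ℕ) (L : Fin n → ℕ) :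
    0 ≤ pathTerm Γ n a l k L :=
  mul_nonneg (Finset.prod_nonneg fun i _ => h0 _) (sq_nonneg _)

lemma pathTerm_snoc (n a l k' L' : ℕ) (k : Fin (n + 1) → ℕ) (L : Fin n → ℕ) :
    pathTerm Γ (n + 1) a l (Fin.snoc k k') (Fin.snoc L L') =
      pathTerm Γ n a L' k L * (Γ k' * cg0 L' k' l ^ 2) := by
  rw [pathTerm, pathTerm, Fin.prod_univ_castSucc, Fin.prod_univ_castSucc (n := n + 1),
    Fin.cons_snoc_eq_snoc_cons]
  simp only [Fin.snoc_castSucc, Fin.snoc_last]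
  ring

/-- The path sum splits at its last step. -/
lemma tsum_pathTerm_succ (h0 : ∀ l, 0 ≤ Γ l) (n a l : ℕ) :
    ∑' k, ∑' L, ENNReal.ofReal (pathTerm Γ (n + 1) a l k L) =
      ∑' L', ∑' k', (∑' k, ∑' L, ENNReal.ofReal (pathTerm Γ n a L' k L)) *
        ENNReal.ofReal (Γ k' * cg0 L' k' l ^ 2) := by
  have hsplit : ∀ (m : ℕ) (f : (Fin (m + 1) → ℕ) → ENNReal),
      ∑' k, f k = ∑' k', ∑' k : Fin m → ℕ, f (Fin.snoc k k') := by
    intro m f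
    rw [← (Fin.snocEquiv (fun _ : Fin (m + 1) => ℕ)).tsum_eq, ENNReal.tsum_prod']
    rfl
  rw [hsplit]
  have hsnoc : ∀ (k' : ℕ) (k : Fin (n + 1) → ℕ),
      ∑' L, ENNReal.ofReal (pathTerm Γ (n + 1) a l (Fin.snoc k k') L) =
        ∑' L', ∑' L, ENNReal.ofReal (pathTerm Γ n a L' k L * (Γ k' * cg0 L' k' l ^ 2)) :=
    fun k' k => by
      rw [hsplit n]
      simp_rw [pathTerm_snoc]
  simp_rw [hsnoc]
  rw [tsum_congr fun k' => ENNReal.tsum_comm (α := Fin (n + 1) → ℕ) (β := ℕ), ENNReal.tsum_comm]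
  refine tsum_congr fun L' => tsum_congr fun k' => ?_
  rw [← ENNReal.tsum_mul_right]
  refine tsum_congr fun k => ?_
  rw [← ENNReal.tsum_mul_right]
  exact tsum_congr fun L => ENNReal.ofReal_mul (pathTerm_nonneg h0 n a L' k L)

/-- Iterating the convolution and summing over paths agree. In `ℝ≥0∞` no summability is needed
to rearrange the path sums. -/
lemma ofReal_cgIter_succ (hs : Summable Γ) (h0 : ∀ l, 0 ≤ Γ l) (a n l : ℕ) :
    ENNReal.ofReal (cgIter Γ a (n + 1) l) =
      ∑' k, ∑' L, ENNReal.ofReal (pathTerm Γ n a l k L) := by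
  have hstep : ∀ n l, ENNReal.ofReal (cgIter Γ a (n + 1) l) =
      ∑' L', ∑' k', ENNReal.ofReal (cgIter Γ a n L') * ENNReal.ofReal (Γ k' * cg0 L' k' l ^ 2) := by
    intro n l
    have hS := summable_cgConv_pair (summable_cgIter hs h0 a n) (cgIter_nonneg h0 a n) hs h0 l
    have hn : ∀ p : ℕ × ℕ, 0 ≤ cgIter Γ a n p.1 * Γ p.2 * cg0 p.1 p.2 l ^ 2 := fun p =>
      mul_nonneg (mul_nonneg (cgIter_nonneg h0 a n _) (h0 _)) (sq_nonneg _)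
    rw [cgIter, cgConv_eq_tsum_prod (summable_cgIter hs h0 a n) (cgIter_nonneg h0 a n) hs h0,
      ENNReal.ofReal_tsum_of_nonneg hn hS, ENNReal.tsum_prod']
    refine tsum_congr fun L' => tsum_congr fun k' => ?_
    rw [← ENNReal.ofReal_mul (cgIter_nonneg h0 a n _), mul_assoc]
  induction n generalizing l with
  | zero =>
    rw [hstep, tsum_eq_single a (fun L hL => by simp [cgIter, hL])]
    have e : ∀ f : (Fin (0 + 1) → ℕ) → ENNReal, ∑' k, f k = ∑' k', f (fun _ => k') := fun f =>
      ((Equiv.funUnique (Fin 1) ℕ).symm.tsum_eq f).symm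
    rw [e]
    refine tsum_congr fun k => ?_
    rw [tsum_eq_single default (fun L hL => absurd (Subsingleton.elim _ _) hL)]
    simp [cgIter, pathTerm, Fin.snoc]
  | succ n ih =>
    rw [hstep, tsum_pathTerm_succ h0]
    simp_rw [ih]

lemma gamStar_eq_cgIter (hs : Summable Γ) (h0 : ∀ l, 0 ≤ Γ l) (n l a : ℕ) :
    gamStar Γ (n + 2) l a = cgIter Γ a (n + 1) l := by
  have h := ofReal_cgIter_succ hs h0 a n l
  have hne : ∑' k, ∑' L, ENNReal.ofReal (pathTerm Γ n a l k L) ≠ ⊤ := by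
    rw [← h]; exact ENNReal.ofReal_ne_top
  have h2 := congrArg ENNReal.toReal h
  rw [ENNReal.toReal_ofReal (cgIter_nonneg h0 a _ l),
    ENNReal.tsum_toReal_eq (ENNReal.ne_top_of_tsum_ne_top hne)] at h2
  rw [h2, gamStar]
  refine tsum_congr fun k => ?_
  rw [ENNReal.tsum_toReal_eq (fun L => ENNReal.ofReal_ne_top), ← tsum_mul_left]
  exact tsum_congr fun L => (ENNReal.toReal_ofReal (pathTerm_nonneg h0 n a l k L)).symm

/-- The `*`-convolution in terms of the convolution powers. -/
lemma gamStar_eq (hs : Summable Γ) (h0 : ∀ l, 0 ≤ Γ l) (n l a : ℕ) :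
    gamStar Γ (n + 2) l a = ∑' L, gamHat Γ (n + 1) L * cg0 a L l ^ 2 := by
  rw [gamStar_eq_cgIter hs h0, cgIter_succ_eq hs h0]

lemma gamStar_nonneg (hs : Summable Γ) (h0 : ∀ l, 0 ≤ Γ l) (n l a : ℕ) :
    0 ≤ gamStar Γ (n + 2) l a := by
  rw [gamStar_eq_cgIter hs h0]; exact cgIter_nonneg h0 _ _ _

/-- The convolution of order `n + 2`, decomposed over the last but one intermediate degree. -/
lemma hasSum_gamHat_mul_gamStar_two (hs : Summable Γ) (h0 : ∀ l, 0 ≤ Γ l) (n l : ℕ) :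
    HasSum (fun L => gamHat Γ (n + 1) L * gamStar Γ 2 l L) (gamHat Γ (n + 2) l) := by
  have h1 : ∀ L, gamHat Γ (n + 1) L * gamStar Γ 2 l L =
      ∑' k, gamHat Γ (n + 1) L * Γ k * cg0 L k l ^ 2 := fun L => by
    rw [gamStar_eq hs h0 0, ← tsum_mul_left]
    simp only [gamHat, zero_add]
    exact tsum_congr fun k => by ring
  have hS := summable_cgConv_pair (summable_gamHat hs h0 n) (gamHat_nonneg h0 n) hs h0 l
  have h2 := hS.prod.hasSum
  rw [← hS.tsum_prod, ← cgConv_eq_tsum_prod (summable_gamHat hs h0 n) (gamHat_nonneg h0 n) hs h0,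
    ← gamHat_add_two] at h2
  simpa only [h1] using h2

/-- The convolution of order `n + 2`, decomposed over the initial degree. -/
lemma hasSum_gamStar_mul (hs : Summable Γ) (h0 : ∀ l, 0 ≤ Γ l) (n l : ℕ) :
    HasSum (fun a => gamStar Γ (n + 2) l a * Γ a) (gamHat Γ (n + 2) l) := by
  have h1 : ∀ a, gamStar Γ (n + 2) l a * Γ a =
      ∑' L, Γ a * gamHat Γ (n + 1) L * cg0 a L l ^ 2 := fun a => by
    rw [gamStar_eq hs h0 n, ← tsum_mul_right]
    exact tsum_congr fun k => by ring
  have hS := summable_cgConv_pair hs h0 (summable_gamHat hs h0 n) (gamHat_nonneg h0 n) l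
  have h2 := hS.prod.hasSum
  rw [← hS.tsum_prod, ← cgConv_eq_tsum_prod hs h0 (summable_gamHat hs h0 n) (gamHat_nonneg h0 n),
    ← cgConv_comm (summable_gamHat hs h0 n) (gamHat_nonneg h0 n) hs h0, ← gamHat_add_two] at h2
  simpa only [h1] using h2

end gam

/-! ### Hermite polynomials of correlated Gaussian variables -/

/-- The probabilists' Hermite polynomial with real coefficients. -/
noncomputable def hermiteR (n : ℕ) : ℝ[X] := (hermite n).map (Int.castRingHom ℝ)

lemma aeval_hermite (n : ℕ) (x : ℝ) : aeval x (hermite n) = (hermiteR n).eval x := by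
  rw [hermiteR, eval_map, aeval_def]
  rfl

lemma hermiteR_zero : hermiteR 0 = 1 := by simp [hermiteR]

lemma hermiteR_one : hermiteR 1 = X := by simp [hermiteR]

lemma hermiteR_succ (n : ℕ) :
    hermiteR (n + 1) = X * hermiteR n - derivative (hermiteR n) := by
  simp [hermiteR, hermite_succ, derivative_map]

lemma derivative_hermiteR_succ (n : ℕ) :
    derivative (hermiteR (n + 1)) = ((n : ℝ[X]) + 1) * hermiteR n := by
  induction n with
  | zero => simp [hermiteR_zero, hermiteR_one]
  | succ n ih =>
    rw [hermiteR_succ (n + 1), derivative_sub, derivative_mul, ih, derivative_mul, derivative_X,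
      hermiteR_succ n]
    simp only [derivative_add, derivative_natCast, derivative_one]
    push_cast
    ring

lemma memLp_eval_of_memLp {Ω : Type*} [MeasurableSpace Ω] {P : Measure Ω} [IsFiniteMeasure P]
    {X : Ω → ℝ} (hX : ∀ r : NNReal, MemLp X r P) (p : ℝ[X]) (r : NNReal) :
    MemLp (fun ω => p.eval (X ω)) r P := by
  induction p using Polynomial.induction_on' with
  | add p q hp hq =>
    simp only [eval_add]
    exact hp.add hq
  | monomial n a =>
    simp only [eval_monomial]
    refine MemLp.const_mul ?_ a
    induction n generalizing r with
    | zero => simpa using memLp_const (1 : ℝ)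
    | succ n ih =>
      simp_rw [pow_succ]
      have : ENNReal.HolderTriple ((2 * r : NNReal) : ENNReal) ((2 * r : NNReal) : ENNReal) r := by
        constructor
        push_cast
        rw [ENNReal.mul_inv (by simp) (by simp), ← add_mul, ENNReal.inv_two_add_inv_two, one_mul]
      exact (hX (2 * r)).mul (ih (2 * r))

lemma integrable_eval_mul_eval {Ω : Type*} [MeasurableSpace Ω] {P : Measure Ω}
    [IsFiniteMeasure P] {X Y : Ω → ℝ} (hX : ∀ r : NNReal, MemLp X r P)
    (hY : ∀ r : NNReal, MemLp Y r P) (p q : ℝ[X]) :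
    Integrable (fun ω => p.eval (X ω) * q.eval (Y ω)) P :=
  MemLp.integrable_mul (p := 2) (q := 2) (by exact_mod_cast memLp_eval_of_memLp hX p 2)
    (by exact_mod_cast memLp_eval_of_memLp hY q 2)

lemma integrable_eval_gaussianReal (p : ℝ[X]) :
    Integrable (fun x => p.eval x) (gaussianReal 0 1) := by
  have := memLp_eval_of_memLp (P := gaussianReal 0 1) (X := id)
    (fun r => memLp_id_gaussianReal r) p 1
  exact memLp_one_iff_integrable.1 (by exact_mod_cast this)

lemma hasDerivAt_gaussianPDFReal (x : ℝ) :
    HasDerivAt (gaussianPDFReal 0 1) (-x * gaussianPDFReal 0 1 x) x := by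
  have h : gaussianPDFReal 0 1 = fun x => (√(2 * Real.pi))⁻¹ * Real.exp (-x ^ 2 / 2) := by
    ext x
    simp [gaussianPDFReal]
  rw [h]
  have h1 : HasDerivAt (fun x : ℝ => -x ^ 2 / 2) (-x) x := by
    have := ((hasDerivAt_pow 2 x).neg.div_const 2)
    refine this.congr_deriv ?_
    push_cast
    ring
  have h2 := (h1.exp).const_mul (√(2 * Real.pi))⁻¹
  exact h2.congr_deriv (by ring)

/-- Gaussian integration by parts for polynomials. -/
lemma integral_mul_eval_gaussianReal (p : ℝ[X]) :
    ∫ x, x * p.eval x ∂(gaussianReal 0 1) = ∫ x, (derivative p).eval x ∂(gaussianReal 0 1) := by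
  have hint : ∀ r : ℝ[X], Integrable (fun x => gaussianPDFReal 0 1 x * r.eval x) volume := by
    intro r
    have h := integrable_eval_gaussianReal r
    rw [gaussianReal_of_var_ne_zero 0 one_ne_zero,
      integrable_withDensity_iff_integrable_smul' (measurable_gaussianPDF _ _)
        (ae_of_all _ fun _ => gaussianPDF_lt_top)] at h
    simpa [toReal_gaussianPDF] using h
  rw [integral_gaussianReal_eq_integral_smul one_ne_zero,
    integral_gaussianReal_eq_integral_smul one_ne_zero]
  have h := integral_mul_deriv_eq_deriv_mul_of_integrable (u := fun x => p.eval x)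
    (u' := fun x => (derivative p).eval x) (v := gaussianPDFReal 0 1)
    (v' := fun x => -x * gaussianPDFReal 0 1 x) (fun x _ => p.hasDerivAt x)
    (fun x _ => hasDerivAt_gaussianPDFReal x) ?_ ?_ ?_
  · calc ∫ x, gaussianPDFReal 0 1 x • (x * p.eval x)
        = -∫ x, p.eval x * (-x * gaussianPDFReal 0 1 x) := by
          rw [← integral_neg]
          congr 1
          ext x
          simp only [smul_eq_mul]
          ring
      _ = ∫ x, (derivative p).eval x * gaussianPDFReal 0 1 x := by rw [h, neg_neg]
      _ = _ := by simp only [smul_eq_mul, mul_comm]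
  · refine (hint (-(X * p))).congr (ae_of_all _ fun x => ?_)
    simp only [eval_neg, eval_mul, eval_X, Pi.mul_apply]
    ring
  · refine (hint (derivative p)).congr (ae_of_all _ fun x => ?_)
    simp only [Pi.mul_apply]
    ring
  · refine (hint p).congr (ae_of_all _ fun x => ?_)
    simp only [Pi.mul_apply]
    ring

section GaussianPair

variable {Ω : Type*} [MeasurableSpace Ω] {P : Measure Ω} {U V : Ω → ℝ}

/-- Gaussian integration by parts for two correlated standard normal variables: `V - ρ U` is
independent of `U`, which reduces the identity to the one-dimensional case. -/
lemma integral_mul_eval_mul_eval (hG : HasGaussianLaw (fun ω => (U ω, V ω)) P)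
    (hU : ∫ ω, U ω ∂P = 0) (hU2 : ∫ ω, U ω ^ 2 ∂P = 1) (f g : ℝ[X]) :
    ∫ ω, U ω * f.eval (U ω) * g.eval (V ω) ∂P =
      ∫ ω, (derivative f).eval (U ω) * g.eval (V ω) ∂P +
        (∫ ω, U ω * V ω ∂P) * ∫ ω, f.eval (U ω) * (derivative g).eval (V ω) ∂P := by
  have := hG.isProbabilityMeasure
  set ρ := ∫ ω, U ω * V ω ∂P with hρ
  have hUm : ∀ r : NNReal, MemLp U r P := fun r => hG.fst.memLp (by simp)
  have hVm : ∀ r : NNReal, MemLp V r P := fun r => hG.snd.memLp (by simp)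
  have hU2m : MemLp U 2 P := by exact_mod_cast hUm 2
  have hV2m : MemLp V 2 P := by exact_mod_cast hVm 2
  let W : Ω → ℝ := fun ω => V ω - ρ * U ω
  have hUW : HasGaussianLaw (fun ω => (U ω, W ω)) P :=
    hG.map_fun ((ContinuousLinearMap.fst ℝ ℝ ℝ).prod
      (ContinuousLinearMap.snd ℝ ℝ ℝ - ρ • ContinuousLinearMap.fst ℝ ℝ ℝ))
  have hW2m : MemLp W 2 P := hV2m.sub (hU2m.const_mul ρ)
  have hcov : cov[U, W; P] = 0 := by
    rw [covariance_eq_sub hU2m hW2m]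
    have h1 : ∫ ω, (U * W) ω ∂P = 0 := by
      have : ∀ ω, (U * W) ω = U ω * V ω - ρ * U ω ^ 2 := fun ω => by
        simp only [W, Pi.mul_apply]
        ring
      simp_rw [this]
      rw [integral_sub (f := fun ω => U ω * V ω) (hU2m.integrable_mul hV2m) (hU2m.integrable_sq.const_mul ρ),
        integral_const_mul, hU2, ← hρ]
      ring
    rw [h1, hU]
    ring
  have hind : IndepFun U W P := hUW.indepFun_of_covariance_eq_zero hcov
  have hmap := (indepFun_iff_map_prod_eq_prod_map_map hUW.fst.aemeasurable
    hUW.snd.aemeasurable).1 hind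
  have hUlaw : P.map U = gaussianReal 0 1 := by
    rw [hG.fst.map_eq_gaussianReal, hU, variance_eq_sub hU2m, hU]
    simp only [Pi.pow_apply, hU2]
    norm_num
  rw [hUlaw] at hmap
  -- every polynomial expectation is an iterated integral against the standard normal law
  have key : ∀ a b : ℝ[X], ∫ ω, a.eval (U ω) * b.eval (V ω) ∂P =
      ∫ w, ∫ x, (a * b.comp (C ρ * X + C w)).eval x ∂(gaussianReal 0 1) ∂(P.map W) := by
    intro a b
    have hm : Measurable (fun z : ℝ × ℝ => a.eval z.1 * b.eval (ρ * z.1 + z.2)) := by fun_prop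
    have heq : ∀ ω, a.eval (U ω) * b.eval (V ω) =
        (fun z : ℝ × ℝ => a.eval z.1 * b.eval (ρ * z.1 + z.2)) (U ω, W ω) := fun ω => by
      simp [W]
    have hi : Integrable (fun z : ℝ × ℝ => a.eval z.1 * b.eval (ρ * z.1 + z.2))
        (P.map (fun ω => (U ω, W ω))) := by
      rw [integrable_map_measure hm.aestronglyMeasurable hUW.aemeasurable]
      exact (integrable_eval_mul_eval hUm hVm a b).congr (ae_of_all _ heq)
    simp_rw [heq]
    rw [← integral_map hUW.aemeasurable hm.aestronglyMeasurable]
    rw [hmap] at hi ⊢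
    have : IsProbabilityMeasure (P.map W) :=
      Measure.isProbabilityMeasure_map hUW.snd.aemeasurable
    rw [integral_prod_symm _ hi]
    simp [eval_comp]
  have hi : ∀ a b : ℝ[X], Integrable
      (fun w => ∫ x, (a * b.comp (C ρ * X + C w)).eval x ∂(gaussianReal 0 1)) (P.map W) := by
    intro a b
    have hm : Measurable (fun z : ℝ × ℝ => a.eval z.1 * b.eval (ρ * z.1 + z.2)) := by fun_prop
    have hi : Integrable (fun z : ℝ × ℝ => a.eval z.1 * b.eval (ρ * z.1 + z.2))
        (P.map (fun ω => (U ω, W ω))) := by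
      rw [integrable_map_measure hm.aestronglyMeasurable hUW.aemeasurable]
      refine (integrable_eval_mul_eval hUm hVm a b).congr (ae_of_all _ fun ω => ?_)
      simp [W]
    rw [hmap] at hi
    have : IsProbabilityMeasure (P.map W) :=
      Measure.isProbabilityMeasure_map hUW.snd.aemeasurable
    have := hi.integral_prod_right
    simpa [eval_comp] using this
  have e1 : ∀ ω, U ω * f.eval (U ω) * g.eval (V ω) = (X * f).eval (U ω) * g.eval (V ω) :=
    fun ω => by simp
  simp_rw [e1]
  rw [key, key, key, ← integral_const_mul, ← integral_add (hi _ _) ((hi _ _).const_mul ρ)]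
  congr 1
  ext w
  have h1 : ∀ x, (X * f * g.comp (C ρ * X + C w)).eval x =
      x * (f * g.comp (C ρ * X + C w)).eval x := fun x => by simp [mul_assoc]
  simp_rw [h1]
  rw [integral_mul_eval_gaussianReal, ← integral_const_mul, ← integral_add
    (integrable_eval_gaussianReal _) ((integrable_eval_gaussianReal _).const_mul ρ)]
  congr 1
  ext x
  simp only [derivative_mul, derivative_comp, derivative_add, eval_add, eval_mul, derivative_C,
    derivative_X, eval_C, eval_zero, eval_one]
  ring

/-- Hermite polynomials of two standard normal variables with correlation `ρ` have covariance
`q! ρ^q`. -/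
lemma integral_hermiteR_mul_hermiteR (hG : HasGaussianLaw (fun ω => (U ω, V ω)) P)
    (hU : ∫ ω, U ω ∂P = 0) (hU2 : ∫ ω, U ω ^ 2 ∂P = 1) (n : ℕ) :
    ∫ ω, (hermiteR n).eval (U ω) * (hermiteR n).eval (V ω) ∂P =
      (n.factorial : ℝ) * (∫ ω, U ω * V ω ∂P) ^ n := by
  have := hG.isProbabilityMeasure
  have hUm : ∀ r : NNReal, MemLp U r P := fun r => hG.fst.memLp (by simp)
  have hVm : ∀ r : NNReal, MemLp V r P := fun r => hG.snd.memLp (by simp)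
  induction n with
  | zero => simp [hermiteR_zero]
  | succ n ih =>
    have h := integral_mul_eval_mul_eval hG hU hU2 (hermiteR n) (hermiteR (n + 1))
    have h1 : ∀ ω, (hermiteR (n + 1)).eval (U ω) * (hermiteR (n + 1)).eval (V ω) =
        (X * hermiteR n).eval (U ω) * (hermiteR (n + 1)).eval (V ω) -
          (derivative (hermiteR n)).eval (U ω) * (hermiteR (n + 1)).eval (V ω) := fun ω => by
      rw [← sub_mul, ← eval_sub, ← hermiteR_succ]
    have h2 : ∀ ω, U ω * (hermiteR n).eval (U ω) * (hermiteR (n + 1)).eval (V ω) =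
        (X * hermiteR n).eval (U ω) * (hermiteR (n + 1)).eval (V ω) := fun ω => by simp
    simp_rw [h2] at h
    simp_rw [h1]
    rw [integral_sub (integrable_eval_mul_eval hUm hVm _ _) (integrable_eval_mul_eval hUm hVm _ _),
      h, derivative_hermiteR_succ]
    have h3 : ∀ ω, (hermiteR n).eval (U ω) * (((n : ℝ[X]) + 1) * hermiteR n).eval (V ω) =
        ((n : ℝ) + 1) * ((hermiteR n).eval (U ω) * (hermiteR n).eval (V ω)) := fun ω => by
      simp only [eval_mul, eval_add, eval_natCast, eval_one]
      ring
    simp_rw [h3]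
    rw [integral_const_mul, ih, Nat.factorial_succ]
    push_cast
    ring

end GaussianPair

/-! ### The covariance function of an isotropic field -/

section Covariance

variable {Ω : Type*} [MeasurableSpace Ω] {P : Measure Ω} {T : S2 → Ω → ℝ}

/-- The covariance function `E T(x) T(y)`. -/
noncomputable def covFun (P : Measure Ω) (T : S2 → Ω → ℝ) (x y : S2) : ℝ := ∫ ω, T x ω * T y ω ∂P

lemma covFun_of_det_eq_one (hT : IsIsotropicGaussianField P T)
    (g : EuclideanSpace ℝ (Fin 3) ≃ₗᵢ[ℝ] EuclideanSpace ℝ (Fin 3))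
    (hg : LinearMap.det
      (g.toLinearEquiv : EuclideanSpace ℝ (Fin 3) →ₗ[ℝ] EuclideanSpace ℝ (Fin 3)) = 1)
    (x y : S2) : covFun P T (sphMap g x) (sphMap g y) = covFun P T x y := by
  have h := hT.isotropic g hg 2 ![x, y] ![sphMap g x, sphMap g y] (fun i => by
    fin_cases i <;> rfl)
  have h2 := (h.comp (u := fun v : Fin 2 → ℝ => v 0 * v 1) (by fun_prop)).integral_eq
  simpa [Function.comp_def, covFun] using h2

lemma exists_ne_zero_inner_eq_zero (x y : EuclideanSpace ℝ (Fin 3)) :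
    ∃ w : EuclideanSpace ℝ (Fin 3), w ≠ 0 ∧ inner ℝ w x = 0 ∧ inner ℝ w y = 0 := by
  let K : Submodule ℝ (EuclideanSpace ℝ (Fin 3)) := Submodule.span ℝ ({x, y} : Set _)
  have hK : K ≠ ⊤ := by
    intro h
    have h1 : Module.finrank ℝ K ≤ 2 := by
      have := finrank_span_finset_le_card (R := ℝ) ({x, y} : Finset (EuclideanSpace ℝ (Fin 3)))
      rw [Finset.coe_pair] at this
      exact this.trans Finset.card_le_two
    rw [h, finrank_top, finrank_euclideanSpace, Fintype.card_fin] at h1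
    omega
  have hK2 : Kᗮ ≠ ⊥ := fun h => hK (Submodule.orthogonal_eq_bot_iff.1 h)
  obtain ⟨w, hw, hw0⟩ := Submodule.exists_mem_ne_zero_of_ne_bot hK2
  refine ⟨w, hw0, ?_, ?_⟩
  · rw [real_inner_comm]
    exact (Submodule.mem_orthogonal K w).1 hw x (Submodule.subset_span (by simp))
  · rw [real_inner_comm]
    exact (Submodule.mem_orthogonal K w).1 hw y (Submodule.subset_span (by simp))

lemma det_reflection_orthogonal_singleton {v : EuclideanSpace ℝ (Fin 3)} (hv : v ≠ 0) :
    LinearMap.det ((Submodule.reflection (ℝ ∙ v)ᗮ).toLinearEquiv :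
      EuclideanSpace ℝ (Fin 3) →ₗ[ℝ] EuclideanSpace ℝ (Fin 3)) = -1 := by
  have h := Submodule.det_reflection (ℝ ∙ v)ᗮ
  rw [Submodule.orthogonal_orthogonal, finrank_span_singleton hv, pow_one] at h
  exact h

/-- Invariance of the covariance under reflections: a reflection can be composed with the reflection
along a vector orthogonal to the two points to give a rotation. -/
lemma covFun_reflection (hT : IsIsotropicGaussianField P T) (v : EuclideanSpace ℝ (Fin 3))
    (x y : S2) : covFun P T (sphMap (Submodule.reflection (ℝ ∙ v)ᗮ) x)
      (sphMap (Submodule.reflection (ℝ ∙ v)ᗮ) y) = covFun P T x y := by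
  by_cases hv : v = 0
  · have h : ∀ z : S2, sphMap (Submodule.reflection (ℝ ∙ v)ᗮ) z = z := fun z =>
      Subtype.ext (by
        rw [coe_sphMap]
        exact Submodule.reflection_mem_subspace_eq_self (by simp [hv]))
    rw [h, h]
  · obtain ⟨w, hw, hx, hy⟩ := exists_ne_zero_inner_eq_zero x.1 y.1
    have h1 : ∀ z : S2, inner ℝ w z.1 = 0 →
        sphMap ((Submodule.reflection (ℝ ∙ w)ᗮ).trans (Submodule.reflection (ℝ ∙ v)ᗮ)) z =
          sphMap (Submodule.reflection (ℝ ∙ v)ᗮ) z := fun z hz => Subtype.ext (by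
      rw [coe_sphMap, coe_sphMap, LinearIsometryEquiv.trans_apply,
        Submodule.reflection_mem_subspace_eq_self
          (Submodule.mem_orthogonal_singleton_iff_inner_right.2 hz)])
    rw [← h1 x hx, ← h1 y hy]
    refine covFun_of_det_eq_one hT _ ?_ x y
    have h2 : (((Submodule.reflection (ℝ ∙ w)ᗮ).trans
        (Submodule.reflection (ℝ ∙ v)ᗮ)).toLinearEquiv :
          EuclideanSpace ℝ (Fin 3) →ₗ[ℝ] EuclideanSpace ℝ (Fin 3)) =
        ((Submodule.reflection (ℝ ∙ v)ᗮ).toLinearEquiv :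
          EuclideanSpace ℝ (Fin 3) →ₗ[ℝ] EuclideanSpace ℝ (Fin 3)) ∘ₗ
        ((Submodule.reflection (ℝ ∙ w)ᗮ).toLinearEquiv :
          EuclideanSpace ℝ (Fin 3) →ₗ[ℝ] EuclideanSpace ℝ (Fin 3)) := rfl
    rw [h2, LinearMap.det_comp, det_reflection_orthogonal_singleton hv,
      det_reflection_orthogonal_singleton hw]
    norm_num

/-- The covariance depends on the inner product of the two points only. -/
lemma covFun_eq_of_inner_eq (hT : IsIsotropicGaussianField P T) {x y x' y' : S2}
    (h : inner ℝ x.1 y.1 = inner ℝ x'.1 y'.1) : covFun P T x y = covFun P T x' y' := by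
  have hr : ∀ a b : S2, sphMap (Submodule.reflection (ℝ ∙ (a.1 - b.1))ᗮ) a = b := fun a b =>
    Subtype.ext (by
      rw [coe_sphMap]
      exact Submodule.reflection_sub (by simp))
  rw [← covFun_reflection hT (y.1 - y'.1) x y, hr]
  set x1 := sphMap (Submodule.reflection (ℝ ∙ (y.1 - y'.1))ᗮ) x with hx1
  have h1 : inner ℝ x1.1 y'.1 = inner ℝ x'.1 y'.1 := by
    rw [← h, ← inner_sphMap (Submodule.reflection (ℝ ∙ (y.1 - y'.1))ᗮ) x y, hr]
  rw [← covFun_reflection hT (x1.1 - x'.1) x1 y', hr]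
  congr 1
  refine Subtype.ext ?_
  rw [coe_sphMap]
  refine Submodule.reflection_mem_subspace_eq_self
    (Submodule.mem_orthogonal_singleton_iff_inner_right.2 ?_)
  rw [inner_sub_left, h1, sub_self]

/-- The covariance as a function of the inner product of the two points. -/
noncomputable def covProfile (P : Measure Ω) (T : S2 → Ω → ℝ) (t : ℝ) : ℝ :=
  covFun P T (meridian (Set.projIcc (-1 : ℝ) 1 (by norm_num) t) (Subtype.prop _)) northPole

lemma covFun_eq_covProfile (hT : IsIsotropicGaussianField P T) (x y : S2) :
    covFun P T x y = covProfile P T (inner ℝ x.1 y.1) := by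
  refine covFun_eq_of_inner_eq hT ?_
  rw [inner_meridian, Set.projIcc_of_mem _ (inner_mem_Icc x y)]

lemma memLp_field (hT : IsIsotropicGaussianField P T) (x : S2) (r : NNReal) :
    MemLp (T x) r P := (hT.gaussian.hasGaussianLaw_eval x).memLp (by simp)

lemma integral_hermiteR_field (hT : IsIsotropicGaussianField P T) (q : ℕ) (x y : S2) :
    ∫ ω, (hermiteR q).eval (T x ω) * (hermiteR q).eval (T y ω) ∂P =
      (q.factorial : ℝ) * covFun P T x y ^ q :=
  integral_hermiteR_mul_hermiteR hT.gaussian.hasGaussianLaw_prodMk (hT.centered x)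
    (hT.variance_one x) q

variable [IsProbabilityMeasure P]

lemma measurable_covFun (hT : IsIsotropicGaussianField P T) :
    Measurable (fun z : S2 × S2 => covFun P T z.1 z.2) := by
  have h : Measurable (fun z : (S2 × S2) × Ω => T z.1.1 z.2 * T z.1.2 z.2) := by
    have h1 : Measurable (fun z : (S2 × S2) × Ω => T z.1.1 z.2) :=
      hT.measurable.comp (by fun_prop : Measurable fun z : (S2 × S2) × Ω => (z.1.1, z.2))
    have h2 : Measurable (fun z : (S2 × S2) × Ω => T z.1.2 z.2) :=
      hT.measurable.comp (by fun_prop : Measurable fun z : (S2 × S2) × Ω => (z.1.2, z.2))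
    exact h1.mul h2
  exact (h.stronglyMeasurable.integral_prod_right').measurable

lemma measurable_covProfile (hT : IsIsotropicGaussianField P T) :
    Measurable (covProfile P T) := by
  have h : Continuous (fun t : ℝ => (meridian (Set.projIcc (-1 : ℝ) 1 (by norm_num) t)
      (Subtype.prop _), northPole)) := by
    refine Continuous.prodMk (Continuous.subtype_mk ?_ _) continuous_const
    have : Continuous fun t : ℝ => ((Set.projIcc (-1 : ℝ) 1 (by norm_num) t : ℝ)) :=
      continuous_subtype_val.comp continuous_projIcc
    refine (PiLp.continuous_toLp 2 _).comp (continuous_pi fun i => ?_)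
    fin_cases i
    · simpa using (by fun_prop)
    · simpa using continuous_const
    · simpa using this
  exact (measurable_covFun hT).comp h.measurable

lemma abs_covFun_le_one (hT : IsIsotropicGaussianField P T) (x y : S2) :
    |covFun P T x y| ≤ 1 := by
  have h2 : ∀ z, MemLp (T z) 2 P := fun z => by exact_mod_cast memLp_field hT z 2
  calc |covFun P T x y| ≤ ∫ ω, |T x ω * T y ω| ∂P := abs_integral_le_integral_abs
    _ ≤ ∫ ω, (T x ω ^ 2 / 2 + T y ω ^ 2 / 2) ∂P := by
        refine integral_mono ((h2 x).integrable_mul (h2 y)).abs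
          (((h2 x).integrable_sq.div_const 2).add ((h2 y).integrable_sq.div_const 2)) fun ω => ?_
        simp only [abs_mul]
        nlinarith [sq_nonneg (|T x ω| - |T y ω|), sq_abs (T x ω), sq_abs (T y ω)]
    _ = 1 := by
        rw [integral_add ((h2 x).integrable_sq.div_const 2) ((h2 y).integrable_sq.div_const 2),
          integral_div, integral_div, hT.variance_one, hT.variance_one]
        norm_num

lemma abs_covProfile_le_one (hT : IsIsotropicGaussianField P T) (t : ℝ) :
    |covProfile P T t| ≤ 1 := abs_covFun_le_one hT _ _

lemma continuous_bounded {f : S2 → ℂ} (hf : Continuous f) : ∃ c : ℝ, 0 ≤ c ∧ ∀ x, ‖f x‖ ≤ c := by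
  obtain ⟨c, hc⟩ := isCompact_univ.exists_bound_of_continuousOn (f := f) hf.continuousOn
  exact ⟨c, (norm_nonneg _).trans (hc northPole trivial), fun x => hc x trivial⟩

/-- The second moment of a random harmonic coefficient as a double integral of a power of the
covariance. -/
lemma integral_norm_harmCoeff_sq (hT : IsIsotropicGaussianField P T) (q l : ℕ) (m : ℤ) :
    ((∫ ω, ‖harmCoeff T q l m ω‖ ^ 2 ∂P : ℝ) : ℂ) = (q.factorial : ℂ) *
      ∫ z : S2 × S2, ((covFun P T z.1 z.2 ^ q : ℝ) : ℂ) *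
        (conj (sphHarm l m z.1) * sphHarm l m z.2) ∂(surf.prod surf) := by
  set F : S2 × S2 → Ω → ℂ := fun z ω =>
    (((hermiteR q).eval (T z.1 ω) * (hermiteR q).eval (T z.2 ω) : ℝ) : ℂ) *
      (conj (sphHarm l m z.1) * sphHarm l m z.2) with hF
  have hY := continuous_sphHarm l m
  obtain ⟨c, hc0, hc⟩ := continuous_bounded hY
  have hm : Measurable (Function.uncurry F) := by
    have h1 : Measurable (fun z : (S2 × S2) × Ω => T z.1.1 z.2) :=
      hT.measurable.comp (by fun_prop : Measurable fun z : (S2 × S2) × Ω => (z.1.1, z.2))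
    have h2 : Measurable (fun z : (S2 × S2) × Ω => T z.1.2 z.2) :=
      hT.measurable.comp (by fun_prop : Measurable fun z : (S2 × S2) × Ω => (z.1.2, z.2))
    have h3 : Measurable fun t : ℝ => (hermiteR q).eval t := (hermiteR q).continuous.measurable
    have h4 : Measurable (sphHarm l m) := hY.measurable
    simp only [hF, Function.uncurry_def]
    have h5 : Measurable fun w : ℂ => conj w := Complex.continuous_conj.measurable
    exact (Complex.measurable_ofReal.comp ((h3.comp h1).mul (h3.comp h2))).mul
      ((h5.comp (h4.comp (by fun_prop))).mul (h4.comp (by fun_prop)))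
  have hXm : ∀ z : S2, ∀ r : NNReal, MemLp (T z) r P := fun z r => memLp_field hT z r
  have hFi : ∀ z, Integrable (F z) P := fun z =>
    ((integrable_eval_mul_eval (hXm z.1) (hXm z.2) (hermiteR q) (hermiteR q)).ofReal).mul_const _
  have hFn : ∀ z, ∫ ω, ‖F z ω‖ ∂P ≤ (q.factorial : ℝ) * (c * c) := by
    intro z
    have hsq : ∀ x : S2, Integrable (fun ω => (hermiteR q).eval (T x ω) ^ 2 / 2) P := fun x => by
      have := (integrable_eval_mul_eval (hXm x) (hXm x) (hermiteR q) (hermiteR q)).div_const 2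
      simpa only [sq] using this
    have hone : ∀ x : S2, ∫ ω, (hermiteR q).eval (T x ω) ^ 2 ∂P = q.factorial := fun x => by
      simp_rw [sq]
      rw [integral_hermiteR_field hT, covFun]
      simp_rw [← sq, hT.variance_one, one_pow, mul_one]
    calc ∫ ω, ‖F z ω‖ ∂P ≤ ∫ ω, ((hermiteR q).eval (T z.1 ω) ^ 2 / 2 +
          (hermiteR q).eval (T z.2 ω) ^ 2 / 2) * (c * c) ∂P := by
          refine integral_mono (hFi z).norm (((hsq _).add (hsq _)).mul_const _) fun ω => ?_
          simp only [hF, norm_mul, Complex.norm_real, Real.norm_eq_abs, RCLike.norm_conj]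
          refine mul_le_mul ?_ (mul_le_mul (hc _) (hc _) (norm_nonneg _) hc0) (by positivity)
            (by positivity)
          nlinarith [sq_nonneg (|(hermiteR q).eval (T z.1 ω)| - |(hermiteR q).eval (T z.2 ω)|),
            sq_abs ((hermiteR q).eval (T z.1 ω)), sq_abs ((hermiteR q).eval (T z.2 ω))]
      _ = _ := by
          rw [integral_mul_const, integral_add (hsq _) (hsq _), integral_div, integral_div, hone,
            hone]
          ring
  have hint : Integrable (Function.uncurry F) ((surf.prod surf).prod P) := by
    rw [integrable_prod_iff hm.aestronglyMeasurable]
    refine ⟨ae_of_all _ fun z => hFi z, ?_⟩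
    refine Integrable.of_bound (C := (q.factorial : ℝ) * (c * c)) ?_ (ae_of_all _ fun z => ?_)
    · exact (hm.norm.stronglyMeasurable.integral_prod_right').aestronglyMeasurable
    · rw [Real.norm_of_nonneg (integral_nonneg fun ω => norm_nonneg _)]
      exact hFn z
  calc ((∫ ω, ‖harmCoeff T q l m ω‖ ^ 2 ∂P : ℝ) : ℂ)
      = ∫ ω, ∫ z, F z ω ∂(surf.prod surf) ∂P := by
        rw [← integral_complex_ofReal]
        congr 1
        ext ω
        push_cast
        rw [← Complex.mul_conj', harmCoeff, ← integral_conj, ← integral_prod_mul]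
        congr 1
        ext z
        simp only [aeval_hermite, hF, map_mul, Complex.conj_ofReal, RingHomCompTriple.comp_apply,
          RingHom.id_apply]
        push_cast
        ring
    _ = ∫ z, ∫ ω, F z ω ∂P ∂(surf.prod surf) := (integral_integral_swap hint).symm
    _ = _ := by
        rw [← integral_const_mul]
        congr 1
        ext z
        simp only [hF]
        rw [integral_mul_const, integral_complex_ofReal, integral_hermiteR_field hT]
        push_cast
        ring

end Covariance

/-! ### Zonal kernels and their Legendre coefficients -/

/-- Polynomials are dense in `L¹[-1, 1]`. -/
lemma exists_polynomial_integral_sub_le {h : ℝ → ℝ} (hm : Measurable h) {B : ℝ}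
    (hB : ∀ t, |h t| ≤ B) {ε : ℝ} (hε : 0 < ε) :
    ∃ p : ℝ[X], ∫ t in Set.Icc (-1 : ℝ) 1, |h t - p.eval t| ≤ ε := by
  have hfin : IsFiniteMeasure (volume.restrict (Set.Icc (-1 : ℝ) 1)) := ⟨by simp⟩
  have hi : Integrable h (volume.restrict (Set.Icc (-1 : ℝ) 1)) :=
    Integrable.of_bound hm.aestronglyMeasurable B (ae_of_all _ hB)
  obtain ⟨g, hg, hgi⟩ := hi.exists_boundedContinuous_integral_sub_le (half_pos hε)
  obtain ⟨p, hp⟩ := exists_polynomial_near_of_continuousOn (-1) 1 g g.continuous.continuousOn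
    (ε / 4) (by positivity)
  refine ⟨p, ?_⟩
  have hpi : Integrable (fun t => p.eval t) (volume.restrict (Set.Icc (-1 : ℝ) 1)) :=
    (p.continuous.continuousOn.integrableOn_compact isCompact_Icc)
  calc ∫ t in Set.Icc (-1 : ℝ) 1, |h t - p.eval t|
      ≤ ∫ t in Set.Icc (-1 : ℝ) 1, (‖h t - g t‖ + |p.eval t - g t|) := by
        refine integral_mono (hi.sub hpi).abs ((hi.sub hgi).norm.add (hpi.sub hgi).abs)
          fun t => ?_
        rw [Real.norm_eq_abs, abs_sub_comm (p.eval t)]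
        exact abs_sub_le _ _ _
    _ = (∫ t in Set.Icc (-1 : ℝ) 1, ‖h t - g t‖) +
          ∫ t in Set.Icc (-1 : ℝ) 1, |p.eval t - g t| :=
        integral_add (hi.sub hgi).norm (hpi.sub hgi).abs
    _ ≤ ε / 2 + ∫ t in Set.Icc (-1 : ℝ) 1, ε / 4 := by
        refine add_le_add hg (setIntegral_mono_on (hpi.sub hgi).abs (by simp) measurableSet_Icc
          fun t ht => (hp t ht).le)
    _ = ε := by
        rw [setIntegral_const, measureReal_def, Real.volume_Icc,
          ENNReal.toReal_ofReal (by norm_num), smul_eq_mul]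
        ring

/-- A bounded function with vanishing Legendre coefficients vanishes almost everywhere. -/
lemma ae_eq_zero_of_legendre_coeff {h : ℝ → ℝ} (hm : Measurable h) {B : ℝ}
    (hB : ∀ t, |h t| ≤ B) (h0 : ∀ l, ∫ t in (-1 : ℝ)..1, h t * (legendreP l).eval t = 0) :
    ∀ᵐ t ∂(volume.restrict (Set.Icc (-1 : ℝ) 1)), h t = 0 := by
  have hfin : IsFiniteMeasure (volume.restrict (Set.Icc (-1 : ℝ) 1)) := ⟨by simp⟩
  have hB0 : 0 ≤ B := (abs_nonneg _).trans (hB 0)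
  have hpi : ∀ p : ℝ[X], Integrable (fun t => p.eval t) (volume.restrict (Set.Icc (-1 : ℝ) 1)) :=
    fun p => (p.continuous.continuousOn.integrableOn_compact isCompact_Icc)
  have hhp : ∀ p : ℝ[X], Integrable (fun t => h t * p.eval t)
      (volume.restrict (Set.Icc (-1 : ℝ) 1)) := fun p =>
    (hpi p).bdd_mul hm.aestronglyMeasurable (ae_of_all _ hB)
  have hhh : Integrable (fun t => h t * h t) (volume.restrict (Set.Icc (-1 : ℝ) 1)) :=
    Integrable.of_bound (hm.mul hm).aestronglyMeasurable (B * B) (ae_of_all _ fun t => by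
      rw [norm_mul]
      exact mul_le_mul (hB t) (hB t) (norm_nonneg _) hB0)
  have hpol : ∀ p : ℝ[X], ∫ t in Set.Icc (-1 : ℝ) 1, h t * p.eval t = 0 := by
    intro p
    rw [eq_sum_legendreP p p.natDegree le_rfl]
    simp only [eval_finsetSum, eval_smul, smul_eq_mul, Finset.mul_sum]
    have hi : ∀ c : ℝ, ∀ l, Integrable (fun t => h t * (c * (legendreP l).eval t))
        (volume.restrict (Set.Icc (-1 : ℝ) 1)) := fun c l =>
      ((hhp (legendreP l)).const_mul c).congr (ae_of_all _ fun t => by ring)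
    rw [integral_finsetSum _ fun l _ => hi _ l]
    refine Finset.sum_eq_zero fun l _ => ?_
    have h1 := h0 l
    rw [intervalIntegral.integral_of_le (by norm_num), ← integral_Icc_eq_integral_Ioc] at h1
    simp_rw [mul_left_comm (h _)]
    rw [integral_const_mul, h1, mul_zero]
  have hsq : ∫ t in Set.Icc (-1 : ℝ) 1, h t * h t = 0 := by
    refine le_antisymm ?_ (integral_nonneg fun t => mul_self_nonneg _)
    refine le_of_forall_pos_le_add fun ε hε => ?_
    obtain ⟨p, hp⟩ := exists_polynomial_integral_sub_le hm hB
      (show 0 < ε / (B + 1) by positivity)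
    calc ∫ t in Set.Icc (-1 : ℝ) 1, h t * h t
        = ∫ t in Set.Icc (-1 : ℝ) 1, (h t * h t - h t * p.eval t) := by
          rw [integral_sub hhh (hhp p), hpol, sub_zero]
      _ ≤ ∫ t in Set.Icc (-1 : ℝ) 1, B * |h t - p.eval t| := by
          refine integral_mono (hhh.sub (hhp p)) (Integrable.const_mul ?_ B) fun t => ?_
          · exact ((Integrable.of_bound hm.aestronglyMeasurable B (ae_of_all _ hB)).sub
              (hpi p)).abs
          · simp only
            rw [← mul_sub]
            exact (le_abs_self _).trans (by rw [abs_mul]; gcongr; exact hB t)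
      _ ≤ B * (ε / (B + 1)) := by
          rw [integral_const_mul]
          gcongr
      _ ≤ 0 + ε := by
          rw [zero_add, mul_div_assoc', div_le_iff₀ (by positivity)]
          nlinarith
  have := (integral_eq_zero_iff_of_nonneg (fun t => mul_self_nonneg (h t)) hhh).1 hsq
  filter_upwards [this] with t ht
  exact mul_self_eq_zero.1 ht

lemma integrable_zonalKernel {h : ℝ → ℝ} (hm : Measurable h) {B : ℝ} (hB : ∀ t, |h t| ≤ B)
    {f g : S2 → ℂ} (hf : Continuous f) (hg : Continuous g) :
    Integrable (fun z : S2 × S2 => ((h (inner ℝ z.1.1 z.2.1) : ℝ) : ℂ) * (conj (f z.1) * g z.2))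
      (surf.prod surf) := by
  obtain ⟨a, ha0, ha⟩ := continuous_bounded hf
  obtain ⟨b, hb0, hb⟩ := continuous_bounded hg
  have hin : Continuous fun z : S2 × S2 => (inner ℝ z.1.1 z.2.1 : ℝ) := by fun_prop
  have hY : Continuous fun z : S2 × S2 => conj (f z.1) * g z.2 :=
    (Complex.continuous_conj.comp (hf.comp continuous_fst)).mul (hg.comp continuous_snd)
  refine Integrable.of_bound (C := B * (a * b))
    ((Complex.measurable_ofReal.comp (hm.comp hin.measurable)).mul
      hY.measurable).aestronglyMeasurable (ae_of_all _ fun z => ?_)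
  rw [norm_mul, norm_mul, RCLike.norm_conj, Complex.norm_real]
  exact mul_le_mul (hB _) (mul_le_mul (ha _) (hb _) (norm_nonneg _) ha0)
    (by positivity) ((abs_nonneg _).trans (hB 0))

/-- The double integral of a zonal kernel against a bounded kernel is controlled by the `L¹` norm of
its profile. -/
lemma norm_integral_zonalKernel_le {h : ℝ → ℝ} (hm : Measurable h) {B : ℝ} (hB : ∀ t, |h t| ≤ B)
    {f g : S2 → ℂ} (hf : Continuous f) (hg : Continuous g) {a b : ℝ} (ha : ∀ x, ‖f x‖ ≤ a)
    (hb : ∀ x, ‖g x‖ ≤ b) :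
    ‖∫ z : S2 × S2, ((h (inner ℝ z.1.1 z.2.1) : ℝ) : ℂ) * (conj (f z.1) * g z.2)
      ∂(surf.prod surf)‖ ≤
      a * b * (4 * Real.pi * (2 * Real.pi)) * ∫ t in Set.Icc (-1 : ℝ) 1, |h t| := by
  have ha0 : 0 ≤ a := (norm_nonneg _).trans (ha northPole)
  have hb0 : 0 ≤ b := (norm_nonneg _).trans (hb northPole)
  have hin : Continuous fun z : S2 × S2 => (inner ℝ z.1.1 z.2.1 : ℝ) := by fun_prop
  have hi : Integrable (fun z : S2 × S2 => |h (inner ℝ z.1.1 z.2.1)| * (a * b))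
      (surf.prod surf) := by
    refine Integrable.of_bound (C := B * (a * b))
      ((hm.comp hin.measurable).abs.mul_const _).aestronglyMeasurable (ae_of_all _ fun z => ?_)
    rw [norm_mul, norm_mul, Real.norm_of_nonneg ha0, Real.norm_of_nonneg hb0, Real.norm_eq_abs,
      abs_abs]
    gcongr
    exact hB _
  calc _ ≤ ∫ z : S2 × S2, ‖((h (inner ℝ z.1.1 z.2.1) : ℝ) : ℂ) * (conj (f z.1) * g z.2)‖
          ∂(surf.prod surf) := norm_integral_le_integral_norm _
    _ ≤ ∫ z : S2 × S2, |h (inner ℝ z.1.1 z.2.1)| * (a * b) ∂(surf.prod surf) := by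
        refine integral_mono (integrable_zonalKernel hm hB hf hg).norm hi fun z => ?_
        simp only [norm_mul, RCLike.norm_conj, Complex.norm_real, Real.norm_eq_abs]
        exact mul_le_mul_of_nonneg_left (mul_le_mul (ha _) (hb _) (norm_nonneg _) ha0)
          (abs_nonneg _)
    _ = _ := by
        rw [integral_prod_symm _ hi]
        have h1 : ∀ y : S2, ∫ x : S2, |h (inner ℝ x.1 y.1)| * (a * b) ∂surf =
            2 * Real.pi * (∫ t in Set.Icc (-1 : ℝ) 1, |h t|) * (a * b) := fun y => by
          rw [integral_mul_const, integral_comp_inner y (fun t => |h t|) hm.abs,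
            intervalIntegral.integral_of_le (by norm_num), ← integral_Icc_eq_integral_Ioc]
        simp_rw [h1]
        rw [integral_const, surf_real_univ, smul_eq_mul]
        ring

/-- The zonal kernel of degree `l` is the kernel of the projection onto the harmonics of degree `l`. -/
lemma integral_zonal_mul (l : ℕ) (t t' : HarmIdx) :
    ∫ z : S2 × S2, ((zonal l z.1 z.2 : ℝ) : ℂ) * (conj (harm t z.1) * harm t' z.2)
      ∂(surf.prod surf) = if t = t' ∧ t.1 = l then 1 else 0 := by
  have h1 : ∀ z : S2 × S2, ((zonal l z.1 z.2 : ℝ) : ℂ) * (conj (harm t z.1) * harm t' z.2) =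
      ∑ m, (harm ⟨l, m⟩ z.1 * conj (harm t z.1)) * (harm t' z.2 * conj (harm ⟨l, m⟩ z.2)) := by
    intro z
    rw [← sum_harm_mul_conj, Finset.sum_mul]
    exact Finset.sum_congr rfl fun m _ => by ring
  simp_rw [h1]
  have hc : ∀ s : HarmIdx, Continuous (harm s) := continuous_harm
  rw [integral_finsetSum]
  · have h2 : ∀ m, ∫ z : S2 × S2, harm ⟨l, m⟩ z.1 * conj (harm t z.1) *
        (harm t' z.2 * conj (harm ⟨l, m⟩ z.2)) ∂(surf.prod surf) =
        (if (⟨l, m⟩ : HarmIdx) = t then 1 else 0) * if t' = ⟨l, m⟩ then 1 else 0 := fun m => by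
      rw [integral_prod_mul (fun x => harm ⟨l, m⟩ x * conj (harm t x))
        (fun x => harm t' x * conj (harm ⟨l, m⟩ x)), integral_harm_mul_conj,
        integral_harm_mul_conj]
    simp_rw [h2]
    obtain ⟨l', m'⟩ := t
    by_cases h : l' = l
    · subst h
      rw [Finset.sum_eq_single m']
      · by_cases h3 : t' = ⟨l', m'⟩
        · simp [h3]
        · simp [h3, Ne.symm h3]
      · intro b _ hb
        rw [if_neg (fun h' => hb (by simpa using h')), zero_mul]
      · simp
    · rw [if_neg (fun h' => h h'.2)]
      refine Finset.sum_eq_zero fun m _ => ?_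
      rw [if_neg (fun h' => h (congrArg Sigma.fst h').symm), zero_mul]
  · intro m _
    have h2 : Continuous fun x => harm ⟨l, m⟩ x * conj (harm t x) :=
      (hc _).mul (Complex.continuous_conj.comp (hc _))
    have h3 : Continuous fun x => harm t' x * conj (harm ⟨l, m⟩ x) :=
      (hc _).mul (Complex.continuous_conj.comp (hc _))
    exact (continuous_integrable h2).mul_prod (continuous_integrable h3)

lemma continuous_prod_integrable {f : S2 × S2 → ℂ} (hf : Continuous f) :
    Integrable f (surf.prod surf) := by
  have : IsCompact (Set.univ : Set (S2 × S2)) := isCompact_univ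
  exact integrableOn_univ.1 (hf.continuousOn.integrableOn_compact this)

/-- The Funk-Hecke formula for polynomials, in integrated form. -/
lemma integral_polynomial_zonal (p : ℝ[X]) (t t' : HarmIdx) :
    ∫ z : S2 × S2, ((p.eval (inner ℝ z.1.1 z.2.1) : ℝ) : ℂ) * (conj (harm t z.1) * harm t' z.2)
      ∂(surf.prod surf) =
        if t = t' then ((2 * Real.pi * polyInt (p * legendreP t.1) : ℝ) : ℂ) else 0 := by
  set N := max p.natDegree t.1 with hN
  have h1 : ∀ z : S2 × S2,
      ((p.eval (inner ℝ z.1.1 z.2.1) : ℝ) : ℂ) * (conj (harm t z.1) * harm t' z.2) =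
      ∑ l ∈ Finset.range (N + 1), ((2 * Real.pi * polyInt (p * legendreP l) : ℝ) : ℂ) *
        (((zonal l z.1 z.2 : ℝ) : ℂ) * (conj (harm t z.1) * harm t' z.2)) := by
    intro z
    conv_lhs => rw [eq_sum_legendreP p N (le_max_left _ _)]
    rw [eval_finsetSum, Complex.ofReal_sum, Finset.sum_mul]
    refine Finset.sum_congr rfl fun l _ => ?_
    rw [zonal, eval_smul, smul_eq_mul]
    have hpi : (Real.pi : ℂ) ≠ 0 := by exact_mod_cast Real.pi_ne_zero
    push_cast
    field_simp
    ring
  simp_rw [h1]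
  rw [integral_finsetSum]
  · simp_rw [integral_const_mul, integral_zonal_mul]
    rw [Finset.sum_eq_single t.1]
    · simp
    · intro l _ hl
      rw [if_neg (fun h => hl h.2.symm), mul_zero]
    · intro h
      exact absurd (Finset.mem_range.2 (Nat.lt_succ_of_le (le_max_right _ _))) h
  · intro l _
    refine Integrable.const_mul (continuous_prod_integrable ?_) _
    unfold zonal
    have := (continuous_harm t').comp (continuous_snd : Continuous fun z : S2 × S2 => z.2)
    have := Complex.continuous_conj.comp
      ((continuous_harm t).comp (continuous_fst : Continuous fun z : S2 × S2 => z.1))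
    fun_prop

/-- The Funk-Hecke formula in integrated form. -/
lemma integral_zonalKernel_mul {h : ℝ → ℝ} (hm : Measurable h) {B : ℝ} (hB : ∀ t, |h t| ≤ B)
    (t : HarmIdx) :
    ∫ z : S2 × S2, ((h (inner ℝ z.1.1 z.2.1) : ℝ) : ℂ) * (conj (harm t z.1) * harm t z.2)
      ∂(surf.prod surf) =
        ((2 * Real.pi * ∫ s in (-1 : ℝ)..1, h s * (legendreP t.1).eval s : ℝ) : ℂ) := by
  obtain ⟨c, hc0, hc⟩ := continuous_bounded (continuous_harm t)
  have hfin : IsFiniteMeasure (volume.restrict (Set.Icc (-1 : ℝ) 1)) := ⟨by simp⟩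
  have hi : Integrable h (volume.restrict (Set.Icc (-1 : ℝ) 1)) :=
    Integrable.of_bound hm.aestronglyMeasurable B (ae_of_all _ hB)
  refine eq_of_forall_dist_le fun ε hε => ?_
  set A := c * c * (4 * Real.pi * (2 * Real.pi)) + 2 * Real.pi with hA
  have hApos : 0 < A := by
    have := Real.pi_pos
    positivity
  obtain ⟨p, hp⟩ := exists_polynomial_integral_sub_le hm hB (show 0 < ε / A by positivity)
  -- the polynomial is truncated outside `[-1, 1]` to keep it bounded
  set p' : ℝ → ℝ := fun s => p.eval (Set.projIcc (-1 : ℝ) 1 (by norm_num) s) with hp'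
  have hp'c : Continuous p' :=
    p.continuous.comp (continuous_subtype_val.comp continuous_projIcc)
  have hp'eq : ∀ s ∈ Set.Icc (-1 : ℝ) 1, p' s = p.eval s := fun s hs => by
    simp only [hp', Set.projIcc_of_mem _ hs]
  obtain ⟨D, hD⟩ : ∃ D, ∀ s, |p' s| ≤ D := by
    obtain ⟨D, hD⟩ := isCompact_Icc.exists_bound_of_continuousOn
      (p.continuous.continuousOn (s := Set.Icc (-1 : ℝ) 1))
    exact ⟨D, fun s => hD _ (Subtype.prop _)⟩
  have hdm : Measurable fun s => h s - p' s := hm.sub hp'c.measurable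
  have hdB : ∀ s, |h s - p' s| ≤ B + D := fun s =>
    (abs_sub _ _).trans (add_le_add (hB s) (hD s))
  have hd1 : ∫ s in Set.Icc (-1 : ℝ) 1, |h s - p' s| ≤ ε / A := by
    refine le_trans (le_of_eq ?_) hp
    exact setIntegral_congr_fun measurableSet_Icc fun s hs => by
      simp only [hp'eq s hs]
  have e1 := norm_integral_zonalKernel_le hdm hdB (continuous_harm t) (continuous_harm t) hc hc
  have e2 := integral_polynomial_zonal p t t
  rw [if_pos rfl] at e2
  have e3 : ∫ z : S2 × S2, (((fun s => h s - p' s) (inner ℝ z.1.1 z.2.1) : ℝ) : ℂ) *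
      (conj (harm t z.1) * harm t z.2) ∂(surf.prod surf) =
      (∫ z : S2 × S2, ((h (inner ℝ z.1.1 z.2.1) : ℝ) : ℂ) * (conj (harm t z.1) * harm t z.2)
        ∂(surf.prod surf)) - ((2 * Real.pi * polyInt (p * legendreP t.1) : ℝ) : ℂ) := by
    rw [← e2]
    have hpe : ∀ z : S2 × S2, p.eval (inner ℝ z.1.1 z.2.1 : ℝ) = p' (inner ℝ z.1.1 z.2.1) :=
      fun z => (hp'eq _ (inner_mem_Icc _ _)).symm
    simp_rw [hpe]
    rw [← integral_sub (integrable_zonalKernel hm hB (continuous_harm t) (continuous_harm t))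
      (integrable_zonalKernel hp'c.measurable hD (continuous_harm t) (continuous_harm t))]
    congr 1
    ext z
    push_cast
    ring
  have e4 : |(∫ s in (-1 : ℝ)..1, h s * (legendreP t.1).eval s) - polyInt (p * legendreP t.1)| ≤
      ∫ s in Set.Icc (-1 : ℝ) 1, |h s - p.eval s| := by
    have hpi : ∀ p : ℝ[X], Integrable (fun t => p.eval t)
        (volume.restrict (Set.Icc (-1 : ℝ) 1)) :=
      fun p => (p.continuous.continuousOn.integrableOn_compact isCompact_Icc)
    rw [polyInt_apply, intervalIntegral.integral_of_le (by norm_num),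
      intervalIntegral.integral_of_le (by norm_num), ← integral_Icc_eq_integral_Ioc,
      ← integral_Icc_eq_integral_Ioc, ← integral_sub
      ((hpi _).bdd_mul hm.aestronglyMeasurable (ae_of_all _ hB)) (hpi _)]
    refine abs_integral_le_integral_abs.trans (setIntegral_mono_on ?_ (hi.sub (hpi p)).abs
      measurableSet_Icc fun s hs => ?_)
    · exact (((hpi _).bdd_mul hm.aestronglyMeasurable (ae_of_all _ hB)).sub (hpi _)).abs
    · rw [eval_mul, ← sub_mul, abs_mul]
      exact mul_le_of_le_one_right (abs_nonneg _) (abs_eval_legendreP_le_one _ hs)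
  rw [dist_eq_norm]
  set I := ∫ z : S2 × S2, ((h (inner ℝ z.1.1 z.2.1) : ℝ) : ℂ) * (conj (harm t z.1) * harm t z.2)
    ∂(surf.prod surf)
  set J := ∫ s in (-1 : ℝ)..1, h s * (legendreP t.1).eval s
  rw [e3] at e1
  calc ‖I - ((2 * Real.pi * J : ℝ) : ℂ)‖
      = ‖(I - ((2 * Real.pi * polyInt (p * legendreP t.1) : ℝ) : ℂ)) -
          ((2 * Real.pi * (J - polyInt (p * legendreP t.1)) : ℝ) : ℂ)‖ := by
        congr 1
        push_cast
        ring
    _ ≤ c * c * (4 * Real.pi * (2 * Real.pi)) * (ε / A) + 2 * Real.pi * (ε / A) := by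
        refine (norm_sub_le _ _).trans (add_le_add (e1.trans ?_) ?_)
        · have := Real.pi_pos
          gcongr
        · rw [Complex.norm_real, Real.norm_eq_abs, abs_mul, abs_of_pos (by positivity)]
          have := e4.trans hp
          gcongr
    _ = ε := by
        rw [← add_mul, ← hA]
        field_simp

/-! ### The angular power spectra -/

/-- Bessel's inequality for the spherical harmonics. -/
lemma sum_norm_integral_mul_conj_harm_sq_le {f : S2 → ℝ} (hf : MemLp f 2 surf)
    (s : Finset HarmIdx) :
    ∑ t ∈ s, ‖∫ x, (f x : ℂ) * conj (harm t x) ∂surf‖ ^ 2 ≤ ∫ x, f x ^ 2 ∂surf := by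
  set a : HarmIdx → ℂ := fun t => ∫ x, (f x : ℂ) * conj (harm t x) ∂surf with ha
  have hcc : ∀ t, Continuous fun x => conj (harm t x) := fun t =>
    Complex.continuous_conj.comp (continuous_harm t)
  have hfi : Integrable f surf := hf.integrable (by norm_num)
  have hfb : ∀ t, Integrable (fun x => (f x : ℂ) * conj (harm t x)) surf := by
    intro t
    obtain ⟨c, -, hc⟩ := continuous_bounded (hcc t)
    exact hfi.ofReal.mul_bdd (hcc t).aestronglyMeasurable (ae_of_all _ hc)
  have hfb' : ∀ t, Integrable (fun x => (f x : ℂ) * harm t x) surf := by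
    intro t
    obtain ⟨c, -, hc⟩ := continuous_bounded (continuous_harm t)
    exact hfi.ofReal.mul_bdd (continuous_harm t).aestronglyMeasurable (ae_of_all _ hc)
  have hconj : ∀ t, ∫ x, (f x : ℂ) * harm t x ∂surf = conj (a t) := fun t => by
    rw [ha, ← integral_conj]
    simp
  set S : S2 → ℂ := fun x => ∑ t ∈ s, a t * harm t x with hS
  have hSc : Continuous S := by
    have := continuous_harm
    fun_prop
  have h1 : ∫ x, (f x : ℂ) * conj (S x) ∂surf = ∑ t ∈ s, ((‖a t‖ ^ 2 : ℝ) : ℂ) := by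
    have : ∀ x, (f x : ℂ) * conj (S x) = ∑ t ∈ s, conj (a t) * ((f x : ℂ) * conj (harm t x)) :=
      fun x => by
        simp only [hS, map_sum, map_mul, Finset.mul_sum]
        exact Finset.sum_congr rfl fun t _ => by ring
    simp_rw [this]
    rw [integral_finsetSum _ fun t _ => (hfb t).const_mul _]
    refine Finset.sum_congr rfl fun t _ => ?_
    rw [integral_const_mul, mul_comm, Complex.mul_conj']
    norm_cast
  have h2 : ∫ x, (f x : ℂ) * S x ∂surf = ∑ t ∈ s, ((‖a t‖ ^ 2 : ℝ) : ℂ) := by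
    have : ∀ x, (f x : ℂ) * S x = ∑ t ∈ s, a t * ((f x : ℂ) * harm t x) :=
      fun x => by
        simp only [hS, Finset.mul_sum]
        exact Finset.sum_congr rfl fun t _ => by ring
    simp_rw [this]
    rw [integral_finsetSum _ fun t _ => (hfb' t).const_mul _]
    refine Finset.sum_congr rfl fun t _ => ?_
    rw [integral_const_mul, hconj, Complex.mul_conj']
    norm_cast
  have h3 : ∫ x, S x * conj (S x) ∂surf = ∑ t ∈ s, ((‖a t‖ ^ 2 : ℝ) : ℂ) := by
    have : ∀ x, S x * conj (S x) =
        ∑ t ∈ s, ∑ t' ∈ s, (a t * conj (a t')) * (harm t x * conj (harm t' x)) := fun x => by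
      simp only [hS, map_sum, map_mul, Finset.sum_mul_sum]
      exact Finset.sum_congr rfl fun t _ => Finset.sum_congr rfl fun t' _ => by ring
    simp_rw [this]
    have hi : ∀ t t', Integrable (fun x => (a t * conj (a t')) * (harm t x * conj (harm t' x)))
        surf := fun t t' =>
      (continuous_integrable ((continuous_harm t).mul (hcc t'))).const_mul _
    rw [integral_finsetSum _ fun t _ => integrable_finsetSum _ fun t' _ => hi t t']
    refine Finset.sum_congr rfl fun t ht => ?_
    rw [integral_finsetSum _ fun t' _ => hi t t']
    simp_rw [integral_const_mul, integral_harm_mul_conj]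
    simp only [mul_ite, mul_one, mul_zero, Finset.sum_ite_eq, ht, if_true]
    rw [Complex.mul_conj']
    norm_cast
  have hfS : Integrable (fun x => (f x : ℂ) * S x) surf := by
    obtain ⟨c, -, hc⟩ := continuous_bounded hSc
    exact hfi.ofReal.mul_bdd hSc.aestronglyMeasurable (ae_of_all _ hc)
  have hfS' : Integrable (fun x => (f x : ℂ) * conj (S x)) surf := by
    have hSc' := Complex.continuous_conj.comp hSc
    obtain ⟨c, -, hc⟩ := continuous_bounded hSc'
    exact hfi.ofReal.mul_bdd hSc'.aestronglyMeasurable (ae_of_all _ hc)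
  have hSS : Integrable (fun x => S x * conj (S x)) surf :=
    continuous_integrable (hSc.mul (Complex.continuous_conj.comp hSc))
  have h4 : ((∫ x, ‖(f x : ℂ) - S x‖ ^ 2 ∂surf : ℝ) : ℂ) =
      ((∫ x, f x ^ 2 ∂surf - ∑ t ∈ s, ‖a t‖ ^ 2 : ℝ) : ℂ) := by
    have : ∀ x, ((‖(f x : ℂ) - S x‖ ^ 2 : ℝ) : ℂ) = ((f x ^ 2 : ℝ) : ℂ) -
        (f x : ℂ) * conj (S x) - ((f x : ℂ) * S x - S x * conj (S x)) := fun x => by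
      push_cast
      rw [← Complex.mul_conj', map_sub, Complex.conj_ofReal]
      ring
    rw [← integral_complex_ofReal]
    simp_rw [this]
    have hff : Integrable (fun x => ((f x ^ 2 : ℝ) : ℂ)) surf := hf.integrable_sq.ofReal
    have e1 : Integrable (fun x => ((f x ^ 2 : ℝ) : ℂ) - (f x : ℂ) * conj (S x)) surf :=
      hff.sub hfS'
    have e2 : Integrable (fun x => (f x : ℂ) * S x - S x * conj (S x)) surf := hfS.sub hSS
    rw [integral_sub e1 e2, integral_sub hff hfS', integral_sub hfS hSS, h1, h2, h3,
      integral_complex_ofReal]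
    push_cast
    ring
  have h5 := Complex.ofReal_injective h4
  have h6 : 0 ≤ ∫ x, ‖(f x : ℂ) - S x‖ ^ 2 ∂surf := integral_nonneg fun x => by positivity
  linarith

section Spectrum

variable {Ω : Type*} [MeasurableSpace Ω] {P : Measure Ω} {T : S2 → Ω → ℝ}

lemma powerSpec_nonneg (q l : ℕ) : 0 ≤ powerSpec P T q l :=
  integral_nonneg fun ω => by positivity

lemma gam_nonneg (l : ℕ) : 0 ≤ gam P T l := mul_nonneg (by positivity) (powerSpec_nonneg 1 l)

variable [IsProbabilityMeasure P]

lemma abs_covProfile_pow_le_one (hT : IsIsotropicGaussianField P T) (q : ℕ) (t : ℝ) :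
    |covProfile P T t ^ q| ≤ 1 := by
  rw [abs_pow]
  exact pow_le_one₀ (abs_nonneg _) (abs_covProfile_le_one hT t)

lemma integral_norm_harmCoeff_sq_eq (hT : IsIsotropicGaussianField P T) (q : ℕ) (t : HarmIdx) :
    ∫ ω, ‖harmCoeff T q t.1 t.2 ω‖ ^ 2 ∂P = (q.factorial : ℝ) *
      (2 * Real.pi * ∫ s in (-1 : ℝ)..1, covProfile P T s ^ q * (legendreP t.1).eval s) := by
  refine Complex.ofReal_injective ?_
  rw [integral_norm_harmCoeff_sq hT, Complex.ofReal_mul, ← integral_zonalKernel_mul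
    ((measurable_covProfile hT).pow_const q) (abs_covProfile_pow_le_one hT q) t]
  simp_rw [covFun_eq_covProfile hT]
  simp [harm]

lemma powerSpec_eq (hT : IsIsotropicGaussianField P T) (q l : ℕ) :
    powerSpec P T q l = (q.factorial : ℝ) *
      (2 * Real.pi * ∫ s in (-1 : ℝ)..1, covProfile P T s ^ q * (legendreP l).eval s) :=
  integral_norm_harmCoeff_sq_eq hT q ⟨l, ⟨0, by simp⟩⟩

/-- The second moments of the random harmonic coefficients do not depend on the order. -/
lemma integral_norm_harmCoeff_sq_eq_powerSpec (hT : IsIsotropicGaussianField P T) (q : ℕ)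
    (t : HarmIdx) : ∫ ω, ‖harmCoeff T q t.1 t.2 ω‖ ^ 2 ∂P = powerSpec P T q t.1 := by
  rw [powerSpec_eq hT, integral_norm_harmCoeff_sq_eq hT]

lemma integrable_field_sq (hT : IsIsotropicGaussianField P T) :
    Integrable (Function.uncurry fun x ω => T x ω ^ 2) (surf.prod P) := by
  have hm : Measurable (Function.uncurry fun x ω => T x ω ^ 2) := hT.measurable.pow_const 2
  rw [integrable_prod_iff hm.aestronglyMeasurable]
  refine ⟨ae_of_all _ fun x => ?_, ?_⟩
  · exact MemLp.integrable_sq (by exact_mod_cast memLp_field hT x 2)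
  · have : ∀ x, ∫ ω, ‖Function.uncurry (fun x ω => T x ω ^ 2) (x, ω)‖ ∂P = 1 := fun x => by
      simp [hT.variance_one]
    simp_rw [this]
    exact integrable_const _

/-- Bessel's inequality for almost every sample path, in expectation, with `E ∫ T² = 4π`. -/
lemma sum_gam_le (hT : IsIsotropicGaussianField P T) (N : ℕ) :
    ∑ l ∈ Finset.range (N + 1), gam P T l ≤ 4 * Real.pi := by
  have hsq := integrable_field_sq hT
  have hae : ∀ᵐ ω ∂P, MemLp (fun x => T x ω) 2 surf := by
    filter_upwards [hsq.prod_left_ae] with ω hω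
    have hmx : Measurable fun x => T x ω :=
      hT.measurable.comp (by fun_prop : Measurable fun x : S2 => (x, ω))
    exact (memLp_two_iff_integrable_sq hmx.aestronglyMeasurable).2 hω
  have hcoeff : ∀ t : HarmIdx, ∀ ω, harmCoeff T 1 t.1 t.2 ω =
      ∫ x, (T x ω : ℂ) * conj (harm t x) ∂surf := fun t ω => by
    simp [harmCoeff, harm]
  have hbes : ∀ᵐ ω ∂P, ∀ s : Finset HarmIdx,
      ∑ t ∈ s, ‖harmCoeff T 1 t.1 t.2 ω‖ ^ 2 ≤ ∫ x, T x ω ^ 2 ∂surf := by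
    filter_upwards [hae] with ω hω s
    simp_rw [hcoeff]
    exact sum_norm_integral_mul_conj_harm_sq_le hω s
  have hint2 : Integrable (fun ω => ∫ x, T x ω ^ 2 ∂surf) P := hsq.integral_prod_right
  have hi : ∀ t : HarmIdx, Integrable (fun ω => ‖harmCoeff T 1 t.1 t.2 ω‖ ^ 2) P := by
    intro t
    refine hint2.mono' ?_ ?_
    · have hm : Measurable (Function.uncurry fun x ω => (T x ω : ℂ) * conj (harm t x)) := by
        have h1 : Measurable fun z : S2 × Ω => conj (harm t z.1) :=
          (Complex.continuous_conj.comp (continuous_harm t)).measurable.comp measurable_fst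
        exact (Complex.measurable_ofReal.comp hT.measurable).mul h1
      have := hm.stronglyMeasurable.integral_prod_left (μ := surf)
      simp_rw [hcoeff]
      exact (this.norm.measurable.pow_const 2).aestronglyMeasurable
    · filter_upwards [hbes] with ω hω
      simpa using hω {t}
  calc ∑ l ∈ Finset.range (N + 1), gam P T l
      = ∑ t ∈ idxLe N, powerSpec P T 1 t.1 := by
        rw [sum_idxLe]
        refine Finset.sum_congr rfl fun l _ => ?_
        simp only [gam, Finset.sum_const, Finset.card_univ, Fintype.card_coe, Int.card_Icc,
          nsmul_eq_mul]
        congr 1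
        rw [show (l : ℤ) + 1 - -(l : ℤ) = ((2 * l + 1 : ℕ) : ℤ) by push_cast; ring, Int.toNat_natCast]
        push_cast
        ring
    _ = ∫ ω, ∑ t ∈ idxLe N, ‖harmCoeff T 1 t.1 t.2 ω‖ ^ 2 ∂P := by
        rw [integral_finsetSum _ fun t _ => hi t]
        exact Finset.sum_congr rfl fun t _ =>
          (integral_norm_harmCoeff_sq_eq_powerSpec hT 1 t).symm
    _ ≤ ∫ ω, ∫ x, T x ω ^ 2 ∂surf ∂P := by
        refine integral_mono_ae (integrable_finsetSum _ fun t _ => hi t) hint2 ?_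
        filter_upwards [hbes] with ω hω
        exact hω _
    _ = ∫ x, ∫ ω, T x ω ^ 2 ∂P ∂surf := (integral_integral_swap hsq).symm
    _ = 4 * Real.pi := by
        simp_rw [hT.variance_one]
        rw [integral_const, surf_real_univ, smul_eq_mul, mul_one]

lemma summable_gam (hT : IsIsotropicGaussianField P T) : Summable (gam P T) :=
  summable_of_sum_range_le (c := 4 * Real.pi) gam_nonneg fun n => by
    rcases n with _ | n
    · simp [Real.pi_pos.le]
    · exact sum_gam_le hT n

/-- The covariance is the sum of its Legendre series. -/
lemma covProfile_ae_eq (hT : IsIsotropicGaussianField P T) :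
    ∀ᵐ t ∂(volume.restrict (Set.Icc (-1 : ℝ) 1)),
      covProfile P T t = legSeries (gam P T) t / (4 * Real.pi) := by
  have hs := summable_gam hT
  have h0 : ∀ l, 0 ≤ gam P T l := gam_nonneg
  -- the series is frozen outside `[-1, 1]` to keep it measurable and bounded
  set S : ℝ → ℝ := fun t => legSeries (gam P T) (Set.projIcc (-1 : ℝ) 1 (by norm_num) t) with hS
  have hSc : Continuous S := by
    have h1 : Continuous fun t : Set.Icc (-1 : ℝ) 1 => legSeries (gam P T) t :=
      continuousOn_iff_continuous_domRestrict.1 (continuousOn_legSeries hs h0)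
    exact h1.comp continuous_projIcc
  have hSeq : ∀ t ∈ Set.Icc (-1 : ℝ) 1, S t = legSeries (gam P T) t := fun t ht => by
    simp only [hS, Set.projIcc_of_mem _ ht]
  have hSB : ∀ t, |S t| ≤ ∑' l, gam P T l := fun t => abs_legSeries_le hs h0 (Subtype.prop _)
  have hm : Measurable fun t => covProfile P T t - S t / (4 * Real.pi) :=
    (measurable_covProfile hT).sub (hSc.measurable.div_const _)
  have hB : ∀ t, |covProfile P T t - S t / (4 * Real.pi)| ≤
      1 + (∑' l, gam P T l) / (4 * Real.pi) := fun t => by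
    refine (abs_sub _ _).trans (add_le_add (abs_covProfile_le_one hT t) ?_)
    rw [abs_div, abs_of_pos (show 0 < 4 * Real.pi by positivity)]
    gcongr
    exact hSB t
  have hz := ae_eq_zero_of_legendre_coeff hm hB fun l => by
    have h1 := powerSpec_eq hT 1 l
    have h2 := integral_legSeries_mul_legendreP hs h0 l
    have hfin : IsFiniteMeasure (volume.restrict (Set.uIoc (-1 : ℝ) 1)) := ⟨by simp⟩
    have hpb : ∀ s ∈ Set.uIoc (-1 : ℝ) 1, |(legendreP l).eval s| ≤ 1 := fun s hs => by
      rw [Set.uIoc_of_le (by norm_num)] at hs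
      exact abs_eval_legendreP_le_one l ⟨hs.1.le, hs.2⟩
    have i1 : IntervalIntegrable (fun s => covProfile P T s * (legendreP l).eval s) volume (-1) 1 :=
      intervalIntegrable_iff.2 (Integrable.of_bound (C := 1)
        ((measurable_covProfile hT).mul (legendreP l).continuous.measurable).aestronglyMeasurable
        ((ae_restrict_iff' measurableSet_uIoc).2 (ae_of_all _ fun s hs => by
          rw [norm_mul]
          exact mul_le_one₀ (abs_covProfile_le_one hT s) (norm_nonneg _) (hpb s hs))))
    have i2 : IntervalIntegrable (fun s => S s * (legendreP l).eval s) volume (-1) 1 :=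
      (hSc.mul (legendreP l).continuous).intervalIntegrable _ _
    have h3 : ∫ s in (-1 : ℝ)..1, S s * (legendreP l).eval s =
        2 / (2 * (l : ℝ) + 1) * gam P T l := by
      rw [← h2]
      refine intervalIntegral.integral_congr fun s hs => ?_
      rw [Set.uIcc_of_le (by norm_num)] at hs
      simp only [hSeq s hs]
    simp_rw [sub_mul, div_mul_eq_mul_div]
    rw [intervalIntegral.integral_sub i1 (i2.div_const _), intervalIntegral.integral_div, h3, gam,
      h1]
    simp only [pow_one, Nat.factorial_one, Nat.cast_one, one_mul]
    have hpi := Real.pi_pos.ne'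
    field_simp
    ring
  filter_upwards [hz, ae_restrict_mem measurableSet_Icc] with t ht hmem
  rw [← hSeq t hmem]
  linarith

/-- The angular power spectrum of `H_q(T)` in terms of the iterated convolution of the spectrum
of `T`. -/
lemma powerSpec_eq_gamHat (hT : IsIsotropicGaussianField P T) (n l : ℕ) :
    powerSpec P T (n + 1) l = ((n + 1).factorial : ℝ) * ((4 * Real.pi) ^ n)⁻¹ *
      (gamHat (gam P T) (n + 1) l / (2 * (l : ℝ) + 1)) := by
  have hs := summable_gam hT
  have h0 : ∀ l, 0 ≤ gam P T l := gam_nonneg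
  have h1 : ∫ s in (-1 : ℝ)..1, covProfile P T s ^ (n + 1) * (legendreP l).eval s =
      ∫ s in (-1 : ℝ)..1, ((4 * Real.pi) ^ (n + 1))⁻¹ *
        (legSeries (gamHat (gam P T) (n + 1)) s * (legendreP l).eval s) := by
    rw [intervalIntegral.integral_of_le (by norm_num), intervalIntegral.integral_of_le (by norm_num),
      ← integral_Icc_eq_integral_Ioc, ← integral_Icc_eq_integral_Ioc]
    refine integral_congr_ae ?_
    filter_upwards [covProfile_ae_eq hT, ae_restrict_mem measurableSet_Icc] with s hs1 hmem
    rw [hs1, legSeries_gamHat hs h0 n hmem, div_pow]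
    ring
  rw [powerSpec_eq hT, h1, intervalIntegral.integral_const_mul,
    integral_legSeries_mul_legendreP (summable_gamHat hs h0 n) (gamHat_nonneg h0 n)]
  have hpi := Real.pi_pos.ne'
  field_simp
  ring

end Spectrum

/-! ### Gaunt integrals of three spherical harmonics -/

/-- The integral of a product of three spherical harmonics. -/
noncomputable def tripleG (a b c : HarmIdx) : ℂ := ∫ x, harm a x * harm b x * harm c x ∂surf

lemma tripleG_swap (a b c : HarmIdx) : tripleG a b c = tripleG b a c := by
  simp only [tripleG, mul_comm (harm a _)]

lemma tripleG_swap_right (a b c : HarmIdx) : tripleG a b c = tripleG a c b := by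
  simp only [tripleG, mul_right_comm (harm a _)]

/-- The value of `∬ Z_a Z_b Z_c`, where `Z_l(x, y) = ∑_m Y_{lm}(x) conj Y_{lm}(y)`. -/
noncomputable def gauntWeight (a b c : ℕ) : ℝ :=
  (2 * (a : ℝ) + 1) * (2 * (b : ℝ) + 1) * (2 * (c : ℝ) + 1) * threeJSq a b c / (4 * Real.pi)

lemma gauntWeight_nonneg (a b c : ℕ) : 0 ≤ gauntWeight a b c := by
  have := threeJSq_nonneg a b c
  unfold gauntWeight
  positivity

lemma gauntWeight_swap (a b c : ℕ) : gauntWeight a b c = gauntWeight b a c := by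
  rw [gauntWeight, gauntWeight, threeJSq_swap]; ring

lemma gauntWeight_swap_right (a b c : ℕ) : gauntWeight a b c = gauntWeight a c b := by
  rw [gauntWeight, gauntWeight, threeJSq_swap_right]; ring

/-- Unitarity: the Gaunt integrals with two of the orders summed out form a scalar matrix. -/
lemma sum_conj_tripleG_mul_tripleG (j l : ℕ) (t t' : HarmIdx) :
    ∑ m, ∑ m', conj (tripleG t ⟨j, m⟩ ⟨l, m'⟩) * tripleG t' ⟨j, m⟩ ⟨l, m'⟩ =
      if t = t' then ((gauntWeight t.1 j l / (2 * (t.1 : ℝ) + 1) : ℝ) : ℂ) else 0 := by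
  have h1 : ∀ a b : HarmIdx, conj (tripleG t a b) * tripleG t' a b =
      ∫ z : S2 × S2, conj (harm t z.1 * harm a z.1 * harm b z.1) *
        (harm t' z.2 * harm a z.2 * harm b z.2) ∂(surf.prod surf) := fun a b => by
    rw [integral_prod_mul (fun x => conj (harm t x * harm a x * harm b x))
      (fun x => harm t' x * harm a x * harm b x), integral_conj]
    rfl
  have hc : ∀ a b c : HarmIdx, Continuous fun x => harm a x * harm b x * harm c x := fun a b c =>
    ((continuous_harm a).mul (continuous_harm b)).mul (continuous_harm c)
  have hi : ∀ a b : HarmIdx, Integrable (fun z : S2 × S2 =>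
      conj (harm t z.1 * harm a z.1 * harm b z.1) *
        (harm t' z.2 * harm a z.2 * harm b z.2)) (surf.prod surf) := fun a b =>
    continuous_prod_integrable ((Complex.continuous_conj.comp ((hc t a b).comp continuous_fst)).mul
      ((hc t' a b).comp continuous_snd))
  simp_rw [h1]
  rw [← (Finset.sum_congr rfl fun m _ => integral_finsetSum _ fun m' _ => hi ⟨j, m⟩ ⟨l, m'⟩),
    ← integral_finsetSum _ fun m _ => integrable_finsetSum _ fun m' _ => hi ⟨j, m⟩ ⟨l, m'⟩]
  have h2 : ∀ z : S2 × S2, ∑ m, ∑ m',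
      conj (harm t z.1 * harm ⟨j, m⟩ z.1 * harm ⟨l, m'⟩ z.1) *
        (harm t' z.2 * harm ⟨j, m⟩ z.2 * harm ⟨l, m'⟩ z.2) =
      (((C ((2 * (j : ℝ) + 1) / (4 * Real.pi) * ((2 * (l : ℝ) + 1) / (4 * Real.pi))) *
        (legendreP j * legendreP l)).eval (inner ℝ z.1.1 z.2.1) : ℝ) : ℂ) *
        (conj (harm t z.1) * harm t' z.2) := fun z => by
    have e1 := sum_harm_mul_conj j z.2 z.1
    have e2 := sum_harm_mul_conj l z.2 z.1
    have e3 : (((C ((2 * (j : ℝ) + 1) / (4 * Real.pi) * ((2 * (l : ℝ) + 1) / (4 * Real.pi))) *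
        (legendreP j * legendreP l)).eval (inner ℝ z.1.1 z.2.1) : ℝ) : ℂ) =
        (zonal j z.2 z.1 : ℂ) * (zonal l z.2 z.1 : ℂ) := by
      rw [zonal, zonal, real_inner_comm, ← Complex.ofReal_mul, eval_mul, eval_mul, eval_C]
      congr 1
      ring
    rw [e3, ← e1, ← e2, Finset.sum_mul_sum, Finset.sum_mul]
    refine Finset.sum_congr rfl fun m _ => ?_
    rw [Finset.sum_mul]
    refine Finset.sum_congr rfl fun m' _ => ?_
    simp only [map_mul]
    ring
  simp_rw [h2]
  rw [integral_polynomial_zonal]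
  split_ifs with h
  · congr 1
    rw [← smul_eq_C_mul, smul_mul_assoc, map_smul, polyInt_legendreP_mul_mul, smul_eq_mul, gauntWeight,
      threeJSq_swap_right j l, threeJSq_swap j t.1]
    have := Real.pi_pos.ne'
    field_simp
    ring
  · rfl

/-- The diagonal case of unitarity, with the remaining index in the last place. -/
lemma sum_norm_tripleG_sq (L j : ℕ) (e : HarmIdx) :
    ∑ m, ∑ m', ‖tripleG ⟨L, m⟩ ⟨j, m'⟩ e‖ ^ 2 = gauntWeight L j e.1 / (2 * (e.1 : ℝ) + 1) := by
  have h := sum_conj_tripleG_mul_tripleG L j e e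
  rw [if_pos rfl] at h
  have h1 : ∀ m m', conj (tripleG e ⟨L, m⟩ ⟨j, m'⟩) * tripleG e ⟨L, m⟩ ⟨j, m'⟩ =
      ((‖tripleG ⟨L, m⟩ ⟨j, m'⟩ e‖ ^ 2 : ℝ) : ℂ) := fun m m' => by
    rw [Complex.conj_mul', tripleG_swap, tripleG_swap_right]
    norm_cast
  simp_rw [h1] at h
  rw [gauntWeight_swap_right, gauntWeight_swap]
  exact_mod_cast h

/-- The triangle condition. -/
lemma tripleG_eq_zero {a b c : HarmIdx} (h : b.1 + c.1 < a.1) : tripleG a b c = 0 := by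
  obtain ⟨L, m⟩ := a
  obtain ⟨j, m'⟩ := b
  have h1 := sum_norm_tripleG_sq L j c
  have h0 : gauntWeight L j c.1 = 0 := by
    rw [gauntWeight, threeJSq_eq_zero (by simp only at h; omega)]
    simp
  rw [h0, zero_div] at h1
  have h2 := (Finset.sum_eq_zero_iff_of_nonneg
    (fun m _ => Finset.sum_nonneg fun m' _ => by positivity)).1 h1 m (Finset.mem_univ _)
  have h3 := (Finset.sum_eq_zero_iff_of_nonneg (fun m' _ => by positivity)).1 h2 m'
    (Finset.mem_univ _)
  exact norm_eq_zero.1 (pow_eq_zero_iff (by norm_num) |>.1 h3)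

/-! ### A quadratic form in the Gaunt integrals -/

/-- The matrix `∑_t u_t 𝒢{t, s, e} conj 𝒢{t, s', e}`, with degrees `≤ N` and weights `u` that depend
on the degree only. -/
noncomputable def gauntMatrix (u : ℕ → ℝ) (N : ℕ) (e s s' : HarmIdx) : ℂ :=
  ∑ t ∈ idxLe N, (u t.1 : ℂ) * (tripleG t s e * conj (tripleG t s' e))

/-- The weighted Hilbert-Schmidt norm of `gauntMatrix`. -/
noncomputable def gauntForm (u v : ℕ → ℝ) (N N' : ℕ) (e : HarmIdx) : ℝ :=
  ∑ p ∈ idxLe N' ×ˢ idxLe N', v p.1.1 * v p.2.1 * ‖gauntMatrix u N e p.1 p.2‖ ^ 2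

lemma gauntForm_eq (u v : ℕ → ℝ) (N N' : ℕ) (e : HarmIdx) :
    (gauntForm u v N N' e : ℂ) = ∑ p ∈ idxLe N' ×ˢ idxLe N', ∑ r ∈ idxLe N ×ˢ idxLe N,
      ((v p.1.1 * v p.2.1 * u r.1.1 * u r.2.1 : ℝ) : ℂ) *
        (tripleG r.1 p.1 e * conj (tripleG r.1 p.2 e) *
          (conj (tripleG r.2 p.1 e) * tripleG r.2 p.2 e)) := by
  rw [gauntForm, Complex.ofReal_sum]
  refine Finset.sum_congr rfl fun p _ => ?_
  rw [Complex.ofReal_mul, Complex.ofReal_pow, ← Complex.mul_conj', gauntMatrix, map_sum,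
    Finset.sum_mul_sum, ← Finset.sum_product', Finset.mul_sum]
  refine Finset.sum_congr rfl fun r _ => ?_
  simp only [map_mul, Complex.conj_ofReal, Complex.conj_conj]
  push_cast
  ring

/-- The roles of the two weights can be exchanged. -/
lemma gauntForm_comm (u v : ℕ → ℝ) (N N' : ℕ) (e : HarmIdx) :
    gauntForm u v N N' e = gauntForm v u N' N e := by
  refine Complex.ofReal_injective ?_
  rw [gauntForm_eq, gauntForm_eq, Finset.sum_comm]
  refine Finset.sum_congr rfl fun r _ => Finset.sum_congr rfl fun p _ => ?_
  rw [tripleG_swap p.1 r.1, tripleG_swap p.1 r.2, tripleG_swap p.2 r.1, tripleG_swap p.2 r.2]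
  push_cast
  ring

/-- Summing over all orders of the index `e` makes the form computable through unitarity, and only
adds nonnegative terms. -/
lemma gauntForm_le {u v : ℕ → ℝ} (hv : ∀ j, 0 ≤ v j) (N N' : ℕ) (e : HarmIdx) :
    gauntForm u v N N' e ≤ ∑ L ∈ Finset.range (N + 1),
      (u L * ∑ j ∈ Finset.range (N' + 1), v j * gauntWeight L j e.1) ^ 2 /
        ((2 * (L : ℝ) + 1) * (2 * (e.1 : ℝ) + 1)) := by
  obtain ⟨l, m0⟩ := e
  set e : HarmIdx := ⟨l, m0⟩ with he
  set Q : HarmIdx → HarmIdx → Finset.Icc (-(l : ℤ)) (l : ℤ) → ℂ := fun s s' m' =>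
    ∑ t ∈ idxLe N, (u t.1 : ℂ) * (tripleG t s e * conj (tripleG t s' ⟨l, m'⟩)) with hQ
  set X : ℕ → ℝ := fun L => ∑ j ∈ Finset.range (N' + 1), v j * gauntWeight L j l with hX
  have hone : ∀ t r : HarmIdx, ∑ s' ∈ idxLe N', ∑ m', (v s'.1 : ℂ) *
      (conj (tripleG t s' ⟨l, m'⟩) * tripleG r s' ⟨l, m'⟩) =
      if t = r then ((X t.1 / (2 * (t.1 : ℝ) + 1) : ℝ) : ℂ) else 0 := fun t r => by
    rw [sum_idxLe]
    simp_rw [← Finset.mul_sum]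
    simp_rw [sum_conj_tripleG_mul_tripleG]
    split_ifs with h
    · rw [hX, Finset.sum_div]
      push_cast
      exact Finset.sum_congr rfl fun j _ => by ring
    · simp
  have htwo : ∀ L : ℕ, ∑ m, ∑ s ∈ idxLe N', v s.1 * ‖tripleG ⟨L, m⟩ s e‖ ^ 2 =
      X L / (2 * (l : ℝ) + 1) := fun L => by
    simp_rw [sum_idxLe]
    rw [Finset.sum_comm, hX, Finset.sum_div]
    refine Finset.sum_congr rfl fun j _ => ?_
    simp_rw [← Finset.mul_sum]
    rw [sum_norm_tripleG_sq]
    ring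
  have hbig : ((∑ p ∈ idxLe N' ×ˢ idxLe N', v p.1.1 * v p.2.1 * ∑ m', ‖Q p.1 p.2 m'‖ ^ 2 : ℝ) : ℂ)
      = ((∑ t ∈ idxLe N, u t.1 ^ 2 * (X t.1 / (2 * (t.1 : ℝ) + 1)) *
          ∑ s ∈ idxLe N', v s.1 * ‖tripleG t s e‖ ^ 2 : ℝ) : ℂ) := by
    have h1 : ∀ s s' m', ((‖Q s s' m'‖ ^ 2 : ℝ) : ℂ) = ∑ t ∈ idxLe N, ∑ r ∈ idxLe N,
        ((u t.1 : ℂ) * (u r.1 : ℂ)) * (tripleG t s e * conj (tripleG r s e)) *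
          (conj (tripleG t s' ⟨l, m'⟩) * tripleG r s' ⟨l, m'⟩) := fun s s' m' => by
      rw [Complex.ofReal_pow, ← Complex.mul_conj', hQ]
      simp only [map_sum]
      rw [Finset.sum_mul_sum]
      refine Finset.sum_congr rfl fun t _ => Finset.sum_congr rfl fun r _ => ?_
      simp only [map_mul, Complex.conj_ofReal, Complex.conj_conj]
      ring
    calc _ = ∑ s ∈ idxLe N', ∑ s' ∈ idxLe N', ∑ m', ∑ t ∈ idxLe N, ∑ r ∈ idxLe N,
          ((u t.1 : ℂ) * (u r.1 : ℂ)) * ((v s.1 : ℂ) * (tripleG t s e * conj (tripleG r s e))) *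
          ((v s'.1 : ℂ) * (conj (tripleG t s' ⟨l, m'⟩) * tripleG r s' ⟨l, m'⟩)) := by
          rw [Finset.sum_product, Complex.ofReal_sum]
          refine Finset.sum_congr rfl fun s _ => ?_
          rw [Complex.ofReal_sum]
          refine Finset.sum_congr rfl fun s' _ => ?_
          rw [Complex.ofReal_mul, Complex.ofReal_sum, Finset.mul_sum]
          refine Finset.sum_congr rfl fun m' _ => ?_
          rw [h1, Finset.mul_sum]
          refine Finset.sum_congr rfl fun t _ => ?_
          rw [Finset.mul_sum]
          refine Finset.sum_congr rfl fun r _ => ?_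
          push_cast
          ring
      _ = ∑ t ∈ idxLe N, ∑ r ∈ idxLe N, ∑ s ∈ idxLe N', ∑ s' ∈ idxLe N', ∑ m',
          ((u t.1 : ℂ) * (u r.1 : ℂ)) * ((v s.1 : ℂ) * (tripleG t s e * conj (tripleG r s e))) *
          ((v s'.1 : ℂ) * (conj (tripleG t s' ⟨l, m'⟩) * tripleG r s' ⟨l, m'⟩)) := by
          rw [Finset.sum_comm' (s' := fun _ => idxLe N') (t' := idxLe N') (by simp)]
          simp_rw [Finset.sum_comm (s := Finset.univ) (t := idxLe N)]
          simp_rw [Finset.sum_comm (s := idxLe N') (t := idxLe N)]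
          refine Finset.sum_congr rfl fun t _ => Finset.sum_congr rfl fun r _ => ?_
          rw [Finset.sum_comm]
      _ = ∑ t ∈ idxLe N, ∑ r ∈ idxLe N, ((u t.1 : ℂ) * (u r.1 : ℂ)) *
          (∑ s ∈ idxLe N', (v s.1 : ℂ) * (tripleG t s e * conj (tripleG r s e))) *
          if t = r then ((X t.1 / (2 * (t.1 : ℝ) + 1) : ℝ) : ℂ) else 0 := by
          refine Finset.sum_congr rfl fun t _ => Finset.sum_congr rfl fun r _ => ?_
          rw [← hone, mul_assoc, Finset.sum_mul, Finset.mul_sum]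
          refine Finset.sum_congr rfl fun s _ => ?_
          rw [Finset.mul_sum, Finset.mul_sum]
          refine Finset.sum_congr rfl fun s' _ => ?_
          rw [Finset.mul_sum, Finset.mul_sum]
          exact Finset.sum_congr rfl fun m' _ => by ring
      _ = _ := by
          rw [Complex.ofReal_sum]
          refine Finset.sum_congr rfl fun t ht => ?_
          simp only [mul_ite, mul_zero]
          rw [Finset.sum_ite_eq, if_pos ht, Complex.ofReal_mul, Complex.ofReal_sum]
          have : ∀ s, (v s.1 : ℂ) * (tripleG t s e * conj (tripleG t s e)) =
              ((v s.1 * ‖tripleG t s e‖ ^ 2 : ℝ) : ℂ) := fun s => by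
            rw [Complex.mul_conj']
            push_cast
            ring
          simp_rw [this]
          push_cast
          ring
  have hbig' := Complex.ofReal_injective hbig
  calc gauntForm u v N N' e
      ≤ ∑ p ∈ idxLe N' ×ˢ idxLe N', v p.1.1 * v p.2.1 * ∑ m', ‖Q p.1 p.2 m'‖ ^ 2 := by
        refine Finset.sum_le_sum fun p _ => mul_le_mul_of_nonneg_left ?_
          (mul_nonneg (hv _) (hv _))
        exact Finset.single_le_sum (f := fun m' => ‖Q p.1 p.2 m'‖ ^ 2)
          (fun m' _ => by positivity) (Finset.mem_univ m0)
    _ = ∑ L ∈ Finset.range (N + 1), u L ^ 2 * (X L / (2 * (L : ℝ) + 1)) *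
          (X L / (2 * (l : ℝ) + 1)) := by
        rw [hbig', sum_idxLe]
        refine Finset.sum_congr rfl fun L _ => ?_
        rw [← htwo, Finset.mul_sum]
    _ = _ := by
        refine Finset.sum_congr rfl fun L _ => ?_
        change u L ^ 2 * (X L / (2 * (L : ℝ) + 1)) * (X L / (2 * (l : ℝ) + 1)) =
          (u L * X L) ^ 2 / ((2 * (L : ℝ) + 1) * (2 * (l : ℝ) + 1))
        field_simp

/-! ### Summation of products of Gaunt integrals -/

/-- The reflection `y ↦ -y` conjugates every spherical harmonic. -/
lemma harm_reflY (t : HarmIdx) (x : S2) : harm t (sphMap reflY x) = conj (harm t x) := by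
  have h0 : (sphMap reflY x).1 0 = x.1 0 := by rw [coe_sphMap, reflY_apply]; rfl
  have h1 : (sphMap reflY x).1 1 = - x.1 1 := by rw [coe_sphMap, reflY_apply]; rfl
  have h2 : (sphMap reflY x).1 2 = x.1 2 := by rw [coe_sphMap, reflY_apply]; rfl
  have h3 : planar (sphMap reflY x) = conj (planar x) := by
    simp [planar, h0, h1]
  rw [harm, harm, sphHarm_eq, sphHarm_eq, map_mul, Complex.conj_ofReal, h2]
  congr 1
  unfold planarPow
  split_ifs
  · rw [h3, map_pow]
  · rw [h3, map_pow]

lemma conj_integral_eq_of_reflY {f : S2 → ℂ} (hf : ∀ x, f (sphMap reflY x) = conj (f x)) :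
    conj (∫ x, f x ∂surf) = ∫ x, f x ∂surf := by
  rw [← integral_conj]
  simp_rw [← hf]
  exact integral_sphMap reflY f

/-- The Gaunt integral of a family of harmonics and of two further ones. -/
noncomputable def prodG {n : ℕ} (r : Fin n → HarmIdx) (s e : HarmIdx) : ℂ :=
  ∫ x, (∏ i, harm (r i) x) * (harm s x * harm e x) ∂surf

/-- Gaunt integrals are real. -/
lemma conj_prodG {n : ℕ} (r : Fin n → HarmIdx) (s e : HarmIdx) :
    conj (prodG r s e) = prodG r s e :=
  conj_integral_eq_of_reflY fun x => by simp [harm_reflY]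

lemma gaunt_eq_prodG {n : ℕ} (r : Fin n → HarmIdx) (s e : HarmIdx) :
    gaunt (List.ofFn (fun i => (r i).pair) ++ [s.pair] ++ [e.pair]) = prodG r s e := by
  rw [gaunt, prodG]
  congr 1
  ext x
  simp only [List.map_append, List.prod_append, List.map_ofFn, List.prod_ofFn, List.map_cons,
    List.map_nil, List.prod_singleton, mul_assoc]
  rfl

/-- The power of an absolutely convergent series as a series over tuples. -/
lemma tsum_prod_fin {ι 𝕜 : Type*} [RCLike 𝕜] {f : ι → 𝕜} (hf : Summable fun i => ‖f i‖) (n : ℕ) :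
    (Summable fun r : Fin n → ι => ‖∏ i, f (r i)‖) ∧
      ∑' r : Fin n → ι, ∏ i, f (r i) = (∑' i, f i) ^ n := by
  induction n with
  | zero =>
    refine ⟨(hasSum_fintype _).summable, ?_⟩
    rw [tsum_fintype]
    simp
  | succ n ih =>
    have h1 : ∀ p : ι × (Fin n → ι), ∏ i, f (Fin.consEquiv (fun _ => ι) p i) =
        f p.1 * ∏ i, f (p.2 i) := fun p => by
      simp [Fin.prod_univ_succ, Fin.consEquiv]
    constructor
    · rw [← (Fin.consEquiv (fun _ : Fin (n + 1) => ι)).summable_iff]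
      refine (hf.mul_norm ih.1).congr fun p => ?_
      rw [Function.comp_apply, h1]
    · rw [← (Fin.consEquiv (fun _ : Fin (n + 1) => ι)).tsum_eq]
      simp_rw [h1]
      rw [pow_succ', ← ih.2]
      exact (tsum_mul_tsum_of_summable_norm hf ih.1).symm

/-- Termwise integration over `S² × S²` of an absolutely and boundedly convergent series. -/
lemma hasSum_integral_of_bound {ι : Type*} [Countable ι] {φ : ι → S2 × S2 → ℂ}
    (hφ : ∀ i, Continuous (φ i)) {B : ℝ} (hs : ∀ z, Summable fun i => ‖φ i z‖)
    (hB : ∀ z, ∑' i, ‖φ i z‖ ≤ B) :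
    HasSum (fun i => ∫ z, φ i z ∂(surf.prod surf)) (∫ z, ∑' i, φ i z ∂(surf.prod surf)) := by
  refine hasSum_integral_of_summable_integral_norm
    (fun i => continuous_prod_integrable (hφ i)) ?_
  refine summable_of_sum_le (c := ∫ _ : S2 × S2, B ∂(surf.prod surf))
    (fun i => integral_nonneg fun z => norm_nonneg _) fun u => ?_
  rw [← integral_finsetSum _ fun i _ => (continuous_prod_integrable (hφ i)).norm]
  refine integral_mono (integrable_finsetSum _ fun i _ =>
    (continuous_prod_integrable (hφ i)).norm) (integrable_const _) fun z => ?_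
  exact ((hs z).sum_le_tsum u fun i _ => norm_nonneg _).trans (hB z)

section Kernel

variable {Γ : ℕ → ℝ}

/-- The summand of the expansion of a zonal kernel in spherical harmonics. -/
noncomputable def kernelTerm (Γ : ℕ → ℝ) (t : HarmIdx) (z : S2 × S2) : ℂ :=
  ((Γ t.1 / (2 * (t.1 : ℝ) + 1) : ℝ) : ℂ) * (harm t z.1 * conj (harm t z.2))

lemma continuous_kernelTerm (t : HarmIdx) : Continuous (kernelTerm Γ t) := by
  unfold kernelTerm
  exact continuous_const.mul (((continuous_harm t).comp continuous_fst).mul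
    (Complex.continuous_conj.comp ((continuous_harm t).comp continuous_snd)))

lemma sum_norm_kernelTerm_le (h0 : ∀ l, 0 ≤ Γ l) (l : ℕ) (z : S2 × S2) :
    ∑ m, ‖kernelTerm Γ ⟨l, m⟩ z‖ ≤ Γ l / (4 * Real.pi) := by
  have h1 : ∀ m, ‖kernelTerm Γ ⟨l, m⟩ z‖ =
      Γ l / (2 * (l : ℝ) + 1) * (‖harm ⟨l, m⟩ z.1‖ * ‖harm ⟨l, m⟩ z.2‖) := fun m => by
    have : 0 ≤ Γ l / (2 * (l : ℝ) + 1) := div_nonneg (h0 l) (by positivity)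
    rw [kernelTerm, norm_mul, norm_mul, RCLike.norm_conj, Complex.norm_real,
      Real.norm_of_nonneg this]
  simp_rw [h1]
  rw [← Finset.mul_sum]
  calc _ ≤ Γ l / (2 * (l : ℝ) + 1) * ((2 * (l : ℝ) + 1) / (4 * Real.pi)) :=
        mul_le_mul_of_nonneg_left (sum_norm_harm_mul_norm_harm_le l z.1 z.2)
          (div_nonneg (h0 l) (by positivity))
    _ = _ := by field_simp

lemma summable_norm_kernelTerm (hs : Summable Γ) (h0 : ∀ l, 0 ≤ Γ l) (z : S2 × S2) :
    Summable fun t => ‖kernelTerm Γ t z‖ := by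
  refine (summable_sigma_of_nonneg fun t => norm_nonneg _).2
    ⟨fun l => (hasSum_fintype _).summable, ?_⟩
  refine Summable.of_nonneg_of_le (fun l => tsum_nonneg fun m => norm_nonneg _) (fun l => ?_)
    (hs.div_const (4 * Real.pi))
  rw [tsum_fintype]
  exact sum_norm_kernelTerm_le h0 l z

lemma tsum_norm_kernelTerm_le (hs : Summable Γ) (h0 : ∀ l, 0 ≤ Γ l) (z : S2 × S2) :
    ∑' t, ‖kernelTerm Γ t z‖ ≤ (∑' l, Γ l) / (4 * Real.pi) := by
  have h := summable_norm_kernelTerm hs h0 z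
  rw [h.tsum_sigma, ← tsum_div_const]
  refine h.sigma.tsum_le_tsum (fun l => ?_) (hs.div_const (4 * Real.pi))
  rw [tsum_fintype]
  exact sum_norm_kernelTerm_le h0 l z

lemma tsum_kernelTerm (hs : Summable Γ) (h0 : ∀ l, 0 ≤ Γ l) (z : S2 × S2) :
    ∑' t, kernelTerm Γ t z = ((legSeries Γ (inner ℝ z.1.1 z.2.1) / (4 * Real.pi) : ℝ) : ℂ) := by
  have h := (summable_norm_kernelTerm hs h0 z).of_norm
  rw [h.tsum_sigma, legSeries, ← tsum_div_const, Complex.ofReal_tsum]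
  refine tsum_congr fun l => ?_
  rw [tsum_fintype]
  simp only [kernelTerm]
  rw [← Finset.mul_sum, sum_harm_mul_conj, ← Complex.ofReal_mul, zonal]
  congr 1
  field_simp

/-- A sum of products of Gaunt integrals as a double integral of a power of a zonal kernel. -/
lemma hasSum_prodG_mul_prodG (hs : Summable Γ) (h0 : ∀ l, 0 ≤ Γ l) (n : ℕ) (s t e : HarmIdx) :
    HasSum (fun r : Fin n → HarmIdx =>
        ((∏ i, Γ (r i).1 / (2 * ((r i).1 : ℝ) + 1) : ℝ) : ℂ) * prodG r s e * conj (prodG r t e))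
      (∫ z : S2 × S2, ((legSeries Γ (inner ℝ z.1.1 z.2.1) / (4 * Real.pi) : ℝ) : ℂ) ^ n *
        (harm s z.1 * harm e z.1 * conj (harm t z.2 * harm e z.2)) ∂(surf.prod surf)) := by
  have hF : ∀ a : HarmIdx, Continuous fun x => harm a x * harm e x := fun a =>
    (continuous_harm a).mul (continuous_harm e)
  obtain ⟨a, ha0, ha⟩ := continuous_bounded (hF s)
  obtain ⟨b, hb0, hb⟩ := continuous_bounded (hF t)
  have hFc : Continuous fun z : S2 × S2 =>
      harm s z.1 * harm e z.1 * conj (harm t z.2 * harm e z.2) :=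
    ((hF s).comp continuous_fst).mul (Complex.continuous_conj.comp ((hF t).comp continuous_snd))
  set φ : (Fin n → HarmIdx) → S2 × S2 → ℂ := fun r z => (∏ i, kernelTerm Γ (r i) z) *
    (harm s z.1 * harm e z.1 * conj (harm t z.2 * harm e z.2)) with hφ
  have hφc : ∀ r, Continuous (φ r) := fun r =>
    (continuous_finsetProd _ fun i _ => continuous_kernelTerm (r i)).mul hFc
  have hpow := fun z => tsum_prod_fin (summable_norm_kernelTerm hs h0 z) n
  have hpown : ∀ z, (Summable fun r : Fin n → HarmIdx => ‖∏ i, kernelTerm Γ (r i) z‖) ∧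
      ∑' r : Fin n → HarmIdx, ‖∏ i, kernelTerm Γ (r i) z‖ = (∑' t, ‖kernelTerm Γ t z‖) ^ n :=
    fun z => by
      have := tsum_prod_fin (f := fun t => ‖kernelTerm Γ t z‖)
        (by simpa using summable_norm_kernelTerm hs h0 z) n
      simpa only [norm_prod, norm_norm] using this
  have hmain := hasSum_integral_of_bound (φ := φ) hφc
    (B := ((∑' l, Γ l) / (4 * Real.pi)) ^ n * (a * b))
    (fun z => by
      simp only [hφ, norm_mul (∏ i, _)]
      exact (hpown z).1.mul_right _)
    (fun z => by
      simp only [hφ, norm_mul (∏ i, _)]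
      rw [tsum_mul_right, (hpown z).2]
      refine mul_le_mul (pow_le_pow_left₀ (tsum_nonneg fun t => norm_nonneg _)
        (tsum_norm_kernelTerm_le hs h0 z) n) ?_ (norm_nonneg _)
        (pow_nonneg (div_nonneg (tsum_nonneg h0) (by positivity)) n)
      rw [norm_mul, RCLike.norm_conj]
      exact mul_le_mul (ha _) (hb _) (norm_nonneg _) ha0)
  have e1 : ∀ r, ∫ z, φ r z ∂(surf.prod surf) =
      ((∏ i, Γ (r i).1 / (2 * ((r i).1 : ℝ) + 1) : ℝ) : ℂ) * prodG r s e * conj (prodG r t e) := by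
    intro r
    have : ∀ z : S2 × S2, φ r z = ((∏ i, Γ (r i).1 / (2 * ((r i).1 : ℝ) + 1) : ℝ) : ℂ) *
        (((∏ i, harm (r i) z.1) * (harm s z.1 * harm e z.1)) *
          conj ((∏ i, harm (r i) z.2) * (harm t z.2 * harm e z.2))) := fun z => by
      simp only [hφ, kernelTerm, Finset.prod_mul_distrib, map_mul, map_prod, Complex.ofReal_prod]
      ring
    simp_rw [this]
    rw [integral_const_mul, integral_prod_mul
      (fun x => (∏ i, harm (r i) x) * (harm s x * harm e x))
      (fun x => conj ((∏ i, harm (r i) x) * (harm t x * harm e x))), integral_conj, mul_assoc]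
    rfl
  have e2 : ∀ z, ∑' r, φ r z =
      ((legSeries Γ (inner ℝ z.1.1 z.2.1) / (4 * Real.pi) : ℝ) : ℂ) ^ n *
        (harm s z.1 * harm e z.1 * conj (harm t z.2 * harm e z.2)) := fun z => by
    simp only [hφ]
    rw [tsum_mul_right, (tsum_prod_fin (summable_norm_kernelTerm hs h0 z) n).2,
      tsum_kernelTerm hs h0]
  simp_rw [e1, e2] at hmain
  exact hmain

lemma prodG_fin_one (t s e : HarmIdx) : prodG (fun _ : Fin 1 => t) s e = tripleG t s e := by
  simp [prodG, tripleG, mul_assoc]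

/-- The sum over `n + 1` pairs of indices collapses to a sum over a single pair. -/
lemma tsum_prodG_mul_prodG (hs : Summable Γ) (h0 : ∀ l, 0 ≤ Γ l) (n : ℕ) (s t e : HarmIdx)
    {N : ℕ} (hN : s.1 + e.1 ≤ N) :
    ∑' r : Fin (n + 1) → HarmIdx,
        ((∏ i, Γ (r i).1 / (2 * ((r i).1 : ℝ) + 1) : ℝ) : ℂ) * prodG r s e * prodG r t e =
      gauntMatrix (fun L => ((4 * Real.pi) ^ n)⁻¹ * (gamHat Γ (n + 1) L / (2 * (L : ℝ) + 1)))
        N e s t := by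
  have h1 := (hasSum_prodG_mul_prodG hs h0 (n + 1) s t e).tsum_eq
  have h2 := (hasSum_prodG_mul_prodG (summable_gamHat hs h0 n) (gamHat_nonneg h0 n) 1 s t
    e).tsum_eq
  simp_rw [conj_prodG] at h1
  rw [h1]
  have h3 : ∀ z : S2 × S2, ((legSeries Γ (inner ℝ z.1.1 z.2.1) / (4 * Real.pi) : ℝ) : ℂ) ^ (n + 1) =
      ((((4 * Real.pi) ^ n)⁻¹ : ℝ) : ℂ) *
        ((legSeries (gamHat Γ (n + 1)) (inner ℝ z.1.1 z.2.1) / (4 * Real.pi) : ℝ) : ℂ) ^ 1 :=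
    fun z => by
      rw [legSeries_gamHat hs h0 n (inner_mem_Icc _ _), pow_one, ← Complex.ofReal_mul,
        ← Complex.ofReal_pow]
      congr 1
      rw [div_pow, pow_succ (4 * Real.pi)]
      field_simp
  simp_rw [h3, mul_assoc ((((4 * Real.pi) ^ n)⁻¹ : ℝ) : ℂ)]
  rw [integral_const_mul, ← h2, ← (Equiv.funUnique (Fin 1) HarmIdx).symm.tsum_eq, gauntMatrix,
    tsum_eq_sum (s := idxLe N), Finset.mul_sum]
  · refine Finset.sum_congr rfl fun r _ => ?_
    have : (Equiv.funUnique (Fin 1) HarmIdx).symm r = fun _ => r := rfl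
    rw [this, prodG_fin_one, prodG_fin_one]
    simp only [Finset.univ_unique, Finset.prod_singleton]
    push_cast
    ring
  · intro r hr
    have : (Equiv.funUnique (Fin 1) HarmIdx).symm r = fun _ => r := rfl
    rw [this, prodG_fin_one, tripleG_eq_zero (by
      rw [mem_idxLe] at hr
      omega)]
    ring

end Kernel

/-! ### The bound for the contraction -/

/-- If the `L`-th term of the bound for the form vanishes for `L < l / 2`, the factors `2 L + 1` and
`2 l + 1` are comparable, and the form is at most a sum times a maximum. -/
lemma gauntForm_le_of_low_eq_zero {u v y : ℕ → ℝ} (hu : ∀ L, 0 ≤ u L) (hv : ∀ j, 0 ≤ v j)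
    {N N' : ℕ} {e : HarmIdx} {Y D : ℝ}
    (hy : ∀ L, u L * ∑ j ∈ Finset.range (N' + 1), v j * gauntWeight L j e.1 ≤ y L)
    (hlow : ∀ L, 2 * L < e.1 →
      u L * ∑ j ∈ Finset.range (N' + 1), v j * gauntWeight L j e.1 = 0)
    (hsum : ∑ L ∈ Finset.range (N + 1), y L ≤ Y) (hmax : ∀ L, y L ≤ D) :
    gauntForm u v N N' e ≤ 2 * Y * D / (2 * (e.1 : ℝ) + 1) ^ 2 := by
  set x : ℕ → ℝ := fun L => u L * ∑ j ∈ Finset.range (N' + 1), v j * gauntWeight L j e.1 with hx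
  have hx0 : ∀ L, 0 ≤ x L := fun L => mul_nonneg (hu L) (Finset.sum_nonneg fun j _ =>
    mul_nonneg (hv j) (gauntWeight_nonneg _ _ _))
  have hD : 0 ≤ D := (hx0 0).trans ((hy 0).trans (hmax 0))
  calc gauntForm u v N N' e
      ≤ ∑ L ∈ Finset.range (N + 1), x L ^ 2 / ((2 * (L : ℝ) + 1) * (2 * (e.1 : ℝ) + 1)) :=
        gauntForm_le hv N N' e
    _ ≤ ∑ L ∈ Finset.range (N + 1), 2 * y L * D / (2 * (e.1 : ℝ) + 1) ^ 2 := by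
        refine Finset.sum_le_sum fun L _ => ?_
        have hxy : x L ≤ y L := hy L
        by_cases hL : 2 * L < e.1
        · have : x L = 0 := hlow L hL
          have h1 : 0 ≤ y L := (hx0 L).trans hxy
          rw [this]
          have : 0 ≤ 2 * y L * D / (2 * (e.1 : ℝ) + 1) ^ 2 := by positivity
          simpa using this
        · have h1 : (e.1 : ℝ) ≤ 2 * L := by exact_mod_cast not_lt.1 hL
          have h2 : x L ^ 2 ≤ y L * D := by
            rw [sq]
            exact mul_le_mul hxy (hxy.trans (hmax L)) (hx0 L) ((hx0 L).trans hxy)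
          have h3 : 0 ≤ y L * D := (sq_nonneg _).trans h2
          rw [div_le_div_iff₀ (by positivity) (by positivity)]
          calc x L ^ 2 * (2 * (e.1 : ℝ) + 1) ^ 2 ≤ y L * D * (2 * (e.1 : ℝ) + 1) ^ 2 := by gcongr
            _ = y L * D * (2 * (e.1 : ℝ) + 1) * (2 * (e.1 : ℝ) + 1) := by ring
            _ ≤ y L * D * (2 * (e.1 : ℝ) + 1) * (2 * (2 * (L : ℝ) + 1)) := by
                gcongr
                linarith
            _ = _ := by ring
    _ = 2 * (∑ L ∈ Finset.range (N + 1), y L) * D / (2 * (e.1 : ℝ) + 1) ^ 2 := by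
        rw [Finset.mul_sum, Finset.sum_mul, Finset.sum_div]
    _ ≤ _ := by gcongr

lemma gauntForm_add_le {u u' v : ℕ → ℝ} (hv : ∀ j, 0 ≤ v j) (N N' : ℕ) (e : HarmIdx) :
    gauntForm (fun L => u L + u' L) v N N' e ≤
      2 * gauntForm u v N N' e + 2 * gauntForm u' v N N' e := by
  simp only [gauntForm]
  rw [Finset.mul_sum, Finset.mul_sum, ← Finset.sum_add_distrib]
  refine Finset.sum_le_sum fun p _ => ?_
  have h1 : gauntMatrix (fun L => u L + u' L) N e p.1 p.2 =
      gauntMatrix u N e p.1 p.2 + gauntMatrix u' N e p.1 p.2 := by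
    simp only [gauntMatrix]
    rw [← Finset.sum_add_distrib]
    exact Finset.sum_congr rfl fun t _ => by push_cast; ring
  rw [h1]
  have h2 := norm_add_le (gauntMatrix u N e p.1 p.2) (gauntMatrix u' N e p.1 p.2)
  have h3 : ‖gauntMatrix u N e p.1 p.2 + gauntMatrix u' N e p.1 p.2‖ ^ 2 ≤
      2 * ‖gauntMatrix u N e p.1 p.2‖ ^ 2 + 2 * ‖gauntMatrix u' N e p.1 p.2‖ ^ 2 := by
    nlinarith [norm_nonneg (gauntMatrix u N e p.1 p.2 + gauntMatrix u' N e p.1 p.2),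
      sq_nonneg (‖gauntMatrix u N e p.1 p.2‖ - ‖gauntMatrix u' N e p.1 p.2‖)]
  have h4 := mul_le_mul_of_nonneg_left h3 (mul_nonneg (hv p.1.1) (hv p.2.1))
  linarith

section Bound

variable {Γ : ℕ → ℝ}

lemma sum_mul_cg0_sq_le (hs : Summable Γ) (h0 : ∀ l, 0 ≤ Γ l) (n a l N : ℕ) :
    ∑ L ∈ Finset.range N, gamHat Γ (n + 1) L * cg0 a L l ^ 2 ≤ gamStar Γ (n + 2) l a := by
  rw [gamStar_eq hs h0]
  refine Summable.sum_le_tsum _ (fun L _ => mul_nonneg (gamHat_nonneg h0 n L) (sq_nonneg _)) ?_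
  exact Summable.of_nonneg_of_le
    (fun L => mul_nonneg (gamHat_nonneg h0 n L) (sq_nonneg _))
    (fun L => mul_le_of_le_one_right (gamHat_nonneg h0 n L) (cg0_sq_le_one a L l))
    (summable_gamHat hs h0 n)

/-- The bound for the form with the weights of the contraction, in terms of bounds `A` and `B` for the
two conditional probabilities. The weight `Γ̂_{n+1,L}` is split at `L = l / 2`: for
small `L` the triangle inequality forces `j ≥ l / 2`, and the roles of the weights are exchanged. -/
lemma gauntForm_gamHat_le (hs : Summable Γ) (h0 : ∀ l, 0 ≤ Γ l) (n N N' : ℕ) (e : HarmIdx)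
    {G A B : ℝ} (hG : G = gamHat Γ (n + 2) e.1)
    (hA : ∀ L, gamHat Γ (n + 1) L * gamStar Γ 2 e.1 L ≤ G * A)
    (hB : ∀ a, gamStar Γ (n + 2) e.1 a * Γ a ≤ G * B) :
    gauntForm (fun L => ((4 * Real.pi) ^ n)⁻¹ * (gamHat Γ (n + 1) L / (2 * (L : ℝ) + 1)))
        (fun j => Γ j / (2 * (j : ℝ) + 1)) N N' e ≤
      4 * (A + B) * (((4 * Real.pi) ^ (n + 1))⁻¹ * (G / (2 * (e.1 : ℝ) + 1))) ^ 2 := by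
  obtain ⟨l, m⟩ := e
  set e : HarmIdx := ⟨l, m⟩
  have hpi := Real.pi_pos
  set κ : ℝ := ((4 * Real.pi) ^ (n + 1))⁻¹ with hκ
  have hκ0 : 0 ≤ κ := by positivity
  set a : ℕ → ℝ := fun L => ((4 * Real.pi) ^ n)⁻¹ * (gamHat Γ (n + 1) L / (2 * (L : ℝ) + 1)) with ha
  set v : ℕ → ℝ := fun j => Γ j / (2 * (j : ℝ) + 1) with hv
  have ha0 : ∀ L, 0 ≤ a L := fun L => by
    have := gamHat_nonneg h0 n L
    positivity
  have hv0 : ∀ j, 0 ≤ v j := fun j => div_nonneg (h0 j) (by positivity)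
  set aL : ℕ → ℝ := fun L => if 2 * L < l then a L else 0 with haL
  set aH : ℕ → ℝ := fun L => if 2 * L < l then 0 else a L with haH
  have hsplit : a = fun L => aL L + aH L := by
    ext L
    simp only [haL, haH]
    split_ifs <;> simp
  have haL0 : ∀ L, 0 ≤ aL L := fun L => by
    simp only [haL]
    split_ifs
    · exact ha0 L
    · exact le_rfl
  have haLle : ∀ L, aL L ≤ a L := fun L => by
    simp only [haL]
    split_ifs
    · exact le_rfl
    · exact ha0 L
  have haH0 : ∀ L, 0 ≤ aH L := fun L => by
    simp only [haH]
    split_ifs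
    · exact le_rfl
    · exact ha0 L
  have haHle : ∀ L, aH L ≤ a L := fun L => by
    simp only [haH]
    split_ifs
    · exact ha0 L
    · exact le_rfl
  have hterm : ∀ L j, a L * (v j * gauntWeight L j l) =
      κ * (gamHat Γ (n + 1) L * (Γ j * cg0 L j l ^ 2)) := fun L j => by
    simp only [ha, hv, hκ, gauntWeight]
    rw [cg0_sq, pow_succ]
    field_simp
  have hterm' : ∀ L j, v j * (a L * gauntWeight j L l) =
      κ * (Γ j * (gamHat Γ (n + 1) L * cg0 j L l ^ 2)) := fun L j => by
    rw [mul_left_comm, gauntWeight_swap, hterm, cg0_sq_comm]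
    ring
  have hhigh : gauntForm aH v N N' e ≤
      2 * (κ * G) * (κ * (G * A)) / (2 * (e.1 : ℝ) + 1) ^ 2 := by
    refine gauntForm_le_of_low_eq_zero
      (y := fun L => κ * (gamHat Γ (n + 1) L * gamStar Γ 2 l L)) haH0 hv0 (fun L => ?_)
      (fun L hL => ?_) ?_ (fun L => mul_le_mul_of_nonneg_left (hA L) hκ0)
    · have h1 : 0 ≤ ∑ j ∈ Finset.range (N' + 1), v j * gauntWeight L j l :=
        Finset.sum_nonneg fun j _ => mul_nonneg (hv0 j) (gauntWeight_nonneg _ _ _)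
      refine (mul_le_mul_of_nonneg_right (haHle L) h1).trans ?_
      rw [Finset.mul_sum]
      simp_rw [hterm]
      rw [← Finset.mul_sum, ← Finset.mul_sum]
      exact mul_le_mul_of_nonneg_left (mul_le_mul_of_nonneg_left
        (sum_mul_cg0_sq_le hs h0 0 L l (N' + 1)) (gamHat_nonneg h0 n L)) hκ0
    · have : aH L = 0 := if_pos hL
      rw [this, zero_mul]
    · rw [← Finset.mul_sum]
      refine mul_le_mul_of_nonneg_left ?_ hκ0
      rw [hG]
      exact sum_le_hasSum _ (fun L _ => mul_nonneg (gamHat_nonneg h0 n L)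
        (gamStar_nonneg hs h0 0 l L)) (hasSum_gamHat_mul_gamStar_two hs h0 n l)
  have hlow : gauntForm aL v N N' e ≤
      2 * (κ * G) * (κ * (G * B)) / (2 * (e.1 : ℝ) + 1) ^ 2 := by
    rw [gauntForm_comm]
    refine gauntForm_le_of_low_eq_zero
      (y := fun j => κ * (gamStar Γ (n + 2) l j * Γ j)) hv0 haL0 (fun j => ?_)
      (fun j hj => ?_) ?_ (fun j => mul_le_mul_of_nonneg_left (hB j) hκ0)
    · have h1 : ∑ L ∈ Finset.range (N + 1), aL L * gauntWeight j L l ≤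
          ∑ L ∈ Finset.range (N + 1), a L * gauntWeight j L l :=
        Finset.sum_le_sum fun L _ =>
          mul_le_mul_of_nonneg_right (haLle L) (gauntWeight_nonneg _ _ _)
      refine (mul_le_mul_of_nonneg_left h1 (hv0 j)).trans ?_
      rw [Finset.mul_sum]
      simp_rw [hterm']
      rw [← Finset.mul_sum, ← Finset.mul_sum, mul_comm (gamStar Γ (n + 2) l j)]
      exact mul_le_mul_of_nonneg_left (mul_le_mul_of_nonneg_left
        (sum_mul_cg0_sq_le hs h0 n j l (N + 1)) (h0 j)) hκ0
    · have hj' : 2 * j < l := hj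
      rw [Finset.sum_eq_zero fun L _ => ?_, mul_zero]
      simp only [haL]
      split_ifs with hL
      · change a L * gauntWeight j L l = 0
        rw [gauntWeight, threeJSq_eq_zero (by omega)]
        simp
      · simp
    · rw [← Finset.mul_sum]
      refine mul_le_mul_of_nonneg_left ?_ hκ0
      rw [hG]
      exact sum_le_hasSum _ (fun j _ => mul_nonneg (gamStar_nonneg hs h0 n l j) (h0 j))
        (hasSum_gamStar_mul hs h0 n l)
  rw [hsplit]
  calc _ ≤ 2 * gauntForm aL v N N' e + 2 * gauntForm aH v N N' e := gauntForm_add_le hv0 N N' e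
    _ ≤ 2 * (2 * (κ * G) * (κ * (G * B)) / (2 * (e.1 : ℝ) + 1) ^ 2) +
        2 * (2 * (κ * G) * (κ * (G * A)) / (2 * (e.1 : ℝ) + 1) ^ 2) := by gcongr
    _ = _ := by field_simp; ring

end Bound

section Contraction

variable {Ω : Type*} [MeasurableSpace Ω] {P : Measure Ω} {T : S2 → Ω → ℝ}

lemma powerSpec_one_eq (l : ℕ) : powerSpec P T 1 l = gam P T l / (2 * (l : ℝ) + 1) := by
  rw [gam]
  field_simp

/-- The contraction of order `q - 1` as a double sum over single indices, with `e = (l, -m)`. -/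
lemma contraction_eq (n : ℕ) (e : HarmIdx) :
    contraction P T (n + 2) (n + 1) (-(e.2 : ℤ)) e.1 = ((powerSpec P T (n + 2) e.1) ^ 2)⁻¹ *
      ∑' p : HarmIdx × HarmIdx, powerSpec P T 1 p.1.1 * powerSpec P T 1 p.2.1 *
        ‖∑' r : Fin (n + 1) → HarmIdx, ((∏ i, powerSpec P T 1 (r i).1 : ℝ) : ℂ) *
          prodG r p.1 e * prodG r p.2 e‖ ^ 2 := by
  -- the number `n + 2 - (n + 1)` of free indices is generalized to `d` before it is replaced by `1`
  have key : ∀ d : ℕ, d = 1 →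
      ∑' t : (Fin d → HarmIdx) × (Fin d → HarmIdx),
        ((∏ i, powerSpec P T 1 (t.1 i).1) * (∏ i, powerSpec P T 1 (t.2 i).1)) *
          ‖∑' r : Fin (n + 1) → HarmIdx, ((∏ i, powerSpec P T 1 (r i).1 : ℝ) : ℂ) *
            gaunt (List.ofFn (fun i => (r i).pair) ++ List.ofFn (fun i => (t.1 i).pair)
              ++ [(e.1, -(-(e.2 : ℤ)))]) *
            gaunt (List.ofFn (fun i => (r i).pair) ++ List.ofFn (fun i => (t.2 i).pair)
              ++ [(e.1, -(-(e.2 : ℤ)))])‖ ^ 2 =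
      ∑' p : HarmIdx × HarmIdx, powerSpec P T 1 p.1.1 * powerSpec P T 1 p.2.1 *
        ‖∑' r : Fin (n + 1) → HarmIdx, ((∏ i, powerSpec P T 1 (r i).1 : ℝ) : ℂ) *
          prodG r p.1 e * prodG r p.2 e‖ ^ 2 := by
    rintro d rfl
    rw [← (((Equiv.funUnique (Fin 1) HarmIdx).symm.prodCongr
      (Equiv.funUnique (Fin 1) HarmIdx).symm)).tsum_eq]
    refine tsum_congr fun p => ?_
    have h1 : ∀ s : HarmIdx, List.ofFn (fun i : Fin 1 =>
        (((Equiv.funUnique (Fin 1) HarmIdx).symm s) i).pair) = [s.pair] := fun s => by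
      simp
    have h2 : ((e.1, -(-(e.2 : ℤ))) : ℕ × ℤ) = e.pair := by simp [HarmIdx.pair]
    simp only [Equiv.prodCongr_apply, Prod.map_fst, Prod.map_snd, h1, h2, gaunt_eq_prodG]
    simp
  rw [contraction, key _ (by omega)]

variable [IsProbabilityMeasure P]

/-- The contraction is controlled by the two conditional probabilities. -/
lemma contraction_le (hT : IsIsotropicGaussianField P T) (n : ℕ) (e : HarmIdx) {A B : ℝ}
    (hA : ∀ L, gamHat (gam P T) (n + 1) L * gamStar (gam P T) 2 e.1 L ≤
      gamHat (gam P T) (n + 2) e.1 * A)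
    (hB : ∀ a, gamStar (gam P T) (n + 2) e.1 a * gam P T a ≤ gamHat (gam P T) (n + 2) e.1 * B)
    (hA0 : 0 ≤ A) (hB0 : 0 ≤ B) :
    contraction P T (n + 2) (n + 1) (-(e.2 : ℤ)) e.1 ≤ 4 * (A + B) := by
  have hs := summable_gam hT
  have h0 : ∀ l, 0 ≤ gam P T l := gam_nonneg
  set G := gamHat (gam P T) (n + 2) e.1 with hG
  set c := ((4 * Real.pi) ^ (n + 1))⁻¹ * (G / (2 * (e.1 : ℝ) + 1)) with hc
  have hps : powerSpec P T (n + 2) e.1 = ((n + 2).factorial : ℝ) * c := by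
    rw [powerSpec_eq_gamHat hT (n + 1), hc]
    ring
  have hfact : (1 : ℝ) ≤ ((n + 2).factorial : ℝ) := by
    exact_mod_cast Nat.succ_le_of_lt (Nat.factorial_pos _)
  have hsum : ∑' p : HarmIdx × HarmIdx, powerSpec P T 1 p.1.1 * powerSpec P T 1 p.2.1 *
        ‖∑' r : Fin (n + 1) → HarmIdx, ((∏ i, powerSpec P T 1 (r i).1 : ℝ) : ℂ) *
          prodG r p.1 e * prodG r p.2 e‖ ^ 2 ≤ 4 * (A + B) * c ^ 2 := by
    refine tsum_le_of_sum_le' (by positivity) fun u => ?_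
    set N' := u.sup (fun p => max p.1.1 p.2.1) with hN'
    have hsub : u ⊆ idxLe N' ×ˢ idxLe N' := fun p hp => by
      have h1 : max p.1.1 p.2.1 ≤ N' := Finset.le_sup (f := fun p : HarmIdx × HarmIdx =>
        max p.1.1 p.2.1) hp
      rw [Finset.mem_product, mem_idxLe, mem_idxLe]
      exact ⟨(le_max_left _ _).trans h1, (le_max_right _ _).trans h1⟩
    refine (Finset.sum_le_sum_of_subset_of_nonneg hsub fun p _ _ =>
      mul_nonneg (mul_nonneg (powerSpec_nonneg _ _) (powerSpec_nonneg _ _)) (sq_nonneg _)).trans ?_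
    refine le_trans (le_of_eq ?_)
      (gauntForm_gamHat_le hs h0 n (N' + e.1) N' e hG hA hB)
    rw [gauntForm]
    refine Finset.sum_congr rfl fun p hp => ?_
    rw [Finset.mem_product, mem_idxLe, mem_idxLe] at hp
    simp_rw [powerSpec_one_eq]
    rw [tsum_prodG_mul_prodG hs h0 n p.1 p.2 e (N := N' + e.1) (by omega)]
  rw [contraction_eq, hps]
  by_cases hc0 : c = 0
  · rw [hc0, mul_zero, zero_pow (by norm_num), inv_zero, zero_mul]
    positivity
  · have hc2 : 0 < c ^ 2 := by positivity
    calc _ ≤ ((((n + 2).factorial : ℝ) * c) ^ 2)⁻¹ * (4 * (A + B) * c ^ 2) :=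
          mul_le_mul_of_nonneg_left hsum (by positivity)
      _ = 4 * (A + B) * (((n + 2).factorial : ℝ) ^ 2)⁻¹ := by
          field_simp
      _ ≤ 4 * (A + B) := by
          refine mul_le_of_le_one_right (by positivity) (inv_le_one_of_one_le₀ ?_)
          exact one_le_pow₀ hfact

/-- The contraction tends to zero if both suprema do. -/
lemma tendsto_contraction (hT : IsIsotropicGaussianField P T) (n : ℕ)
    (h : Tendsto (fun l : ℕ =>
      (⨆ lam : ℕ, gamHat (gam P T) (n + 1) lam * gamStar (gam P T) 2 l lam /
          gamHat (gam P T) (n + 2) l) +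
        ⨆ lam : ℕ, gamStar (gam P T) (n + 2) l lam * gam P T lam /
          gamHat (gam P T) (n + 2) l) atTop (𝓝 0)) (m : ℤ) :
    Tendsto (fun l : ℕ => contraction P T (n + 2) (n + 1) m l) atTop (𝓝 0) := by
  have hs := summable_gam hT
  have h0 : ∀ l, 0 ≤ gam P T l := gam_nonneg
  refine squeeze_zero' (Eventually.of_forall fun l => ?_) ?_ (by simpa using h.const_mul 4)
  · exact mul_nonneg (by positivity) (tsum_nonneg fun t => mul_nonneg (mul_nonneg
      (Finset.prod_nonneg fun i _ => powerSpec_nonneg _ _)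
      (Finset.prod_nonneg fun i _ => powerSpec_nonneg _ _)) (sq_nonneg _))
  filter_upwards [eventually_ge_atTop m.natAbs] with l hl
  have hG0 := gamHat_nonneg h0 (n + 1) l
  -- both families are nonnegative with sum `Γ̂_{n+2,l}`, hence their quotients are bounded
  have key : ∀ f : ℕ → ℝ, (∀ k, 0 ≤ f k) → HasSum f (gamHat (gam P T) (n + 2) l) →
      (∀ k, f k ≤ gamHat (gam P T) (n + 2) l * ⨆ k, f k / gamHat (gam P T) (n + 2) l) ∧
        0 ≤ ⨆ k, f k / gamHat (gam P T) (n + 2) l := by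
    intro f hf hsum
    have hle : ∀ k, f k ≤ gamHat (gam P T) (n + 2) l := fun k => le_hasSum hsum k fun j _ => hf j
    have hbdd : BddAbove (Set.range fun k => f k / gamHat (gam P T) (n + 2) l) := by
      refine ⟨1, ?_⟩
      rintro _ ⟨k, rfl⟩
      exact div_le_one_of_le₀ (hle k) hG0
    refine ⟨fun k => ?_, Real.iSup_nonneg fun k => div_nonneg (hf k) hG0⟩
    rcases hG0.eq_or_lt with hz | hpos
    · rw [← hz, zero_mul]
      exact (hle k).trans hz.symm.le
    · rw [← div_le_iff₀' hpos]
      exact le_ciSup hbdd k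
  obtain ⟨hA, hA0⟩ := key _ (fun k => mul_nonneg (gamHat_nonneg h0 n k)
    (gamStar_nonneg hs h0 0 l k)) (hasSum_gamHat_mul_gamStar_two hs h0 n l)
  obtain ⟨hB, hB0⟩ := key _ (fun k => mul_nonneg (gamStar_nonneg hs h0 n l k) (h0 k))
    (hasSum_gamStar_mul hs h0 n l)
  have hm : -m ∈ Finset.Icc (-(l : ℤ)) (l : ℤ) := by
    rw [Finset.mem_Icc]
    omega
  have := contraction_le hT n ⟨l, ⟨-m, hm⟩⟩ hA hB hA0 hB0
  simpa using this

end Contraction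

/-! ### The Markov chain of Clebsch-Gordan coefficients -/

lemma cond_real_eq_div {Ω' : Type*} [MeasurableSpace Ω'] {Q : Measure Ω'} {E F : Set Ω'} (hE : MeasurableSet E) :
    (cond Q E).real F = Q.real (E ∩ F) / Q.real E := by
  rw [measureReal_def, cond_apply hE, ENNReal.toReal_mul, ENNReal.toReal_inv, div_eq_inv_mul]
  rfl

section Walk

variable {Ω' : Type*} [MeasurableSpace Ω'] {Q : Measure Ω'} [IsProbabilityMeasure Q]
  {Γ : ℕ → ℝ} {Z : ℕ → Ω' → ℕ}

/-- The one-step transition probability of the chain. -/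
noncomputable def cgStep (Γ : ℕ → ℝ) (L l : ℕ) : ℝ := ∑' k, Γ k / (∑' k', Γ k') * cg0 k L l ^ 2

lemma cgStep_nonneg (h0 : ∀ l, 0 ≤ Γ l) (L l : ℕ) : 0 ≤ cgStep Γ L l :=
  tsum_nonneg fun k => mul_nonneg (div_nonneg (h0 k) (tsum_nonneg h0)) (sq_nonneg _)

lemma cgStep_eq (Γ : ℕ → ℝ) (L l : ℕ) :
    cgStep Γ L l = (∑' k, Γ k * cg0 L k l ^ 2) / ∑' k, Γ k := by
  rw [cgStep, ← tsum_div_const]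
  exact tsum_congr fun k => by rw [cg0_sq_comm]; ring

lemma cgStep_eq_gamStar (hs : Summable Γ) (h0 : ∀ l, 0 ≤ Γ l) (L l : ℕ) :
    cgStep Γ L l = gamStar Γ 2 l L / ∑' k, Γ k := by
  rw [cgStep_eq, gamStar_eq hs h0 0]
  rfl

/-- The Markov property for events that are determined by `Z_1` and `Z_n`: both sides are measures
in the history `(Z_1, ..., Z_n)`, and they agree on single histories. -/
lemma measureReal_step (h0 : ∀ l, 0 ≤ Γ l) (hZ : IsCGWalk Q Γ Z) (S : Set ℕ) (n : ℕ) (hn : 1 ≤ n)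
    (L l : ℕ) :
    Q.real {ω | (Z 1 ω ∈ S ∧ Z n ω = L) ∧ Z (n + 1) ω = l} =
      Q.real {ω | Z 1 ω ∈ S ∧ Z n ω = L} * cgStep Γ L l := by
  classical
  set W : Ω' → (Finset.Icc 1 n → ℕ) := fun ω k => Z k ω with hW
  have hWm : Measurable W := measurable_pi_lambda _ fun k => hZ.measurable k
  set A : Set (Finset.Icc 1 n → ℕ) :=
    {h | h ⟨1, Finset.mem_Icc.2 ⟨le_rfl, hn⟩⟩ ∈ S ∧ h ⟨n, Finset.mem_Icc.2 ⟨hn, le_rfl⟩⟩ = L}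
    with hA
  have hAm : MeasurableSet A := A.to_countable.measurableSet
  have hEm : MeasurableSet {ω | Z (n + 1) ω = l} :=
    hZ.measurable (n + 1) (measurableSet_singleton l)
  have hmeas : ((Q.restrict {ω | Z (n + 1) ω = l}).map W).restrict A =
      ENNReal.ofReal (cgStep Γ L l) • (Q.map W).restrict A := by
    refine Measure.ext_of_singleton fun h => ?_
    have hsm : MeasurableSet ({h} : Set (Finset.Icc 1 n → ℕ)) := measurableSet_singleton h
    rw [Measure.smul_apply, Measure.restrict_apply hsm, Measure.restrict_apply hsm]
    by_cases hhA : h ∈ A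
    · rw [Set.singleton_inter_of_mem hhA, Measure.map_apply hWm hsm, Measure.map_apply hWm hsm,
        Measure.restrict_apply (hWm hsm)]
      set i : ℕ → ℕ := fun k => if hk : k ∈ Finset.Icc 1 n then h ⟨k, hk⟩ else l with hi
      have hin : i n = L := by
        have hk : n ∈ Finset.Icc 1 n := Finset.mem_Icc.2 ⟨hn, le_rfl⟩
        simp only [hi, dif_pos hk]
        exact hhA.2
      have hin1 : i (n + 1) = l := by
        have hk : n + 1 ∉ Finset.Icc 1 n := by simp
        simp only [hi, dif_neg hk]
      have e1 : W ⁻¹' {h} = {ω | ∀ k ∈ Finset.Icc 1 n, Z k ω = i k} := by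
        ext ω
        simp only [Set.mem_preimage, Set.mem_singleton_iff, Set.mem_ofPred_eq, funext_iff, hW,
          Subtype.forall]
        refine forall_congr' fun k => forall_congr' fun hk => ?_
        simp only [hi, dif_pos hk]
      have e2 : W ⁻¹' {h} ∩ {ω | Z (n + 1) ω = l} =
          {ω | ∀ k ∈ Finset.Icc 1 (n + 1), Z k ω = i k} := by
        rw [e1]
        ext ω
        simp only [Set.mem_inter_iff, Set.mem_ofPred_eq]
        constructor
        · rintro ⟨h1, h2⟩ k hk
          rcases Nat.lt_or_ge n k with hlt | hge
          · have : k = n + 1 := by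
              have := (Finset.mem_Icc.1 hk).2
              omega
            rw [this, hin1, h2]
          · exact h1 k (Finset.mem_Icc.2 ⟨(Finset.mem_Icc.1 hk).1, hge⟩)
        · intro h1
          refine ⟨fun k hk => h1 k ?_, ?_⟩
          · rw [Finset.mem_Icc] at hk ⊢
            omega
          · rw [h1 (n + 1) (by simp), hin1]
      have hmk := hZ.markov n hn i
      rw [hin, hin1, ← e1, ← e2] at hmk
      rw [smul_eq_mul, ← ENNReal.toReal_eq_toReal_iff' (measure_ne_top _ _)
        (ENNReal.mul_ne_top ENNReal.ofReal_ne_top (measure_ne_top _ _)),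
        ENNReal.toReal_mul, ENNReal.toReal_ofReal (cgStep_nonneg h0 L l), mul_comm]
      exact hmk
    · rw [Set.singleton_inter_eq_empty.2 hhA]
      simp
  have h1 := congrArg (fun μ => μ Set.univ) hmeas
  simp only [Measure.smul_apply, Measure.restrict_apply_univ, smul_eq_mul] at h1
  rw [Measure.map_apply hWm hAm, Measure.map_apply hWm hAm,
    Measure.restrict_apply (hWm hAm)] at h1
  have h2 := congrArg ENNReal.toReal h1
  rw [ENNReal.toReal_mul, ENNReal.toReal_ofReal (cgStep_nonneg h0 L l), mul_comm] at h2
  exact h2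

lemma hasSum_measureReal_and_eq {X : Ω' → ℕ} (hX : Measurable X) (E : Set Ω') :
    HasSum (fun L => Q.real {ω | ω ∈ E ∧ X ω = L}) (Q.real E) := by
  have h1 : ∑' L, Q {ω | ω ∈ E ∧ X ω = L} = Q E := by
    have := tsum_measure_preimage_singleton (μ := Q.restrict E) (s := (Set.univ : Set ℕ))
      Set.countable_univ (f := X) (fun y _ => hX (measurableSet_singleton y))
    rw [tsum_univ (fun y => (Q.restrict E) (X ⁻¹' {y})), Set.preimage_univ,
      Measure.restrict_apply_univ] at this
    rw [← this]
    refine tsum_congr fun L => ?_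
    rw [Measure.restrict_apply (hX (measurableSet_singleton L)), Set.inter_comm]
    rfl
  have h2 : ∑' L, Q {ω | ω ∈ E ∧ X ω = L} ≠ ⊤ := h1 ▸ measure_ne_top _ _
  have h3 := ENNReal.hasSum_toReal h2
  rw [← ENNReal.tsum_toReal_eq fun L => measure_ne_top _ _, h1] at h3
  exact h3

/-- The law of `Z_{n+1}` on the event `Z_1 ∈ S`. -/
lemma measureReal_succ (h0 : ∀ l, 0 ≤ Γ l) (hZ : IsCGWalk Q Γ Z) (S : Set ℕ) (n : ℕ) (hn : 1 ≤ n)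
    {u : ℕ → ℝ} {c : ℝ} (hu : ∀ L, Q.real {ω | Z 1 ω ∈ S ∧ Z n ω = L} = c * u L) (l : ℕ) :
    Q.real {ω | Z 1 ω ∈ S ∧ Z (n + 1) ω = l} = c * (cgConv u Γ l / ∑' k, Γ k) := by
  have h1 := (hasSum_measureReal_and_eq (Q := Q) (hZ.measurable n)
    {ω | Z 1 ω ∈ S ∧ Z (n + 1) ω = l}).tsum_eq
  rw [← h1, cgConv, ← tsum_div_const, ← tsum_mul_left]
  refine tsum_congr fun L => ?_
  have h2 : {ω | ω ∈ {ω | Z 1 ω ∈ S ∧ Z (n + 1) ω = l} ∧ Z n ω = L} =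
      {ω | (Z 1 ω ∈ S ∧ Z n ω = L) ∧ Z (n + 1) ω = l} := by
    ext ω
    simp only [Set.mem_ofPred_eq]
    tauto
  rw [h2, measureReal_step h0 hZ S n hn, hu, cgStep_eq, mul_assoc, mul_div_assoc', ← tsum_mul_left]
  simp_rw [mul_assoc]

lemma measureReal_eq_gamHat (h0 : ∀ l, 0 ≤ Γ l) (hZ : IsCGWalk Q Γ Z) (n l : ℕ) :
    Q.real {ω | Z (n + 1) ω = l} = ((∑' k, Γ k) ^ (n + 1))⁻¹ * gamHat Γ (n + 1) l := by
  have h : ∀ l, Q.real {ω | Z 1 ω ∈ Set.univ ∧ Z (n + 1) ω = l} =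
      ((∑' k, Γ k) ^ (n + 1))⁻¹ * gamHat Γ (n + 1) l := by
    induction n with
    | zero =>
      intro l
      simp only [Set.mem_univ, true_and, zero_add, hZ.init, gamHat, pow_one]
      ring
    | succ n ih =>
      intro l
      rw [measureReal_succ h0 hZ Set.univ (n + 1) (by omega) ih, gamHat_add_two,
        pow_succ _ (n + 1), mul_inv]
      ring
  simpa using h l

/-- The joint law of the initial position and a later one. -/
lemma measureReal_eq_cgIter (h0 : ∀ l, 0 ≤ Γ l) (hZ : IsCGWalk Q Γ Z) (n a l : ℕ) :
    Q.real {ω | Z 1 ω = a ∧ Z (n + 1) ω = l} =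
      ((∑' k, Γ k) ^ (n + 1))⁻¹ * Γ a * cgIter Γ a n l := by
  have h : ∀ l, Q.real {ω | Z 1 ω ∈ ({a} : Set ℕ) ∧ Z (n + 1) ω = l} =
      ((∑' k, Γ k) ^ (n + 1))⁻¹ * Γ a * cgIter Γ a n l := by
    induction n with
    | zero =>
      intro l
      by_cases hal : l = a
      · subst hal
        simp only [Set.mem_singleton_iff, zero_add, and_self, hZ.init, cgIter, pow_one,
          Pi.single_eq_same]
        ring
      · have : {ω | Z 1 ω ∈ ({a} : Set ℕ) ∧ Z (0 + 1) ω = l} = ∅ := by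
          ext ω
          simp only [Set.mem_singleton_iff, zero_add, Set.mem_ofPred_eq, Set.mem_empty_iff_false,
            iff_false]
          omega
        rw [this, cgIter, Pi.single_eq_of_ne hal]
        simp
    | succ n ih =>
      intro l
      rw [measureReal_succ h0 hZ {a} (n + 1) (by omega) ih, cgIter, pow_succ _ (n + 1), mul_inv]
      ring
  simpa using h l

/-- The conditional law of the last but one position. -/
lemma cond_last (hs : Summable Γ) (h0 : ∀ l, 0 ≤ Γ l) (hpos : 0 < ∑' k, Γ k)
    (hZ : IsCGWalk Q Γ Z) (n l lam : ℕ) :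
    (cond Q {ω | Z (n + 2) ω = l}).real {ω | Z (n + 1) ω = lam} =
      gamHat Γ (n + 1) lam * gamStar Γ 2 l lam / gamHat Γ (n + 2) l := by
  have h1 := measureReal_step h0 hZ Set.univ (n + 1) (by omega) lam l
  simp only [Set.mem_univ, true_and] at h1
  rw [measureReal_eq_gamHat h0 hZ, cgStep_eq_gamStar hs h0] at h1
  have h2 : {ω | Z (n + 2) ω = l} ∩ {ω | Z (n + 1) ω = lam} =
      {ω | Z (n + 1) ω = lam ∧ Z (n + 1 + 1) ω = l} := by
    ext ω
    simp only [Set.mem_inter_iff, Set.mem_ofPred_eq]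
    tauto
  have hE : MeasurableSet {ω | Z (n + 2) ω = l} :=
    hZ.measurable (n + 2) (measurableSet_singleton l)
  rw [cond_real_eq_div hE, h2, h1,
    measureReal_eq_gamHat h0 hZ (n + 1), show n + 1 + 1 = n + 2 from rfl,
    show ((∑' k, Γ k) ^ (n + 1))⁻¹ * gamHat Γ (n + 1) lam * (gamStar Γ 2 l lam / ∑' k, Γ k) =
      ((∑' k, Γ k) ^ (n + 2))⁻¹ * (gamHat Γ (n + 1) lam * gamStar Γ 2 l lam) by
      rw [pow_succ _ (n + 1), mul_inv]; ring]
  exact mul_div_mul_left _ _ (by positivity)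

/-- The conditional law of the initial position. -/
lemma cond_first (hs : Summable Γ) (h0 : ∀ l, 0 ≤ Γ l) (hpos : 0 < ∑' k, Γ k)
    (hZ : IsCGWalk Q Γ Z) (n l lam : ℕ) :
    (cond Q {ω | Z (n + 2) ω = l}).real {ω | Z 1 ω = lam} =
      gamStar Γ (n + 2) l lam * Γ lam / gamHat Γ (n + 2) l := by
  have h1 := measureReal_eq_cgIter h0 hZ (n + 1) lam l
  have h2 : {ω | Z (n + 2) ω = l} ∩ {ω | Z 1 ω = lam} =
      {ω | Z 1 ω = lam ∧ Z (n + 1 + 1) ω = l} := by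
    ext ω
    simp only [Set.mem_inter_iff, Set.mem_ofPred_eq]
    tauto
  have hE : MeasurableSet {ω | Z (n + 2) ω = l} :=
    hZ.measurable (n + 2) (measurableSet_singleton l)
  rw [cond_real_eq_div hE, h2, h1,
    measureReal_eq_gamHat h0 hZ (n + 1), gamStar_eq_cgIter hs h0, show n + 1 + 1 = n + 2 from rfl,
    mul_assoc, mul_comm (Γ lam)]
  exact mul_div_mul_left _ _ (by positivity)

end Walk

end HighFreq

theorem proposition5 {Ω : Type*} [MeasurableSpace Ω] (P : MeasureTheory.Measure Ω)
    [MeasureTheory.IsProbabilityMeasure P] (T : HighFreq.S2 → Ω → ℝ)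
    (hT : HighFreq.IsIsotropicGaussianField P T)
    (hC : ∀ l : ℕ, 0 < HighFreq.powerSpec P T 1 l)
    (q : ℕ) (hq : 4 ≤ q) (Γ : ℕ → ℝ) (hΓ : Γ = HighFreq.gam P T) :
    (∀ l : ℕ, ∑' L : ℕ, HighFreq.gamHat Γ (q - 1) L * HighFreq.gamStar Γ 2 l L =
        HighFreq.gamHat Γ q l) ∧
    (∀ {Ω' : Type*} [MeasurableSpace Ω'] (Q : MeasureTheory.Measure Ω')
        [MeasureTheory.IsProbabilityMeasure Q] (Z : ℕ → Ω' → ℕ), HighFreq.IsCGWalk Q Γ Z →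
        ∀ l lam : ℕ,
          (ProbabilityTheory.cond Q {ω | Z q ω = l}).real {ω | Z (q - 1) ω = lam} =
              HighFreq.gamHat Γ (q - 1) lam * HighFreq.gamStar Γ 2 l lam /
                HighFreq.gamHat Γ q l ∧
          (ProbabilityTheory.cond Q {ω | Z q ω = l}).real {ω | Z 1 ω = lam} =
              HighFreq.gamStar Γ q l lam * Γ lam / HighFreq.gamHat Γ q l) ∧
    (Filter.Tendsto
        (fun l : ℕ =>
          (⨆ lam : ℕ, HighFreq.gamHat Γ (q - 1) lam * HighFreq.gamStar Γ 2 l lam /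
              HighFreq.gamHat Γ q l) +
            ⨆ lam : ℕ, HighFreq.gamStar Γ q l lam * Γ lam / HighFreq.gamHat Γ q l)
        Filter.atTop (nhds 0) →
      ∀ m : ℤ,
        Filter.Tendsto (fun l : ℕ => HighFreq.contraction P T q (q - 1) m l)
          Filter.atTop (nhds 0)) := by
  subst hΓ
  obtain ⟨n, rfl⟩ : ∃ n, q = n + 2 := ⟨q - 2, by omega⟩
  have hs := HighFreq.summable_gam hT
  have h0 : ∀ l, 0 ≤ HighFreq.gam P T l := HighFreq.gam_nonneg
  have hpos : 0 < ∑' k, HighFreq.gam P T k :=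
    hs.tsum_pos h0 0 (mul_pos (by positivity) (hC 0))
  rw [show n + 2 - 1 = n + 1 from rfl]
  refine ⟨fun l => (HighFreq.hasSum_gamHat_mul_gamStar_two hs h0 n l).tsum_eq, ?_,
    HighFreq.tendsto_contraction hT n⟩
  intro Ω' _ Q _ Z hZ l lam
  exact ⟨HighFreq.cond_last hs h0 hpos hZ n l lam, HighFreq.cond_first hs h0 hpos hZ n l lam⟩
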